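/- Let $n\ge 1$ be an integer, let $\gamma\in[0,1]$, and put $\beta:=\frac{2}{2-\gamma}$ and $Q:=\mathbb{R}^n\times(0,\infty)$. For $p\in\mathbb{R}$ write $u_+^{p}:=\chi_{\{u>0\}}u^{p}$ (so $u_+^0=\chi_{\{u>0\}}$). Let $R>0$, and consider functions $U:[0,\infty)\to[0,\infty)$ that are positive and of class $C^2$ in $(R,\infty)$, vanish on $[0,R]$, and satisfy $$ U''+\Big(\frac{n-1}{r}+\frac r2\Big)U'-\frac{\beta}{2}U=\gamma U^{\gamma-1}\ \text{ in }(R,\infty),\qquad U(R)=0,\qquad (U^{1/\beta})'(R)=\frac{\sqrt2}{\beta},\tag{1} $$ where the last derivative is the right derivative at $R$. (i) For every $R>0$ there is a solution $U$ of (1) which is (positive and) strictly increasing in $[R,\infty)$ and satisfies $\lim_{r\to\infty}U(r)/r^\beta=c$ for some $c>0$. (ii) For every $R>0$ and every solution $U$ of (1), let $u(x,t):=t^{\beta/2}\,U(t^{-1/2}|x|)$ for $(x,t)\in Q$. Then $\{(x,t)\in Q: u(x,t)=0\}=\{(x,t): t>0,\ |x|^2\le R^2t\}$. If $\gamma\in(0,1]$,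 then $u$ is a weak solution of $\partial_tu-\Delta u=-\frac{\mathrm d}{\mathrm du}u_+^\gamma$ in $Q$; if $\gamma=0$, then $u$ is a solution in $Q$ in the sense of domain variations. Here $u$ is a weak solution in $Q$ if for every bounded open $\Omega\subset\mathbb{R}^n$ and every bounded open interval $I$ with $\overline{\Omega\times I}\subset Q$ one has: (a) $u\in L^2(I;H^1(\Omega))$ and $\partial_tu\in L^2(\Omega\times I)$ (weak derivatives); (b) $u_+^{\gamma-1}\in L^1(\Omega\times I)$; (c) $\int_{\Omega\times I}\partial_tu\,\varphi+\nabla u\cdot\nabla\varphi+\gamma u_+^{\gamma-1}\varphi=0$ for all $\varphi\in C_c^\infty(\Omega\times I)$; (d) $$ \int_{\Omega\times I}\big(|\nabla u|^2+2u_+^\gamma\big)\,\mathrm{div}_x\Phi-2\,\nabla u\cdot D_x\Phi\cdot\nabla u-2\,\partial_tu\,(\nabla u\cdot\Phi)=0 $$ for all $\Phi\in C_c^\infty(\Omega\times I;\mathbb{R}^{n+1})$, where $\nabla$, $\mathrm{div}_x$ and $D_x$ involve only the $n$ spatial variables and the first $n$ components of $\Phi$. It is a solution in the sense of domain variations if (a)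 and (d) hold for all such $\Omega$ and $I$. -/

import Mathlib

open scoped ContDiff

/-- Space-time `ℝⁿ × ℝ`; a point is `z = (x, t)`. -/
abbrev Spacetime (n : ℕ) : Type := EuclideanSpace ℝ (Fin n) × ℝ

/-- The upper half space-time `Q = ℝⁿ × (0, ∞)`. -/
def upperSpacetime (n : ℕ) : Set (Spacetime n) := {z | 0 < z.2}

/-- The scaling exponent `β = 2 / (2 - γ)`. -/
noncomputable def scalingExponent (γ : ℝ) : ℝ := 2 / (2 - γ)

/-- The power `s₊ ^ p := χ_{s > 0} s ^ p`, which vanishes for `s ≤ 0` whatever `p` is.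
For `p = 0` this is the indicator of `s > 0`. -/
noncomputable def posPartPow (p s : ℝ) : ℝ := if 0 < s then s ^ p else 0

/-- `φ ∈ C_c^∞(W; F)`. -/
def IsTestFunction {n : ℕ} {F : Type*} [NormedAddCommGroup F] [NormedSpace ℝ F]
    (W : Set (Spacetime n)) (φ : Spacetime n → F) : Prop :=
  ContDiff ℝ ∞ φ ∧ HasCompactSupport φ ∧ tsupport φ ⊆ W

/-- The directional derivative of `φ` at `z` in the spatial direction `v`. -/
noncomputable def spatialDeriv {n : ℕ} {F : Type*} [NormedAddCommGroup F] [NormedSpace ℝ F]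
    (φ : Spacetime n → F) (z : Spacetime n) (v : EuclideanSpace ℝ (Fin n)) : F :=
  fderiv ℝ φ z (v, 0)

/-- The time derivative of `φ` at `z`. -/
noncomputable def timeDeriv {n : ℕ} {F : Type*} [NormedAddCommGroup F] [NormedSpace ℝ F]
    (φ : Spacetime n → F) (z : Spacetime n) : F :=
  fderiv ℝ φ z (0, 1)

/-- `div_x Φ = ∑ⱼ ∂_{xⱼ} Φʲ`, the sum running over the `n` spatial coordinates. -/
noncomputable def spatialDiv {n : ℕ} (Φ : Spacetime n → Spacetime n) (z : Spacetime n) : ℝ :=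
  ∑ j : Fin n, (spatialDeriv Φ z (EuclideanSpace.single j 1)).1 j

/-- `G` is the weak spatial gradient of `u` in `W`. -/
def IsWeakSpatialGradient {n : ℕ} (W : Set (Spacetime n)) (u : Spacetime n → ℝ)
    (G : Spacetime n → EuclideanSpace ℝ (Fin n)) : Prop :=
  ∀ φ : Spacetime n → ℝ, IsTestFunction W φ → ∀ v : EuclideanSpace ℝ (Fin n),
    ∫ z in W, u z * spatialDeriv φ z v = - ∫ z in W, inner ℝ (G z) v * φ z

/-- `D` is the weak time derivative of `u` in `W`. -/
def IsWeakTimeDeriv {n : ℕ} (W : Set (Spacetime n)) (u D : Spacetime n → ℝ) : Prop :=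
  ∀ φ : Spacetime n → ℝ, IsTestFunction W φ →
    ∫ z in W, u z * timeDeriv φ z = - ∫ z in W, D z * φ z

/-- `u ∈ L²(I; H¹(Ω))` and `∂ₜ u ∈ L²(Ω × I)` on `W = Ω × I`, with weak spatial gradient `G` and
weak time derivative `D`. -/
structure InEnergySpace {n : ℕ} (W : Set (Spacetime n)) (u : Spacetime n → ℝ)
    (G : Spacetime n → EuclideanSpace ℝ (Fin n)) (D : Spacetime n → ℝ) : Prop where
  memLp_self : MeasureTheory.MemLp u 2 (MeasureTheory.volume.restrict W)
  memLp_grad : MeasureTheory.MemLp G 2 (MeasureTheory.volume.restrict W)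
  memLp_time : MeasureTheory.MemLp D 2 (MeasureTheory.volume.restrict W)
  grad : IsWeakSpatialGradient W u G
  time : IsWeakTimeDeriv W u D

/-- The weak formulation
`∫_W ∂ₜu φ + ∇u · ∇φ + γ u₊^(γ-1) φ = 0` for all `φ ∈ C_c^∞(W)`, where `G = ∇u`, `D = ∂ₜu`.
The spatial derivative of `φ` in the direction `∇u` is `∇u · ∇φ`. -/
def WeakFormulation {n : ℕ} (γ : ℝ) (W : Set (Spacetime n)) (u : Spacetime n → ℝ)
    (G : Spacetime n → EuclideanSpace ℝ (Fin n)) (D : Spacetime n → ℝ) : Prop :=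
  ∀ φ : Spacetime n → ℝ, IsTestFunction W φ →
    ∫ z in W, (D z * φ z + spatialDeriv φ z (G z) + γ * posPartPow (γ - 1) (u z) * φ z) = 0

/-- The weak formulation with respect to domain variations
`∫_W (|∇u|² + 2 u₊^γ) div_x Φ - 2 ∇u · D_xΦ · ∇u - 2 ∂ₜu (∇u · Φ) = 0`
for all `Φ ∈ C_c^∞(W; ℝⁿ⁺¹)`, where `G = ∇u`, `D = ∂ₜu`; only the spatial part of `Φ` enters.
For `γ = 0` the term `u₊^γ` is the indicator of `{u > 0}`. -/
def DomainVariationFormulation {n : ℕ} (γ : ℝ) (W : Set (Spacetime n)) (u : Spacetime n → ℝ)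
    (G : Spacetime n → EuclideanSpace ℝ (Fin n)) (D : Spacetime n → ℝ) : Prop :=
  ∀ Φ : Spacetime n → Spacetime n, IsTestFunction W Φ →
    ∫ z in W, ((‖G z‖ ^ 2 + 2 * posPartPow γ (u z)) * spatialDiv Φ z
      - 2 * inner ℝ (G z) (spatialDeriv Φ z (G z)).1
      - 2 * D z * inner ℝ (G z) (Φ z).1) = 0

/-- `W = Ω × I` for an open bounded `Ω ⊆ ℝⁿ` and an open bounded interval `I`,
with `W` compactly contained in `A`. -/
def IsInnerCylinder {n : ℕ} (A W : Set (Spacetime n)) : Prop :=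
  ∃ (Ω : Set (EuclideanSpace ℝ (Fin n))) (a b : ℝ), IsOpen Ω ∧ Bornology.IsBounded Ω ∧
    W = Ω ×ˢ Set.Ioo a b ∧ IsCompact (closure W) ∧ closure W ⊆ A

/-- `u` is a weak solution in the open set `A` of `∂ₜu - Δu = -(d/du) u₊^γ`, for `γ ∈ (0, 1]`. -/
def IsWeakSolution {n : ℕ} (γ : ℝ) (A : Set (Spacetime n)) (u : Spacetime n → ℝ) : Prop :=
  ∀ W, IsInnerCylinder A W → ∃ G D, InEnergySpace W u G D ∧
    MeasureTheory.IntegrableOn (fun z => posPartPow (γ - 1) (u z)) W ∧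
    WeakFormulation γ W u G D ∧ DomainVariationFormulation γ W u G D

/-- `u` is a solution in the open set `A` in the sense of domain variations
(the notion of solution that is used for `γ = 0`). -/
def IsDomainVariationSolution {n : ℕ} (γ : ℝ) (A : Set (Spacetime n))
    (u : Spacetime n → ℝ) : Prop :=
  ∀ W, IsInnerCylinder A W → ∃ G D, InEnergySpace W u G D ∧
    DomainVariationFormulation γ W u G D

/-- `U` is a positive solution, of class `C²` in `(R, ∞)` and extended by zero to `[0, R]`, of
`U'' + ((n-1)/r + r/2) U' - (β/2) U = γ U^(γ-1)` in `(R, ∞)`, `U(R) = 0`,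
`(U^(1/β))'(R) = √2/β` (a right derivative). -/
structure IsSelfSimilarProfile (n : ℕ) (γ R : ℝ) (U : ℝ → ℝ) : Prop where
  contDiffOn : ContDiffOn ℝ 2 U (Set.Ioi R)
  pos : ∀ r, R < r → 0 < U r
  eq_zero : ∀ r, 0 ≤ r → r ≤ R → U r = 0
  ode : ∀ r, R < r →
    deriv (deriv U) r + (((n : ℝ) - 1) / r + r / 2) * deriv U r
      - scalingExponent γ / 2 * U r = γ * U r ^ (γ - 1)
  free_boundary : HasDerivWithinAt (fun r => U r ^ (1 / scalingExponent γ))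
    (Real.sqrt 2 / scalingExponent γ) (Set.Ici R) R

/-- The forward self-similar function `u(x, t) = t^(β/2) U(t^(-1/2) |x|)`
(relevant for `t > 0` only). -/
noncomputable def selfSimilarFunction (n : ℕ) (γ : ℝ) (U : ℝ → ℝ) (z : Spacetime n) : ℝ :=
  z.2 ^ (scalingExponent γ / 2) * U (z.2 ^ (-(1 / 2) : ℝ) * ‖z.1‖)

open MeasureTheory Set Filter Topology

/-! Existence. Near `R` the equation is singular, so one passes to `V = U^(1/β)`, which has finite
positive slope `k = √2/β` there, and takes `V` itself as the independent variable. The unknowns are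
then the inverse function of `V` and `z = (V')²`. The singular term is linear in `z - k²`, and an
integrating factor turns the system into a Volterra equation with a bounded kernel, solved by
contraction (`exists_local_root_profile`). Away from `R`, a solution with `U' > 0` keeps `U' > 0`:
the reaction is positive, and an integrating factor absorbs the drift. Hence `U` stays off the
singularity of `U^(γ-1)` and the solution is global (`exists_profile_system`). Growth is governed by
`D = r U' - β U`, which satisfies a damped first order equation. Two-sided bounds on `D` give
convergence of `U / r^β` and positivity of the limit (`exists_tendsto_profile_div_rpow`).

Solutions. In the region where the similarity variable `ξ = t^(-1/2)|x|` exceeds `R`, the function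
`u` satisfies the equation classically. Each required identity says that the divergence of some
field integrates to zero there. A cutoff `η(ξ)` close to the boundary leaves an error `∫ η'(ξ)
F·∇ξ`. Since `∫ η'(ξ)` stays bounded on compact sets (`exists_bound_integral_deriv_cutoff`), this
error vanishes once the flux `F·∇ξ` tends to zero at `ξ = R`. For weak derivatives the flux carries
the factor `U`, for the weak equation with `γ > 0` it carries `U'`, and for domain variations it
carries `2 U^γ - U'^2`. The free boundary condition makes the last one vanish, also for `γ = 0`,
where `U'` tends to `√2`. Integrability of `u^(γ-1)` comes from Fatou's lemma applied to the
divergence of `φ ∇u`, whose flux is bounded. -/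

/-! ### Volterra equations. -/

open scoped BoundedContinuousFunction in
/-- Volterra equations with a Lipschitz nonlinearity, in rescaled form, have global solutions. -/
theorem exists_volterra_solution {E : Type*} [NormedAddCommGroup E] [NormedSpace ℝ E]
    [CompleteSpace E] (F : ℝ → ℝ → E → E)
    (hF : Continuous fun p : ℝ × ℝ × E => F p.1 p.2.1 p.2.2) (K : ℝ → ℝ) (hK : Continuous K)
    (y₀ : E)
    (hL : ∀ τ ∈ Icc (0 : ℝ) 1, ∀ s, 0 ≤ s → ∀ y y', ‖F τ s y - F τ s y'‖ ≤ K s * ‖y - y'‖)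
    (hB : ∀ τ ∈ Icc (0 : ℝ) 1, ∀ s, 0 ≤ s → ‖F τ s y₀‖ ≤ K s) :
    ∃ y : ℝ → E, Continuous y ∧
      ∀ x, 0 ≤ x → y x = y₀ + x • ∫ τ in (0 : ℝ)..1, F τ (τ * x) (y (τ * x)) := by
  -- Bielecki weight: since `w' = 2 K w`, the integral of `K w` over `[0, x]` is `(w x - 1) / 2`. In
  -- the sup norm weighted by `1 / w` the integral operator therefore contracts by `1/2` on the
  -- whole half-line at once.
  set w : ℝ → ℝ := fun x => Real.exp (2 * ∫ s in (0 : ℝ)..x, K s) with hw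
  have hwd : ∀ x, HasDerivAt w (2 * K x * w x) x := by
    intro x
    have h1 : HasDerivAt (fun x => ∫ s in (0 : ℝ)..x, K s) (K x) x :=
      intervalIntegral.integral_hasDerivAt_right (hK.intervalIntegrable _ _)
        (hK.stronglyMeasurableAtFilter _ _) hK.continuousAt
    have := (h1.const_mul 2).exp
    convert this using 1
    simp only [hw]; ring
  have hwc : Continuous w := continuous_iff_continuousAt.2 fun x => (hwd x).continuousAt
  have hwpos : ∀ x, 0 < w x := fun x => Real.exp_pos _
  have hw0 : w 0 = 1 := by simp [hw]
  have hK0 : ∀ s, 0 ≤ s → 0 ≤ K s := fun s hs =>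
    (norm_nonneg _).trans (hB 0 (by simp) s hs)
  have hw1 : ∀ x, 0 ≤ x → 1 ≤ w x := by
    intro x hx
    apply Real.one_le_exp
    have := intervalIntegral.integral_nonneg (μ := volume) hx (fun s hs => hK0 s hs.1)
    positivity
  have hint : ∀ x, x * ∫ τ in (0 : ℝ)..1, K (τ * x) * w (τ * x) = (w x - 1) / 2 := by
    intro x
    have h1 := intervalIntegral.smul_integral_comp_mul_right (a := 0) (b := 1)
      (fun s => K s * w s) x
    simp only [smul_eq_mul, zero_mul, one_mul] at h1
    rw [h1]
    have h2 : ∫ s in (0 : ℝ)..x, 2 * K s * w s = w x - w 0 :=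
      intervalIntegral.integral_eq_sub_of_hasDerivAt (fun s _ => hwd s)
        (((continuous_const.mul hK).mul hwc).intervalIntegrable _ _)
    rw [hw0] at h2
    rw [← h2, ← intervalIntegral.integral_div]
    congr 1; ext s; ring
  set p : ℝ → ℝ := fun x => max x 0 with hp
  have hpc : Continuous p := continuous_id.max continuous_const
  have hp0 : ∀ x, 0 ≤ p x := fun x => le_max_right _ _
  have hpp : ∀ x, 0 ≤ x → p x = x := fun x hx => max_eq_left hx
  -- The unknown is `g = (y - y₀) / w`. Clamping the argument with `p` lets the operator act on
  -- bounded continuous functions on all of `ℝ`.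
  set T : (ℝ → E) → ℝ → E := fun g x =>
    (w (p x))⁻¹ • (p x • ∫ τ in (0 : ℝ)..1, F τ (τ * p x) (y₀ + w (τ * p x) • g (τ * p x)))
    with hT
  have hIc : ∀ g : ℝ → E, Continuous g → Continuous fun q : ℝ × ℝ =>
      F q.2 (q.2 * p q.1) (y₀ + w (q.2 * p q.1) • g (q.2 * p q.1)) := by
    intro g hg
    exact hF.comp (by fun_prop : Continuous fun q : ℝ × ℝ =>
      (q.2, q.2 * p q.1, y₀ + w (q.2 * p q.1) • g (q.2 * p q.1)))
  have hTc : ∀ g : ℝ → E, Continuous g → Continuous (T g) := by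
    intro g hg
    have h1 : Continuous fun x => ∫ τ in (0 : ℝ)..1,
        F τ (τ * p x) (y₀ + w (τ * p x) • g (τ * p x)) :=
      intervalIntegral.continuous_parametric_intervalIntegral_of_continuous' (hIc g hg) 0 1
    exact ((hwc.comp hpc).inv₀ fun x => (hwpos _).ne').smul (hpc.smul h1)
  have key : ∀ (Y : ℝ → ℝ → E) (C : ℝ), 0 ≤ C →
      (∀ x, 0 ≤ x → ∀ τ ∈ Icc (0 : ℝ) 1, ‖Y x τ‖ ≤ C * (K (τ * x) * w (τ * x))) →
      ∀ x, ‖(w (p x))⁻¹ • (p x • ∫ τ in (0 : ℝ)..1, Y (p x) τ)‖ ≤ C / 2 := by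
    intro Y C hC hY x
    have h1 : ‖∫ τ in (0 : ℝ)..1, Y (p x) τ‖
        ≤ ∫ τ in (0 : ℝ)..1, C * (K (τ * p x) * w (τ * p x)) := by
      apply intervalIntegral.norm_integral_le_of_norm_le zero_le_one
      · exact Eventually.of_forall fun τ hτ => hY _ (hp0 x) τ ⟨hτ.1.le, hτ.2⟩
      · apply Continuous.intervalIntegrable
        fun_prop
    rw [intervalIntegral.integral_const_mul] at h1
    rw [norm_smul, norm_smul, norm_inv, Real.norm_of_nonneg (hwpos _).le,
      Real.norm_of_nonneg (hp0 x), inv_mul_le_iff₀ (hwpos _)]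
    calc p x * ‖∫ τ in (0 : ℝ)..1, Y (p x) τ‖
        ≤ p x * (C * ∫ τ in (0 : ℝ)..1, K (τ * p x) * w (τ * p x)) := by
          gcongr
      _ = C * ((w (p x) - 1) / 2) := by rw [← hint (p x)]; ring
      _ ≤ w (p x) * (C / 2) := by nlinarith
  have hbd : ∀ g : ℝ →ᵇ E, ∀ x, ‖T g x‖ ≤ (1 + ‖g‖) / 2 := by
    intro g
    apply key (fun x τ => F τ (τ * x) (y₀ + w (τ * x) • g (τ * x))) _ (by positivity)
    intro x hx τ hτ
    have hs : 0 ≤ τ * x := mul_nonneg hτ.1 hx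
    have h1 := hL τ hτ _ hs (y₀ + w (τ * x) • g (τ * x)) y₀
    have h2 := hB τ hτ _ hs
    have h3 : ‖y₀ + w (τ * x) • g (τ * x) - y₀‖ ≤ w (τ * x) * ‖g‖ := by
      rw [add_sub_cancel_left, norm_smul, Real.norm_of_nonneg (hwpos _).le]
      exact mul_le_mul_of_nonneg_left (g.norm_coe_le_norm _) (hwpos _).le
    have h4 := norm_add_le (F τ (τ * x) (y₀ + w (τ * x) • g (τ * x)) - F τ (τ * x) y₀)
      (F τ (τ * x) y₀)
    rw [sub_add_cancel] at h4
    have h5 := mul_le_mul_of_nonneg_left h3 (hK0 _ hs)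
    have h6 := mul_le_mul_of_nonneg_left (hw1 _ hs) (hK0 _ hs)
    linarith
  let T' : (ℝ →ᵇ E) → (ℝ →ᵇ E) := fun g =>
    BoundedContinuousFunction.ofNormedAddCommGroup (T g) (hTc g g.continuous) _ (hbd g)
  have hcontr : ContractingWith (1 / 2) T' := by
    refine ⟨by norm_num, LipschitzWith.of_dist_le_mul fun g g' => ?_⟩
    rw [BoundedContinuousFunction.dist_le (by positivity)]
    intro x
    have h1 : T' g x - T' g' x = (w (p x))⁻¹ • (p x • ∫ τ in (0 : ℝ)..1,
        (F τ (τ * p x) (y₀ + w (τ * p x) • g (τ * p x))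
          - F τ (τ * p x) (y₀ + w (τ * p x) • g' (τ * p x)))) := by
      rw [intervalIntegral.integral_sub, smul_sub, smul_sub]
      · rfl
      · exact ((hIc g g.continuous).comp
          (by fun_prop : Continuous fun τ : ℝ => (x, τ))).intervalIntegrable _ _
      · exact ((hIc g' g'.continuous).comp
          (by fun_prop : Continuous fun τ : ℝ => (x, τ))).intervalIntegrable _ _
    rw [dist_eq_norm, h1]
    have h2 := key (fun x τ => F τ (τ * x) (y₀ + w (τ * x) • g (τ * x))
          - F τ (τ * x) (y₀ + w (τ * x) • g' (τ * x))) (dist g g') dist_nonneg ?_ x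
    · simpa [div_eq_inv_mul] using h2
    intro x hx τ hτ
    have hs : 0 ≤ τ * x := mul_nonneg hτ.1 hx
    refine (hL τ hτ _ hs _ _).trans ?_
    rw [add_sub_add_left_eq_sub, ← smul_sub, norm_smul, Real.norm_of_nonneg (hwpos _).le]
    have h5 : ‖g (τ * x) - g' (τ * x)‖ ≤ dist g g' := by
      rw [← dist_eq_norm]; exact BoundedContinuousFunction.dist_coe_le_dist _
    calc _ ≤ K (τ * x) * (w (τ * x) * dist g g') := by
          gcongr
          · exact hK0 _ hs
      _ = _ := by ring
  set g := ContractingWith.fixedPoint T' hcontr with hg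
  have hfix : T' g = g := hcontr.fixedPoint_isFixedPt
  refine ⟨fun x => y₀ + w x • g x, by fun_prop, fun x hx => ?_⟩
  have h1 : g x = T g x := by
    conv_lhs => rw [← hfix]
    rfl
  simp only [add_right_inj]
  rw [h1]
  simp only [hT, hpp x hx]
  rw [smul_inv_smul₀ (hwpos _).ne']

/-! ### Local solution at the free boundary. -/

/-- Clamping a `C¹` function to a compact box makes it bounded and globally Lipschitz. -/
theorem exists_lipschitz_comp_clamp (f : ℝ × ℝ → ℝ × ℝ) {a b c d : ℝ} (hab : a ≤ b) (hcd : c ≤ d)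
    (hf : ∀ p ∈ Icc a b ×ˢ Icc c d, ContDiffAt ℝ 1 f p) :
    ∃ C : ℝ, 0 ≤ C ∧
      (∀ p q : ℝ × ℝ, ‖f (max a (min p.1 b), max c (min p.2 d))
        - f (max a (min q.1 b), max c (min q.2 d))‖ ≤ C * ‖p - q‖) ∧
      ∀ p : ℝ × ℝ, ‖f (max a (min p.1 b), max c (min p.2 d))‖ ≤ C := by
  have hcomp : IsCompact (Icc a b ×ˢ Icc c d) := isCompact_Icc.prod isCompact_Icc
  obtain ⟨K, hK⟩ := LocallyLipschitzOn.exists_lipschitzOnWith_of_compact (f := f) hcomp (by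
    intro x hx
    obtain ⟨K, t, ht, hKt⟩ := (hf x hx).exists_lipschitzOnWith
    exact ⟨K, t, mem_nhdsWithin_of_mem_nhds ht, hKt⟩)
  obtain ⟨B, hB⟩ := hcomp.exists_bound_of_continuousOn
    (fun x hx => (hf x hx).continuousAt.continuousWithinAt : ContinuousOn f _)
  have hmem : ∀ p : ℝ × ℝ, (max a (min p.1 b), max c (min p.2 d)) ∈ Icc a b ×ˢ Icc c d :=
    fun p => ⟨⟨le_max_left _ _, max_le hab (min_le_right _ _)⟩,
      ⟨le_max_left _ _, max_le hcd (min_le_right _ _)⟩⟩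
  have hl : ∀ s t : ℝ, LipschitzWith 1 fun x : ℝ => max s (min x t) := fun s t =>
    (LipschitzWith.id.min_const t).const_max s
  refine ⟨max K B, le_max_of_le_left K.2, fun p q => ?_, fun p => ?_⟩
  · refine (hK.norm_sub_le (hmem p) (hmem q)).trans ?_
    refine mul_le_mul (le_max_left _ _) ?_ (norm_nonneg _) (le_max_of_le_left K.2)
    rw [Prod.norm_def, Prod.norm_def]
    have h1 := (hl a b).dist_le_mul p.1 q.1
    have h2 := (hl c d).dist_le_mul p.2 q.2
    rw [dist_eq_norm, dist_eq_norm, NNReal.coe_one, one_mul] at h1 h2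
    exact max_le_max h1 h2
  · exact (hB _ (hmem p)).trans (le_max_right _ _)

/-- Local solvability of the equation for `V = U^(1/b)` at the singular point `R`; the unknowns are
the inverse function of `V` and the square of `V'`, as functions of the value of `V`. -/
theorem exists_local_root_profile (a : ℝ → ℝ) {R k α : ℝ} (hR : 0 < R) (hk : 0 < k) (hα : 0 ≤ α)
    (ha : ∀ r, 0 < r → ContDiffAt ℝ 1 a r) :
    ∃ R₂, R < R₂ ∧ ∃ V W : ℝ → ℝ, V R = 0 ∧ HasDerivAt V k R ∧ ∀ r ∈ Ioo R R₂,
      0 < V r ∧ 0 < W r ∧ HasDerivAt V (W r) r ∧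
      HasDerivAt W (V r / 2 - a r * W r - α / 2 * (W r ^ 2 - k ^ 2) / V r) r := by
  have hk2 : 0 < k ^ 2 := by positivity
  have hc1 : k ^ 2 / 4 ≤ 4 * k ^ 2 := by linarith
  -- With `x = V` as variable, `ρ` the inverse of `V` and `z = (V')²`, the system reads `ρ' = 1/√z`
  -- and `z' = x - 2 a(ρ) √z - α (z - k²)/x`; `f` collects its regular coefficients.
  set f : ℝ × ℝ → ℝ × ℝ := fun p => (1 / √p.2, a p.1 * √p.2) with hf
  obtain ⟨C, hC0, hCL, hCB⟩ := exists_lipschitz_comp_clamp f (by linarith : R ≤ R + 1) hc1 (by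
    rintro ⟨p, q⟩ ⟨hp, hq⟩
    have hq0 : q ≠ 0 := by have := hq.1; simp at this; linarith
    have hp0 : 0 < p := hR.trans_le hp.1
    have hs : ContDiffAt ℝ 1 (fun x : ℝ × ℝ => √x.2) (p, q) := contDiffAt_snd.sqrt hq0
    have hs0 : √q ≠ 0 := by
      rw [Real.sqrt_ne_zero']; have := hq.1; simp at this; linarith
    exact (contDiffAt_const.div hs hs0).prodMk
      (((ha p hp0).comp (p, q) contDiffAt_fst).mul hs))
  -- The clamp makes the coefficients globally Lipschitz. It is inactive near `x = 0` because the
  -- data are `ρ = R` and `z = k²`.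
  set c : ℝ × ℝ → ℝ × ℝ :=
    fun p => (max R (min p.1 (R + 1)), max (k ^ 2 / 4) (min p.2 (4 * k ^ 2))) with hc
  set H : ℝ × ℝ → ℝ × ℝ := fun p => f (c p) with hH
  have hHL : ∀ p q, ‖H p - H q‖ ≤ C * ‖p - q‖ := hCL
  have hHB : ∀ p, ‖H p‖ ≤ C := hCB
  have hHc : Continuous H := (LipschitzWith.of_dist_le_mul (K := ⟨C, hC0⟩) fun p q => by
    rw [dist_eq_norm, dist_eq_norm]; exact hHL p q).continuous
  -- The factor `x^α` removes the singular term: `(x^α (z - k²))' = x^α (x - 2 a(ρ) √z)`.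
  -- Integrating from `0` and substituting `s = τ x` leaves the kernel `τ^α`, which is at most `1`
  -- on `[0, 1]`.
  obtain ⟨y, hyc, hy⟩ := exists_volterra_solution
    (fun τ s p => ((H p).1, τ ^ α * (s - 2 * (H p).2)))
    (by
      have h1 : Continuous fun x : ℝ => x ^ α := Real.continuous_rpow_const hα
      have h2 : Continuous fun p : ℝ × ℝ × ℝ × ℝ => p.1 ^ α := h1.comp continuous_fst
      have h3 : Continuous fun p : ℝ × ℝ × ℝ × ℝ => H p.2.2 := hHc.comp (by fun_prop)
      fun_prop)
    (fun s => 2 * C + |s|) (by fun_prop) (R, k ^ 2)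
    (by
      intro τ hτ s hs p q
      have h1 := hHL p q
      have h2 : |τ ^ α| ≤ 1 := by
        rw [abs_of_nonneg (Real.rpow_nonneg hτ.1 _)]; exact Real.rpow_le_one hτ.1 hτ.2 hα
      have h3 := norm_fst_le (H p - H q)
      have h4 := norm_snd_le (H p - H q)
      have h5 : 0 ≤ |s| * ‖p - q‖ := by positivity
      have h6 : 0 ≤ C * ‖p - q‖ := by positivity
      rw [Prod.norm_def]
      refine max_le ?_ ?_
      · simp only [Prod.fst_sub] at h3 ⊢
        linarith
      · simp only [Prod.snd_sub] at h4 ⊢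
        rw [← mul_sub, norm_mul, Real.norm_eq_abs (τ ^ α)]
        have h7 : s - 2 * (H p).2 - (s - 2 * (H q).2) = -(2 * ((H p).2 - (H q).2)) := by ring
        rw [h7, norm_neg, norm_mul, Real.norm_ofNat]
        have := mul_le_mul_of_nonneg_right h2
          (by positivity : 0 ≤ 2 * ‖(H p).2 - (H q).2‖)
        linarith)
    (by
      intro τ hτ s hs
      have h1 := hHB (R, k ^ 2)
      have h2 : |τ ^ α| ≤ 1 := by
        rw [abs_of_nonneg (Real.rpow_nonneg hτ.1 _)]; exact Real.rpow_le_one hτ.1 hτ.2 hα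
      have h3 := norm_fst_le (H (R, k ^ 2))
      have h4 := norm_snd_le (H (R, k ^ 2))
      have h5 := abs_nonneg s
      rw [Prod.norm_def]
      refine max_le ?_ ?_
      · simp only; linarith
      · simp only
        rw [norm_mul, Real.norm_eq_abs (τ ^ α)]
        have h6 := norm_sub_le s (2 * (H (R, k ^ 2)).2)
        rw [norm_mul, Real.norm_ofNat, Real.norm_eq_abs s] at h6
        have := mul_le_mul_of_nonneg_right h2
          (norm_nonneg (s - 2 * (H (R, k ^ 2)).2))
        linarith)
  set z : ℝ → ℝ := fun x => (y x).2 with hz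
  set ρ : ℝ → ℝ := fun x => (y x).1 with hρ
  have hzc : Continuous z := continuous_snd.comp hyc
  have hρc : Continuous ρ := continuous_fst.comp hyc
  have hy0 : y 0 = (R, k ^ 2) := by simpa using hy 0 le_rfl
  have hint : ∀ x, IntervalIntegrable (fun τ : ℝ => ((H (y (τ * x))).1,
      τ ^ α * (τ * x - 2 * (H (y (τ * x))).2))) volume 0 1 := by
    intro x
    have h1 : Continuous fun x : ℝ => x ^ α := Real.continuous_rpow_const hα
    have h3 : Continuous fun τ : ℝ => H (y (τ * x)) := hHc.comp (hyc.comp (by fun_prop))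
    apply Continuous.intervalIntegrable
    fun_prop
  have hfst : ∀ x, 0 ≤ x → ρ x = R + x * ∫ τ in (0 : ℝ)..1, (H (y (τ * x))).1 := by
    intro x hx
    have h1 := congrArg Prod.fst (hy x hx)
    have h2 := (ContinuousLinearMap.fst ℝ ℝ ℝ).intervalIntegral_comp_comm (hint x)
    simp only [ContinuousLinearMap.coe_fst'] at h2
    simpa [h2, hρ] using h1
  have hsnd : ∀ x, 0 ≤ x → z x = k ^ 2 + x * ∫ τ in (0 : ℝ)..1,
      τ ^ α * (τ * x - 2 * (H (y (τ * x))).2) := by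
    intro x hx
    have h1 := congrArg Prod.snd (hy x hx)
    have h2 := (ContinuousLinearMap.snd ℝ ℝ ℝ).intervalIntegral_comp_comm (hint x)
    simp only [ContinuousLinearMap.coe_snd'] at h2
    simpa [h2, hz] using h1
  -- the inverse function of `V`
  set g : ℝ → ℝ := fun x => (H (y x)).1 with hg
  have hgc : Continuous g := continuous_fst.comp (hHc.comp hyc)
  have hge : ∀ x, g x = 1 / √(max (k ^ 2 / 4) (min (z x) (4 * k ^ 2))) := fun x => rfl
  have hgm : ∀ x, 1 / (2 * k) ≤ g x := by
    intro x
    rw [hge]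
    apply one_div_le_one_div_of_le
    · exact Real.sqrt_pos.2 (lt_max_of_lt_left (by positivity))
    · rw [Real.sqrt_le_left (by positivity)]
      exact max_le (by nlinarith) ((min_le_right _ _).trans (by nlinarith))
  have hgpos : ∀ x, 0 < g x := fun x => lt_of_lt_of_le (by positivity) (hgm x)
  -- `σ` continues `ρ` to negative `x` with positive slope, so that its inverse `V` is defined on
  -- all of `ℝ` and has a two-sided derivative at `R`.
  set σ : ℝ → ℝ := fun x => R + ∫ s in (0 : ℝ)..x, g s with hσ
  have hσd : ∀ x, HasDerivAt σ (g x) x := fun x =>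
    (intervalIntegral.integral_hasDerivAt_right (hgc.intervalIntegrable _ _)
      (hgc.stronglyMeasurableAtFilter _ _) hgc.continuousAt).const_add R
  have hσρ : ∀ x, 0 ≤ x → σ x = ρ x := by
    intro x hx
    rw [hfst x hx]
    have h1 := intervalIntegral.smul_integral_comp_mul_right (a := 0) (b := 1) g x
    simp only [smul_eq_mul, zero_mul, one_mul] at h1
    simp only [hσ, ← h1]
    rfl
  have hσm : StrictMono σ := strictMono_of_deriv_pos fun x => by
    rw [(hσd x).deriv]; exact hgpos x
  have hσ0 : σ 0 = R := by simp [hσ]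
  -- The slope is at least `1/(2k)` because `z` is clamped by `4 k²`; linear growth in both
  -- directions makes `σ` surjective.
  have hmono : Monotone fun x => σ x - 1 / (2 * k) * x := by
    have h1 : ∀ x, HasDerivAt (fun x => σ x - 1 / (2 * k) * x) (g x - 1 / (2 * k) * 1) x :=
      fun x => (hσd x).sub ((hasDerivAt_id x).const_mul _)
    refine monotone_of_deriv_nonneg (fun x => (h1 x).differentiableAt) fun x => ?_
    rw [(h1 x).deriv]
    linarith [hgm x]
  have hσc : Continuous σ := continuous_iff_continuousAt.2 fun x => (hσd x).continuousAt
  have hσs : Function.Surjective σ := by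
    have hk' : 0 < 1 / (2 * k) := by positivity
    apply hσc.surjective
    · refine tendsto_atTop_mono' _ ?_ (tendsto_id.const_mul_atTop hk')
      filter_upwards [eventually_ge_atTop 0] with x hx
      have := hmono hx
      simp only [hσ0, mul_zero] at this
      simp only [id]; linarith
    · refine tendsto_atBot_mono' _ ?_
        (tendsto_atBot_add_const_left _ R (tendsto_id.const_mul_atBot hk'))
      filter_upwards [eventually_le_atBot 0] with x hx
      have := hmono hx
      simp only [hσ0, mul_zero] at this
      simp only [id]; linarith
  set e := hσm.orderIsoOfSurjective σ hσs with he
  set V : ℝ → ℝ := fun r => e.symm r with hV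
  have hσV : ∀ r, σ (V r) = r := fun r => e.apply_symm_apply r
  have hVσ : ∀ x, V (σ x) = x := fun x => e.symm_apply_apply x
  have hVm : StrictMono V := e.symm.strictMono
  have hVc : Continuous V := e.symm.continuous
  have hVd : ∀ r, HasDerivAt V (g (V r))⁻¹ r := fun r =>
    HasDerivAt.of_local_left_inverse hVc.continuousAt (hσd _) (hgpos _).ne'
      (Eventually.of_forall hσV)
  have hVR : V R = 0 := by rw [← hσ0, hVσ]
  have hz0 : z 0 = k ^ 2 := by simp [hz, hy0]
  have hρ0 : ρ 0 = R := by simp [hρ, hy0]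
  obtain ⟨δ, hδ, hδz⟩ : ∃ δ > 0, ∀ x, |x| < δ →
      (k ^ 2 / 4 < z x ∧ z x < 4 * k ^ 2) ∧ ρ x < R + 1 := by
    have h1 : ∀ᶠ x in 𝓝 (0 : ℝ), (k ^ 2 / 4 < z x ∧ z x < 4 * k ^ 2) ∧ ρ x < R + 1 := by
      have e1 := (hzc.continuousAt (x := 0)).eventually_const_lt (u := k ^ 2 / 4) (by rw [hz0]; linarith)
      have e2 := (hzc.continuousAt (x := 0)).eventually_lt_const (u := 4 * k ^ 2) (by rw [hz0]; linarith)
      have e3 := (hρc.continuousAt (x := 0)).eventually_lt_const (u := R + 1) (by rw [hρ0]; linarith)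
      filter_upwards [e1, e2, e3] with x h1 h2 h3 using ⟨⟨h1, h2⟩, h3⟩
    obtain ⟨δ, hδ, h⟩ := Metric.eventually_nhds_iff.1 h1
    exact ⟨δ, hδ, fun x hx => h (by simpa using hx)⟩
  have hcy : ∀ x, 0 ≤ x → x < δ → H (y x) = (1 / √(z x), a (ρ x) * √(z x)) := by
    intro x hx hxδ
    obtain ⟨⟨h1, h2⟩, h3⟩ := hδz x (by rwa [abs_of_nonneg hx])
    have h4 : R ≤ ρ x := by
      rw [← hσρ x hx, ← hσ0]; exact hσm.monotone hx
    have h5 : c (y x) = (ρ x, z x) := by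
      simp only [hc, Prod.mk.injEq]
      exact ⟨by rw [min_eq_left h3.le, max_eq_right h4], by rw [min_eq_left h2.le, max_eq_right h1.le]⟩
    simp only [hH, h5, hf]
  have hzd : ∀ x, 0 < x → x < δ →
      HasDerivAt z (x - 2 * (a (ρ x) * √(z x)) - α * (z x - k ^ 2) / x) x := by
    intro x hx hxδ
    -- For `x > 0` the substitution is undone, giving `z = k² + x^(-α) J`, which can be
    -- differentiated.
    set J : ℝ → ℝ := fun x => ∫ s in (0 : ℝ)..x, s ^ α * (s - 2 * (H (y s)).2) with hJ
    have hJc : Continuous fun s : ℝ => s ^ α * (s - 2 * (H (y s)).2) := by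
      have h1 : Continuous fun x : ℝ => x ^ α := Real.continuous_rpow_const hα
      have h3 : Continuous fun τ : ℝ => H (y τ) := hHc.comp hyc
      fun_prop
    have hJd : HasDerivAt J (x ^ α * (x - 2 * (H (y x)).2)) x :=
      intervalIntegral.integral_hasDerivAt_right (hJc.intervalIntegrable _ _)
        (hJc.stronglyMeasurableAtFilter _ _) hJc.continuousAt
    have hzJ : ∀ x, 0 < x → z x = k ^ 2 + x ^ (-α) * J x := by
      intro x hx
      rw [hsnd x hx.le]
      have h1 := intervalIntegral.smul_integral_comp_mul_right (a := 0) (b := 1)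
        (fun s : ℝ => s ^ α * (s - 2 * (H (y s)).2)) x
      simp only [smul_eq_mul, zero_mul, one_mul] at h1
      rw [hJ]
      simp only
      rw [← h1, mul_left_comm]
      congr 2
      rw [← intervalIntegral.integral_const_mul]
      apply intervalIntegral.integral_congr
      intro τ hτ
      rw [uIcc_of_le zero_le_one] at hτ
      simp only
      rw [Real.mul_rpow hτ.1 hx.le, Real.rpow_neg hx.le]
      have := (Real.rpow_pos_of_pos hx α).ne'
      field_simp
    have hd := ((Real.hasDerivAt_rpow_const (p := -α) (Or.inl hx.ne')).mul hJd).const_add (k ^ 2)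
    have hd' := hd.congr_of_eventuallyEq (f₁ := z) (by
      filter_upwards [lt_mem_nhds hx] with x' hx' using hzJ x' hx')
    refine hd'.congr_deriv ?_
    symm
    rw [hcy x hx.le hxδ]
    have h1 : z x - k ^ 2 = x ^ (-α) * J x := by rw [hzJ x hx]; ring
    rw [h1, Real.rpow_sub_one hx.ne']
    have h2 : x ^ (-α) * x ^ α = 1 := by
      rw [← Real.rpow_add hx]; simp
    have h3 : x ^ (-α) * (x ^ α * (x - 2 * (a (ρ x) * √(z x)))) = x - 2 * (a (ρ x) * √(z x)) := by
      rw [← mul_assoc, h2, one_mul]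
    simp only
    rw [h3]
    field_simp
    ring
  refine ⟨σ δ, by rw [← hσ0]; exact hσm hδ, V, fun r => (g (V r))⁻¹, hVR, ?_, ?_⟩
  · convert hVd R using 1
    rw [hVR, hge, hz0, min_eq_left (by linarith), max_eq_right (by linarith),
      Real.sqrt_sq hk.le, one_div, inv_inv]
  · rintro r ⟨hr1, hr2⟩
    have hVr : 0 < V r := by rw [← hVR]; exact hVm hr1
    have hVr2 : V r < δ := by rw [← hVσ δ]; exact hVm hr2
    refine ⟨hVr, inv_pos.2 (hgpos _), hVd r, ?_⟩
    have hgz : ∀ x, 0 ≤ x → x < δ → (g x)⁻¹ = √(z x) := by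
      intro x hx hx'
      simp only [hg]
      rw [hcy x hx hx', one_div, inv_inv]
    have hzpos : 0 < z (V r) := by
      have := (hδz (V r) (by rwa [abs_of_pos hVr])).1.1
      linarith
    have hd : HasDerivAt (fun r => √(z (V r))) _ r :=
      ((hzd _ hVr hVr2).comp r (hVd r)).sqrt hzpos.ne'
    have hd' := hd.congr_of_eventuallyEq (f₁ := fun r => (g (V r))⁻¹) (by
      filter_upwards [hVc.continuousAt.eventually_const_lt hVr,
        hVc.continuousAt.eventually_lt_const hVr2] with r' h1 h2 using hgz _ h1.le h2)
    refine hd'.congr_deriv ?_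
    symm
    have h0 : ρ (V r) = r := by rw [← hσρ _ hVr.le, hσV]
    have hs : √(z (V r)) ≠ 0 := (Real.sqrt_pos.2 hzpos).ne'
    simp only [Function.comp_apply]
    rw [hgz _ hVr.le hVr2, h0, Real.sq_sqrt hzpos.le]
    field_simp

theorem one_le_scalingExponent {γ : ℝ} (h0 : 0 ≤ γ) (h1 : γ ≤ 1) : 1 ≤ scalingExponent γ := by
  rw [scalingExponent, le_div_iff₀ (by linarith)]; linarith

/-- This is the parabolic scaling relation: it gives `u^(γ-1)` and `∂ₜu` the same power of `t`, and
turns `U^(γ-1)` into `V^(β-2)` for `U = V^β`. -/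
theorem scalingExponent_mul_sub_one {γ : ℝ} (h1 : γ ≤ 1) :
    scalingExponent γ * (γ - 1) = scalingExponent γ - 2 := by
  rw [scalingExponent]
  have : 2 - γ ≠ 0 := by linarith
  field_simp; ring

/-- Local solvability of the profile equation at the free boundary. -/
theorem exists_local_profile (a : ℝ → ℝ) {γ R : ℝ} (hγ₀ : 0 ≤ γ) (hγ₁ : γ ≤ 1) (hR : 0 < R)
    (ha : ∀ r, 0 < r → ContDiffAt ℝ 1 a r) :
    ∃ R₂, R < R₂ ∧ ∃ U P : ℝ → ℝ, U R = 0 ∧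
      HasDerivWithinAt (fun r => U r ^ (1 / scalingExponent γ))
        (Real.sqrt 2 / scalingExponent γ) (Ici R) R ∧
      ∀ r ∈ Ioo R R₂, 0 < U r ∧ 0 < P r ∧ HasDerivAt U (P r) r ∧
        HasDerivAt P (scalingExponent γ / 2 * U r + γ * U r ^ (γ - 1) - a r * P r) r := by
  have hβ := one_le_scalingExponent hγ₀ hγ₁
  have hβγ := scalingExponent_mul_sub_one hγ₁
  set β := scalingExponent γ with hβdef
  have hβ0 : 0 < β := by linarith
  -- Inserting `U = V^β` gives `V'' = V/2 - a V' - (β-1)(V'^2 - 2/β²)/V`, hence these values of `k`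
  -- and `α`.
  obtain ⟨R₂, hR₂, V, W, hVR, hVd, h⟩ := exists_local_root_profile a hR
    (k := √2 / β) (α := 2 * (β - 1)) (by positivity) (by linarith) ha
  refine ⟨R₂, hR₂, fun r => V r ^ β, fun r => β * V r ^ (β - 1) * W r, ?_, ?_, ?_⟩
  · simp [hVR, hβ0.ne']
  · refine hVd.hasDerivWithinAt.congr_of_eventuallyEq ?_ ?_
    · have h1 : ∀ᶠ r in 𝓝[Ici R] R, r < R₂ := eventually_nhdsWithin_of_eventually_nhds
        (gt_mem_nhds hR₂)
      filter_upwards [h1, self_mem_nhdsWithin] with r hr hr'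
      have hV0 : 0 ≤ V r := by
        rcases eq_or_lt_of_le (mem_Ici.1 hr') with h2 | h2
        · rw [← h2, hVR]
        · exact (h r ⟨h2, hr⟩).1.le
      rw [← Real.rpow_mul hV0, mul_one_div_cancel hβ0.ne', Real.rpow_one]
    · simp only
      rw [hVR, ← Real.rpow_mul le_rfl, mul_one_div_cancel hβ0.ne', Real.rpow_one]
  · intro r hr
    obtain ⟨hV, hW, hVd, hWd⟩ := h r hr
    refine ⟨by positivity, by positivity, ?_, ?_⟩
    · refine (hVd.rpow_const (p := β) (Or.inl hV.ne')).congr_deriv (by ring)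
    · refine (((hVd.rpow_const (p := β - 1) (Or.inl hV.ne')).const_mul β).mul hWd).congr_deriv ?_
      have e1 : (V r ^ β) ^ (γ - 1) = V r ^ β / V r ^ 2 := by
        rw [← Real.rpow_mul hV.le, hβγ, Real.rpow_sub hV, Real.rpow_two]
      have e2 : V r ^ (β - 1) = V r ^ β / V r := Real.rpow_sub_one hV.ne' _
      have e3 : V r ^ (β - 1 - 1) = V r ^ β / V r ^ 2 := by
        rw [Real.rpow_sub_one hV.ne', e2]; field_simp
      beta_reduce
      rw [e1, e3, e2]
      have e4 : γ = 2 * (β - 1) / β := by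
        rw [hβdef, scalingExponent]
        have : 2 - γ ≠ 0 := by linarith
        field_simp; ring
      have e5 : (√2 / β) ^ 2 = 2 / β ^ 2 := by
        rw [div_pow, Real.sq_sqrt (by norm_num)]
      rw [e4, e5]
      field_simp
      ring

/-! ### Continuation to all radii. -/

/-- Global solvability of `U'' + a U' = g(U)` with Lipschitz `g`. -/
theorem exists_second_order_solution (a g : ℝ → ℝ) (ha : Continuous a) {C : ℝ}
    (hg : ∀ u v, |g u - g v| ≤ C * |u - v|) (t₀ u₀ p₀ : ℝ) :
    ∃ U P : ℝ → ℝ, U t₀ = u₀ ∧ P t₀ = p₀ ∧ ∀ t, t₀ ≤ t →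
      HasDerivWithinAt U (P t) (Ici t₀) t ∧
      HasDerivWithinAt P (g (U t) - a t * P t) (Ici t₀) t := by
  have hC : 0 ≤ C := by
    have := (abs_nonneg _).trans (hg 1 0)
    simpa using this
  have hgc : Continuous g := (LipschitzWith.of_dist_le_mul (K := ⟨C, hC⟩) fun u v => by
    rw [Real.dist_eq, Real.dist_eq]; exact hg u v).continuous
  set F : ℝ → ℝ × ℝ → ℝ × ℝ := fun s y => (y.2, g y.1 - a (t₀ + s) * y.2) with hF
  have hFc : Continuous fun p : ℝ × ℝ × ℝ => F p.1 p.2 := by fun_prop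
  -- Without dependence on `τ`, the rescaled equation is the usual integral equation. The function
  -- `K` is the sum of the Lipschitz constant and a bound at the initial value.
  obtain ⟨y, hyc, hy⟩ := exists_volterra_solution (fun _ s y => F s y) (by fun_prop)
    (fun s => 1 + C + |a (t₀ + s)| + (|p₀| + |g u₀| + |a (t₀ + s)| * |p₀|)) (by fun_prop) (u₀, p₀)
    (by
      intro τ _ s _ y y'
      have h1 := norm_fst_le (y - y')
      have h2 := norm_snd_le (y - y')
      have h3 : 0 ≤ ‖y - y'‖ := norm_nonneg _
      have h4 : 0 ≤ (|p₀| + |g u₀| + |a (t₀ + s)| * |p₀|) * ‖y - y'‖ := by positivity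
      have h5 : 0 ≤ |a (t₀ + s)| * ‖y - y'‖ := by positivity
      have h6 : 0 ≤ C * ‖y - y'‖ := by positivity
      rw [Prod.norm_def (F s y - F s y')]
      simp only [Prod.fst_sub, Prod.snd_sub, hF, Real.norm_eq_abs] at h1 h2 ⊢
      refine max_le (by linarith) ?_
      have e : g y.1 - a (t₀ + s) * y.2 - (g y'.1 - a (t₀ + s) * y'.2)
        = (g y.1 - g y'.1) - a (t₀ + s) * (y.2 - y'.2) := by ring
      rw [e]
      refine (abs_sub _ _).trans ?_
      rw [abs_mul]
      have h7 := hg y.1 y'.1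
      have h8 := mul_le_mul_of_nonneg_left h1 hC
      have h9 := mul_le_mul_of_nonneg_left h2 (abs_nonneg (a (t₀ + s)))
      linarith)
    (by
      intro τ _ s _
      have h5 : 0 ≤ |a (t₀ + s)| * |p₀| := by positivity
      have h6 := abs_nonneg (a (t₀ + s))
      have h7 := abs_nonneg p₀
      have h8 := abs_nonneg (g u₀)
      rw [Prod.norm_def]
      simp only [hF, Real.norm_eq_abs]
      refine max_le (by linarith) ?_
      refine (abs_sub _ _).trans ?_
      rw [abs_mul]
      linarith)
  have hΦ : Continuous fun s => F s (y s) := hFc.comp (continuous_id.prodMk hyc)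
  have hy' : ∀ x, 0 ≤ x → y x = (u₀, p₀) + ∫ s in (0 : ℝ)..x, F s (y s) := by
    intro x hx
    have h1 := intervalIntegral.smul_integral_comp_mul_right (a := 0) (b := 1)
      (fun s => F s (y s)) x
    simp only [zero_mul, one_mul] at h1
    rw [← h1]
    exact hy x hx
  have hyd : ∀ x, 0 ≤ x → HasDerivWithinAt y (F x (y x)) (Ici 0) x := by
    intro x hx
    have h1 : HasDerivAt (fun x => (u₀, p₀) + ∫ s in (0 : ℝ)..x, F s (y s)) (F x (y x)) x :=
      (intervalIntegral.integral_hasDerivAt_right (hΦ.intervalIntegrable _ _)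
        (hΦ.stronglyMeasurableAtFilter _ _) hΦ.continuousAt).const_add _
    exact h1.hasDerivWithinAt.congr (fun x hx => hy' x hx) (hy' x hx)
  have hy0 : y 0 = (u₀, p₀) := by simpa using hy 0 le_rfl
  have hyt : ∀ t, t₀ ≤ t →
      HasDerivWithinAt (fun t => y (t - t₀)) (F (t - t₀) (y (t - t₀))) (Ici t₀) t := by
    intro t ht
    have h1 := (hyd (t - t₀) (by linarith)).scomp t
      ((hasDerivAt_id t).sub_const t₀).hasDerivWithinAt (s := Ici t₀)
      (fun s hs => by simpa using hs)
    simpa [Function.comp_def] using h1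
  refine ⟨fun t => (y (t - t₀)).1, fun t => (y (t - t₀)).2, by simp [hy0], by simp [hy0],
    fun t ht => ⟨?_, ?_⟩⟩
  · exact ((ContinuousLinearMap.fst ℝ ℝ ℝ).hasFDerivAt.comp_hasDerivWithinAt t (hyt t ht))
  · have := ((ContinuousLinearMap.snd ℝ ℝ ℝ).hasFDerivAt.comp_hasDerivWithinAt t (hyt t ht))
    simpa [hF, Function.comp_def] using this

/-- At `c` the two one-sided derivatives agree and combine into a derivative. The right piece is
only assumed differentiable within `Ici c`, as the global solver provides. -/
theorem hasDerivAt_glue {f₁ f₂ d₁ d₂ : ℝ → ℝ} {A c : ℝ}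
    (h₁ : ∀ r, A < r → r ≤ c → HasDerivAt f₁ (d₁ r) r)
    (h₂ : ∀ r, c ≤ r → HasDerivWithinAt f₂ (d₂ r) (Ici c) r)
    (hf : f₁ c = f₂ c) (hd : d₁ c = d₂ c) {r : ℝ} (hr : A < r) :
    HasDerivAt (fun r => if r ≤ c then f₁ r else f₂ r) (if r ≤ c then d₁ r else d₂ r) r := by
  rcases lt_trichotomy r c with h | rfl | h
  · rw [if_pos h.le]
    refine (h₁ r hr h.le).congr_of_eventuallyEq ?_
    filter_upwards [gt_mem_nhds h] with s hs using if_pos hs.le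
  · rw [if_pos le_rfl, ← hasDerivWithinAt_univ, ← Iic_union_Ici (a := r)]
    refine HasDerivWithinAt.union ?_ ?_
    · exact (h₁ r hr le_rfl).hasDerivWithinAt.congr (fun s hs => if_pos hs) (if_pos le_rfl)
    · rw [hd]
      refine (h₂ r le_rfl).congr (fun s hs => ?_) (by rw [if_pos le_rfl, hf])
      rcases eq_or_lt_of_le (mem_Ici.1 hs) with h | h
      · rw [if_pos h.symm.le, ← h, hf]
      · exact if_neg (not_le.2 h)
  · rw [if_neg (not_le.2 h)]
    refine ((h₂ r h.le).hasDerivAt (Ici_mem_nhds h)).congr_of_eventuallyEq ?_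
    filter_upwards [lt_mem_nhds h] with s hs using if_neg (not_le.2 hs)

/-- The nonlinearity with its argument cut off from below is Lipschitz. -/
theorem exists_lipschitz_reaction {γ β u₀ : ℝ} (hγ₁ : γ ≤ 1) (hu₀ : 0 < u₀) :
    ∃ C, ∀ u v : ℝ, |(β / 2 * max u u₀ + γ * max u u₀ ^ (γ - 1))
      - (β / 2 * max v u₀ + γ * max v u₀ ^ (γ - 1))| ≤ C * |u - v| := by
  set C := |β / 2| + |γ| * (|γ - 1| * u₀ ^ (γ - 1 - 1)) with hC
  have hmax : ∀ u v : ℝ, |max u u₀ - max v u₀| ≤ |u - v| := fun u v => by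
    have := (LipschitzWith.id.max_const u₀).dist_le_mul u v
    simpa [Real.dist_eq] using this
  have hlip : ∀ u ∈ Ici u₀, ∀ v ∈ Ici u₀, ‖u ^ (γ - 1) - v ^ (γ - 1)‖
      ≤ |γ - 1| * u₀ ^ (γ - 1 - 1) * ‖u - v‖ := by
    intro u hu v hv
    refine Convex.norm_image_sub_le_of_norm_deriv_le (s := Ici u₀)
      (f := fun x : ℝ => x ^ (γ - 1)) (fun x hx => ?_) (fun x hx => ?_) (convex_Ici _) hv hu
    · exact (Real.hasDerivAt_rpow_const (Or.inl (hu₀.trans_le hx).ne')).differentiableAt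
    · have hx0 : 0 < x := hu₀.trans_le hx
      rw [(Real.hasDerivAt_rpow_const (Or.inl hx0.ne')).deriv, norm_mul, Real.norm_eq_abs,
        Real.norm_of_nonneg (Real.rpow_nonneg hx0.le _)]
      refine mul_le_mul_of_nonneg_left ?_ (abs_nonneg _)
      exact Real.rpow_le_rpow_of_nonpos hu₀ hx (by linarith)
  refine ⟨C, fun u v => ?_⟩
  have h1 := hlip _ (le_max_right u u₀) _ (le_max_right v u₀)
  rw [Real.norm_eq_abs, Real.norm_eq_abs] at h1
  have e : (β / 2 * max u u₀ + γ * max u u₀ ^ (γ - 1))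
      - (β / 2 * max v u₀ + γ * max v u₀ ^ (γ - 1))
      = β / 2 * (max u u₀ - max v u₀) + γ * (max u u₀ ^ (γ - 1) - max v u₀ ^ (γ - 1)) := by ring
  rw [e]
  calc _ ≤ |β / 2| * |max u u₀ - max v u₀|
        + |γ| * |max u u₀ ^ (γ - 1) - max v u₀ ^ (γ - 1)| := by
        rw [← abs_mul, ← abs_mul]; exact abs_add_le _ _
    _ ≤ |β / 2| * |max u u₀ - max v u₀|
        + |γ| * (|γ - 1| * u₀ ^ (γ - 1 - 1) * |max u u₀ - max v u₀|) := by gcongr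
    _ = C * |max u u₀ - max v u₀| := by rw [hC]; ring
    _ ≤ C * |u - v| := mul_le_mul_of_nonneg_left (hmax u v) (by positivity)

/-- The drift coefficient of the profile equation. -/
noncomputable def profileDrift (n : ℕ) (r : ℝ) : ℝ := ((n : ℝ) - 1) / r + r / 2

theorem contDiffAt_profileDrift (n : ℕ) {r : ℝ} (hr : 0 < r) :
    ContDiffAt ℝ 1 (profileDrift n) r :=
  (contDiffAt_const.div contDiffAt_id hr.ne').add (contDiffAt_id.div_const 2)

/-- Existence of a monotone profile, as a solution of a first order system. -/
theorem exists_profile_system (n : ℕ) {γ R : ℝ} (hγ₀ : 0 ≤ γ) (hγ₁ : γ ≤ 1) (hR : 0 < R) :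
    ∃ U P : ℝ → ℝ, (∀ r ≤ R, U r = 0) ∧
      HasDerivWithinAt (fun r => U r ^ (1 / scalingExponent γ))
        (Real.sqrt 2 / scalingExponent γ) (Ici R) R ∧
      ∀ r, R < r → 0 < U r ∧ 0 < P r ∧ HasDerivAt U (P r) r ∧
        HasDerivAt P (scalingExponent γ / 2 * U r + γ * U r ^ (γ - 1)
          - profileDrift n r * P r) r := by
  have hβ := one_le_scalingExponent hγ₀ hγ₁
  obtain ⟨R₂, hR₂, U₁, P₁, hU₁R, hfb, h₁⟩ := exists_local_profile (profileDrift n) hγ₀ hγ₁ hR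
    (fun r hr => contDiffAt_profileDrift n hr)
  set β := scalingExponent γ with hβdef
  set c := (R + R₂) / 2 with hc
  have hcR : R < c := by linarith
  have hcR₂ : c < R₂ := by linarith
  obtain ⟨hU₁c, hP₁c, -, -⟩ := h₁ c ⟨hcR, hcR₂⟩
  set u₀ := U₁ c with hu₀
  -- Below `u₀` the singular reaction is frozen, and below `c` so is the drift. Neither change is
  -- felt on `[c, ∞)`, since the solution turns out to be increasing.
  set g : ℝ → ℝ := fun u => β / 2 * max u u₀ + γ * max u u₀ ^ (γ - 1) with hg
  set a : ℝ → ℝ := fun r => profileDrift n (max r c) with ha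
  have hac : Continuous a := by
    refine continuous_iff_continuousAt.2 fun r => ?_
    have h0 : 0 < max r c := lt_max_of_lt_right (hR.trans hcR)
    exact ContinuousAt.comp (f := fun r => max r c) (contDiffAt_profileDrift n h0).continuousAt
      (continuous_id.max continuous_const).continuousAt
  have haeq : ∀ r, c ≤ r → a r = profileDrift n r := fun r hr => by
    simp only [ha, max_eq_left hr]
  have hgpos : ∀ u, 0 < g u := fun u => by
    have h0 : 0 < max u u₀ := lt_max_of_lt_right hU₁c
    have h1 := Real.rpow_pos_of_pos h0 (γ - 1)
    have h2 : 0 < β / 2 * max u u₀ := by positivity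
    have h3 : 0 ≤ γ * max u u₀ ^ (γ - 1) := by positivity
    simp only [hg]; linarith
  obtain ⟨C, hC⟩ := exists_lipschitz_reaction (β := β) hγ₁ hU₁c
  obtain ⟨U₂, P₂, hU₂c, hP₂c, h₂⟩ := exists_second_order_solution a g hac hC c u₀ (P₁ c)
  have hP₂ : ∀ r, c ≤ r → 0 < P₂ r := by
    -- Integrating factor: `(exp A · P₂)' = exp A · g(U₂) > 0`, so `P₂` keeps its positive initial
    -- sign.
    set A : ℝ → ℝ := fun r => ∫ s in c..r, a s with hA
    have hAd : ∀ r, HasDerivAt A (a r) r := fun r =>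
      intervalIntegral.integral_hasDerivAt_right (hac.intervalIntegrable _ _)
        (hac.stronglyMeasurableAtFilter _ _) hac.continuousAt
    have hd : ∀ r, c ≤ r → HasDerivWithinAt (fun r => Real.exp (A r) * P₂ r)
        (Real.exp (A r) * g (U₂ r)) (Ici c) r := fun r hr =>
      ((hAd r).exp.hasDerivWithinAt.mul (h₂ r hr).2).congr_deriv (by ring)
    have hm : MonotoneOn (fun r => Real.exp (A r) * P₂ r) (Ici c) := by
      refine monotoneOn_of_hasDerivWithinAt_nonneg (convex_Ici c)
        (fun r hr => (hd r hr).continuousWithinAt)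
        (fun r hr => (hd r (interior_subset hr)).mono interior_subset) fun r hr => ?_
      exact (mul_pos (Real.exp_pos _) (hgpos _)).le
    intro r hr
    have h3 := hm (mem_Ici.2 le_rfl) (mem_Ici.2 hr) hr
    simp only [hP₂c] at h3
    have h4 : 0 < Real.exp (A r) * P₂ r := lt_of_lt_of_le (by positivity) h3
    exact (pos_iff_pos_of_mul_pos h4).1 (Real.exp_pos _)
  have hU₂ : ∀ r, c ≤ r → u₀ ≤ U₂ r := by
    have hm : MonotoneOn U₂ (Ici c) := by
      refine monotoneOn_of_hasDerivWithinAt_nonneg (convex_Ici c)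
        (fun r hr => (h₂ r hr).1.continuousWithinAt)
        (fun r hr => (h₂ r (interior_subset hr)).1.mono interior_subset) fun r hr => ?_
      exact (hP₂ r (interior_subset hr)).le
    intro r hr
    rw [← hU₂c]
    exact hm (mem_Ici.2 le_rfl) (mem_Ici.2 hr) hr
  have hgeq : ∀ r, c ≤ r → g (U₂ r) = β / 2 * U₂ r + γ * U₂ r ^ (γ - 1) := fun r hr => by
    simp only [hg, max_eq_left (hU₂ r hr)]
  set U₀ : ℝ → ℝ := fun r => if r ≤ c then U₁ r else U₂ r with hU₀
  set P₀ : ℝ → ℝ := fun r => if r ≤ c then P₁ r else P₂ r with hP₀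
  have h₀ : ∀ r, R < r → 0 < U₀ r ∧ 0 < P₀ r ∧ HasDerivAt U₀ (P₀ r) r ∧
        HasDerivAt P₀ (β / 2 * U₀ r + γ * U₀ r ^ (γ - 1) - profileDrift n r * P₀ r) r := by
    intro r hr
    refine ⟨?_, ?_, ?_, ?_⟩
    · by_cases h : r ≤ c
      · simp only [hU₀, if_pos h]; exact (h₁ r ⟨hr, h.trans_lt hcR₂⟩).1
      · simp only [hU₀, if_neg h]; exact hU₁c.trans_le (hU₂ r (not_le.1 h).le)
    · by_cases h : r ≤ c
      · simp only [hP₀, if_pos h]; exact (h₁ r ⟨hr, h.trans_lt hcR₂⟩).2.1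
      · simp only [hP₀, if_neg h]; exact hP₂ r (not_le.1 h).le
    · exact hasDerivAt_glue (fun r hr hrc => (h₁ r ⟨hr, hrc.trans_lt hcR₂⟩).2.2.1)
        (fun r hrc => (h₂ r hrc).1) hU₂c.symm hP₂c.symm hr
    · have := hasDerivAt_glue (fun r hr hrc => (h₁ r ⟨hr, hrc.trans_lt hcR₂⟩).2.2.2)
        (fun r hrc => (h₂ r hrc).2) hP₂c.symm
        (by rw [hgeq c le_rfl, haeq c le_rfl, hU₂c, hP₂c]) hr
      refine this.congr_deriv ?_
      by_cases h : r ≤ c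
      · simp only [hU₀, hP₀, if_pos h]
      · simp only [hU₀, hP₀, if_neg h]
        rw [hgeq r (not_le.1 h).le, haeq r (not_le.1 h).le]
  refine ⟨fun r => if r ≤ R then 0 else U₀ r, P₀, fun r hr => if_pos hr, ?_, fun r hr => ?_⟩
  · have hev : ∀ r, R ≤ r → r ≤ c → (if r ≤ R then 0 else U₀ r) = U₁ r := by
      intro r hr hrc
      rcases eq_or_lt_of_le hr with h | h
      · rw [if_pos h.symm.le, ← h, hU₁R]
      · rw [if_neg (not_le.2 h)]; simp only [hU₀, if_pos hrc]
    refine hfb.congr_of_eventuallyEq ?_ (by simp only [hev R le_rfl hcR.le])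
    have h1 : ∀ᶠ r in 𝓝[Ici R] R, r < c := eventually_nhdsWithin_of_eventually_nhds
      (gt_mem_nhds hcR)
    filter_upwards [h1, self_mem_nhdsWithin] with r hr hr'
    simp only [hev r hr' hr.le]
  · obtain ⟨h1, h2, h3, h4⟩ := h₀ r hr
    simp only [if_neg (not_le.2 hr)]
    refine ⟨h1, h2, h3.congr_of_eventuallyEq ?_, h4⟩
    filter_upwards [lt_mem_nhds hr] with s hs using if_neg (not_le.2 hs)

/-! ### Growth of profiles at infinity. -/

/-- If `S' + (r/2) S ≥ 0` and `S` is nonnegative initially, then `S` stays nonnegative. -/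
theorem nonneg_of_deriv_add_mul_nonneg {S S' : ℝ → ℝ} {r₀ : ℝ}
    (hS : ∀ r, r₀ ≤ r → HasDerivAt S (S' r) r) (h0 : 0 ≤ S r₀)
    (h : ∀ r, r₀ ≤ r → 0 ≤ S' r + r / 2 * S r) {r : ℝ} (hr : r₀ ≤ r) : 0 ≤ S r := by
  have hd : ∀ r, r₀ ≤ r → HasDerivAt (fun r => Real.exp (r ^ 2 / 4) * S r)
      (Real.exp (r ^ 2 / 4) * (S' r + r / 2 * S r)) r := fun r hr => by
    refine ((((hasDerivAt_pow 2 r).div_const 4).exp).mul (hS r hr)).congr_deriv ?_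
    push_cast; ring
  have hm : MonotoneOn (fun r => Real.exp (r ^ 2 / 4) * S r) (Ici r₀) :=
    monotoneOn_of_hasDerivWithinAt_nonneg (convex_Ici r₀)
      (fun r hr => (hd r hr).continuousAt.continuousWithinAt)
      (fun r hr => (hd r (interior_subset hr)).hasDerivWithinAt)
      fun r hr => mul_nonneg (Real.exp_pos _).le (h r (interior_subset hr))
  have h1 := hm (mem_Ici.2 le_rfl) (mem_Ici.2 hr) hr
  have h2 : 0 ≤ Real.exp (r ^ 2 / 4) * S r := le_trans (by positivity) h1
  exact nonneg_of_mul_nonneg_right h2 (Real.exp_pos _)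

theorem profileDrift_mul_self (n : ℕ) {r : ℝ} (hr : 0 < r) :
    r * profileDrift n r = (n : ℝ) - 1 + r ^ 2 / 2 := by
  rw [profileDrift]; field_simp

/-- An increasing profile is asymptotic to a positive multiple of `r ^ β`. -/
theorem exists_tendsto_profile_div_rpow {n : ℕ} (hn : 1 ≤ n) {γ β R : ℝ} (hγ₀ : 0 ≤ γ)
    (hγ₁ : γ ≤ 1) (hβ : 1 ≤ β) (hR : 0 < R) {U P : ℝ → ℝ}
    (h : ∀ r, R < r → 0 < U r ∧ 0 < P r ∧ HasDerivAt U (P r) r ∧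
      HasDerivAt P (β / 2 * U r + γ * U r ^ (γ - 1) - profileDrift n r * P r) r) :
    ∃ c, 0 < c ∧ Tendsto (fun r => U r / r ^ β) atTop (𝓝 c) := by
  have hn' : (1 : ℝ) ≤ n := by exact_mod_cast hn
  -- Starting at distance `3` keeps `U` away from zero and ensures `1/r² ≤ 1/9`, which is used for
  -- the lower bound on `D`.
  set r₁ := R + 3 with hr₁
  have hRr : ∀ r, r₁ ≤ r → R < r := fun r hr => by linarith
  have hr3 : ∀ r, r₁ ≤ r → 3 ≤ r := fun r hr => by linarith
  have hr0 : ∀ r, r₁ ≤ r → 0 < r := fun r hr => by linarith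
  have hUpos : ∀ r, r₁ ≤ r → 0 < U r := fun r hr => (h r (hRr r hr)).1
  have hPpos : ∀ r, r₁ ≤ r → 0 < P r := fun r hr => (h r (hRr r hr)).2.1
  have hUd : ∀ r, r₁ ≤ r → HasDerivAt U (P r) r := fun r hr => (h r (hRr r hr)).2.2.1
  set u₁ := U r₁ with hu₁
  have hu₁pos : 0 < u₁ := hUpos r₁ le_rfl
  have hUm : MonotoneOn U (Ici r₁) :=
    monotoneOn_of_hasDerivWithinAt_nonneg (convex_Ici r₁)
      (fun r hr => (hUd r hr).continuousAt.continuousWithinAt)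
      (fun r hr => (hUd r (interior_subset hr)).hasDerivWithinAt)
      fun r hr => (hPpos r (interior_subset hr)).le
  have hUge : ∀ r, r₁ ≤ r → u₁ ≤ U r := fun r hr => hUm (mem_Ici.2 le_rfl) hr hr
  have hreac : ∀ r, r₁ ≤ r → γ * U r ^ (γ - 1) ≤ γ * u₁ ^ (γ - 1) := fun r hr =>
    mul_le_mul_of_nonneg_left
      (Real.rpow_le_rpow_of_nonpos hu₁pos (hUge r hr) (by linarith)) hγ₀
  have hreac0 : ∀ r, r₁ ≤ r → 0 ≤ γ * U r ^ (γ - 1) := fun r hr =>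
    mul_nonneg hγ₀ (Real.rpow_nonneg (hUpos r hr).le _)
  -- the deviation from homogeneity
  set D : ℝ → ℝ := fun r => r * P r - β * U r with hD
  have hDd : ∀ r, r₁ ≤ r → HasDerivAt D
      ((2 - β - n) * P r - r / 2 * D r + r * (γ * U r ^ (γ - 1))) r := fun r hr => by
    refine (((hasDerivAt_id r).mul (h r (hRr r hr)).2.2.2).sub
      ((hUd r hr).const_mul β)).congr_deriv ?_
    have := profileDrift_mul_self n (hr0 r hr)
    simp only [hD, id]
    linear_combination (-P r) * this
  -- A constant above `2 γ u₁^(γ-1)` is a supersolution: the damping `(r/2) M₁` beats the reaction,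
  -- and `(2 - β - n) P ≤ 0`.
  set M₁ := max (2 * (γ * u₁ ^ (γ - 1))) (D r₁) with hM₁
  have hM₁0 : 0 ≤ M₁ := le_max_of_le_left (by positivity)
  have hDle : ∀ r, r₁ ≤ r → D r ≤ M₁ := fun r hr => by
    have := nonneg_of_deriv_add_mul_nonneg (S := fun r => M₁ - D r)
      (fun r hr => (hDd r hr).const_sub M₁) (sub_nonneg.2 (le_max_right _ _)) (fun r hr => by
        have h1 := mul_le_mul_of_nonneg_left (hreac r hr) (hr0 r hr).le
        have h2 : 2 * (γ * u₁ ^ (γ - 1)) ≤ M₁ := le_max_left _ _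
        have h3 := mul_le_mul_of_nonneg_left h2 (hr0 r hr).le
        have h4 : (2 - β - n) * P r ≤ 0 :=
          mul_nonpos_of_nonpos_of_nonneg (by linarith) (hPpos r hr).le
        linarith) hr
    linarith
  set C₂ := β + M₁ / u₁ with hC₂
  have hPle : ∀ r, r₁ ≤ r → P r ≤ C₂ * (U r / r) := fun r hr => by
    have h1 : r * P r ≤ β * U r + M₁ := by have := hDle r hr; simp only [hD] at this; linarith
    have h2 : M₁ ≤ M₁ / u₁ * U r := by
      rw [div_mul_eq_mul_div, le_div_iff₀ hu₁pos]
      exact mul_le_mul_of_nonneg_left (hUge r hr) hM₁0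
    rw [← mul_div_assoc, le_div_iff₀ (hr0 r hr), hC₂]
    linarith
  set C₃ := (n + β) * C₂ with hC₃
  -- The barrier is `-M U/r²`. Its damping yields `M U/(2r)`, which for `M ≥ 4 C₃` and `r ≥ 3`
  -- covers both `(n + β) P ≤ C₃ U/r` and the error `2 M U/r³`. The second entry of the maximum
  -- handles the initial value.
  set M := max (4 * C₃) (|D r₁| * r₁ ^ 2 / u₁) with hM
  have hDge : ∀ r, r₁ ≤ r → 0 ≤ D r + M * (U r / r ^ 2) := fun r hr => by
    refine nonneg_of_deriv_add_mul_nonneg (S := fun r => D r + M * (U r / r ^ 2))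
      (fun r hr => (hDd r hr).add (((hUd r hr).div (hasDerivAt_pow 2 r)
        (pow_pos (hr0 r hr) 2).ne').const_mul M)) ?_ (fun r hr => ?_) hr
    · have h0 := hr0 r₁ le_rfl
      have h1 : |D r₁| * r₁ ^ 2 / u₁ * (u₁ / r₁ ^ 2) ≤ M * (u₁ / r₁ ^ 2) :=
        mul_le_mul_of_nonneg_right (le_max_right _ _) (by positivity)
      have h2 : |D r₁| * r₁ ^ 2 / u₁ * (u₁ / r₁ ^ 2) = |D r₁| := by field_simp
      have h3 := neg_abs_le (D r₁)
      change 0 ≤ D r₁ + M * (u₁ / r₁ ^ 2)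
      linarith
    · have h0 := hr0 r hr
      have hU := hUpos r hr
      have hP := hPpos r hr
      have hMC : 4 * C₃ ≤ M := le_max_left _ _
      have hC₃0 : 0 ≤ C₃ := by positivity
      have hM0 : 0 ≤ M := le_trans (by positivity) hMC
      have h1 : (n + β) * P r ≤ C₃ * (U r / r) := by
        rw [hC₃, mul_assoc]; exact mul_le_mul_of_nonneg_left (hPle r hr) (by positivity)
      have h2 := mul_nonneg h0.le (hreac0 r hr)
      have h3 : 0 ≤ M * (P r / r ^ 2) := by positivity
      have h4 : 1 / r ^ 2 ≤ 1 / 9 := by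
        have := hr3 r hr
        apply one_div_le_one_div_of_le (by norm_num); nlinarith
      have h5 : 0 ≤ U r / r * (M / 2 - 2 * M * (1 / r ^ 2) - C₃) := by
        apply mul_nonneg (by positivity)
        have := mul_le_mul_of_nonneg_left h4 (by positivity : 0 ≤ 2 * M)
        linarith
      have e : (2 - β - n) * P r - r / 2 * D r + r * (γ * U r ^ (γ - 1))
          + M * ((P r * r ^ 2 - U r * (((2 : ℕ) : ℝ) * r ^ (2 - 1))) / (r ^ 2) ^ 2)
          + r / 2 * (D r + M * (U r / r ^ 2))
          = r * (γ * U r ^ (γ - 1)) + M * (P r / r ^ 2) + 2 * P r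
            + (C₃ * (U r / r) - (n + β) * P r)
            + U r / r * (M / 2 - 2 * M * (1 / r ^ 2) - C₃) := by
        push_cast
        field_simp
        ring
      rw [e]
      linarith
  have hrpow : ∀ r, r₁ ≤ r → 0 < r ^ (-β) := fun r hr => Real.rpow_pos_of_pos (hr0 r hr) _
  -- Since `q' = D r^(-β-1)`, the bounds on `D` control the variation of `q`.
  set q : ℝ → ℝ := fun r => U r * r ^ (-β) with hq
  have hqd : ∀ r, r₁ ≤ r → HasDerivAt q (D r * r ^ (-β) / r) r := fun r hr => by
    have h0 := hr0 r hr
    refine ((hUd r hr).mul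
      (Real.hasDerivAt_rpow_const (p := -β) (Or.inl h0.ne'))).congr_deriv ?_
    rw [Real.rpow_sub_one h0.ne']
    simp only [hD]; field_simp
    ring
  -- upper bound gives convergence
  set H : ℝ → ℝ := fun r => q r + M₁ / β * r ^ (-β) with hH
  have hβ0 : 0 < β := by linarith
  have hHa : AntitoneOn H (Ici r₁) := by
    have hd : ∀ r, r₁ ≤ r → HasDerivAt H ((D r - M₁) * r ^ (-β) / r) r := fun r hr => by
      have h0 := hr0 r hr
      refine ((hqd r hr).add ((Real.hasDerivAt_rpow_const (p := -β)
        (Or.inl h0.ne')).const_mul (M₁ / β))).congr_deriv ?_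
      rw [Real.rpow_sub_one h0.ne']
      field_simp
      ring
    refine antitoneOn_of_hasDerivWithinAt_nonpos (convex_Ici r₁)
      (fun r hr => (hd r hr).continuousAt.continuousWithinAt)
      (fun r hr => (hd r (interior_subset hr)).hasDerivWithinAt) fun r hr => ?_
    have hr := interior_subset hr
    have h0 := hr0 r hr
    have h1 := hrpow r hr
    have h2 := hDle r hr
    rw [mul_div_assoc]
    exact mul_nonpos_of_nonpos_of_nonneg (by linarith) (by positivity)
  have hq0 : ∀ r, r₁ ≤ r → 0 < q r := fun r hr => mul_pos (hUpos r hr) (hrpow r hr)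
  obtain ⟨c, hc⟩ : ∃ c, Tendsto H atTop (𝓝 c) := by
    have h1 : Antitone fun r => H (max r r₁) := fun r s hrs =>
      hHa (mem_Ici.2 (le_max_right _ _)) (mem_Ici.2 (le_max_right _ _)) (max_le_max_right _ hrs)
    have h2 : BddBelow (range fun r => H (max r r₁)) := by
      refine ⟨0, ?_⟩
      rintro _ ⟨r, rfl⟩
      have h3 := hq0 _ (le_max_right r r₁)
      have h4 := hrpow _ (le_max_right r r₁)
      simp only [hH]
      positivity
    refine ⟨_, (tendsto_atTop_ciInf h1 h2).congr' ?_⟩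
    filter_upwards [eventually_ge_atTop r₁] with r hr
    simp only [max_eq_left hr]
  have hqc : Tendsto q atTop (𝓝 c) := by
    have h1 := hc.sub ((tendsto_rpow_neg_atTop hβ0).const_mul (M₁ / β))
    simp only [mul_zero, sub_zero] at h1
    refine h1.congr fun r => ?_
    simp only [hH]; ring
  -- lower bound gives positivity of the limit
  set c₀ := q r₁ * Real.exp (-(M / 2) * (r₁ ^ 2)⁻¹) with hc₀
  have hc₀pos : 0 < c₀ := mul_pos (hq0 _ le_rfl) (Real.exp_pos _)
  have hqge : ∀ r, r₁ ≤ r → c₀ ≤ q r := fun r hr => by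
    have hd : ∀ r, r₁ ≤ r → HasDerivAt (fun r => q r * Real.exp (-(M / 2) * (r ^ 2)⁻¹))
        ((D r + M * (U r / r ^ 2)) * (r ^ (-β) / r * Real.exp (-(M / 2) * (r ^ 2)⁻¹))) r :=
      fun r hr => by
        have h0 := hr0 r hr
        refine ((hqd r hr).mul ((((hasDerivAt_pow 2 r).fun_inv
          (pow_pos h0 2).ne').const_mul (-(M / 2))).exp)).congr_deriv ?_
        simp only [hq]
        push_cast
        field_simp
    have hm : MonotoneOn (fun r => q r * Real.exp (-(M / 2) * (r ^ 2)⁻¹)) (Ici r₁) :=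
      monotoneOn_of_hasDerivWithinAt_nonneg (convex_Ici r₁)
        (fun r hr => (hd r hr).continuousAt.continuousWithinAt)
        (fun r hr => (hd r (interior_subset hr)).hasDerivWithinAt) fun r hr => by
          have hr := interior_subset hr
          have h0 := hr0 r hr
          have h1 := hrpow r hr
          exact mul_nonneg (hDge r hr) (by positivity)
    have h1 : c₀ ≤ q r * Real.exp (-(M / 2) * (r ^ 2)⁻¹) := hm (mem_Ici.2 le_rfl) hr hr
    have hM0 : 0 ≤ M := le_max_of_le_right (by positivity)
    have h2 : Real.exp (-(M / 2) * (r ^ 2)⁻¹) ≤ 1 := by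
      rw [Real.exp_le_one_iff]
      have : 0 ≤ M / 2 * (r ^ 2)⁻¹ := by positivity
      linarith
    exact h1.trans (mul_le_of_le_one_right (hq0 r hr).le h2)
  refine ⟨c, hc₀pos.trans_le (ge_of_tendsto hqc ?_), hqc.congr' ?_⟩
  · filter_upwards [eventually_ge_atTop r₁] with r hr using hqge r hr
  · filter_upwards [eventually_ge_atTop r₁] with r hr
    simp only [hq]
    rw [Real.rpow_neg (hr0 r hr).le, div_eq_mul_inv]

/-- A profile is not required to be continuous at `R`; continuity from the right is recovered from
the differentiability of `U^(1/β)`. -/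
theorem continuousWithinAt_of_rpow {U : ℝ → ℝ} {b R : ℝ} (hb : 0 < b)
    (hU : ∀ r, R ≤ r → 0 ≤ U r)
    (h : ContinuousWithinAt (fun r => U r ^ (1 / b)) (Ici R) R) :
    ContinuousWithinAt U (Ici R) R := by
  have e : ∀ r, R ≤ r → (U r ^ (1 / b)) ^ b = U r := fun r hr => by
    rw [← Real.rpow_mul (hU r hr), one_div_mul_cancel hb.ne', Real.rpow_one]
  exact (h.rpow_const (Or.inr hb.le)).congr (fun r hr => (e r hr).symm) (e R le_rfl).symm

theorem exists_selfSimilarProfile {n : ℕ} (hn : 1 ≤ n) {γ R : ℝ} (hγ₀ : 0 ≤ γ) (hγ₁ : γ ≤ 1)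
    (hR : 0 < R) :
    ∃ U : ℝ → ℝ, IsSelfSimilarProfile n γ R U ∧ StrictMonoOn U (Ici R) ∧
      ∃ c : ℝ, 0 < c ∧ Tendsto (fun r => U r / r ^ scalingExponent γ) atTop (𝓝 c) := by
  obtain ⟨U, P, hU0, hfb, h⟩ := exists_profile_system n hγ₀ hγ₁ hR
  have hβ := one_le_scalingExponent hγ₀ hγ₁
  have hdU : EqOn (deriv U) P (Ioi R) := fun r hr => (h r hr).2.2.1.deriv
  refine ⟨U, ⟨?_, fun r hr => (h r hr).1, fun r _ hr => hU0 r hr, fun r hr => ?_, hfb⟩, ?_,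
    exists_tendsto_profile_div_rpow hn hγ₀ hγ₁ hβ hR h⟩
  · have hUc : ContinuousOn U (Ioi R) := fun r hr =>
      (h r hr).2.2.1.continuousAt.continuousWithinAt
    have hPc : ContinuousOn P (Ioi R) := fun r hr =>
      (h r hr).2.2.2.continuousAt.continuousWithinAt
    -- Bootstrap: the equation expresses `P'` through continuous functions, so `P` is `C¹` and `U`
    -- is `C²`.
    have hP1 : ContDiffOn ℝ 1 P (Ioi R) := by
      rw [show (1 : WithTop ℕ∞) = 0 + 1 from rfl, contDiffOn_succ_iff_deriv_of_isOpen isOpen_Ioi]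
      refine ⟨fun r hr => (h r hr).2.2.2.differentiableAt.differentiableWithinAt, by simp, ?_⟩
      rw [contDiffOn_zero]
      have hc : ContinuousOn (fun r => scalingExponent γ / 2 * U r + γ * U r ^ (γ - 1)
          - profileDrift n r * P r) (Ioi R) := by
        refine ((hUc.const_smul (scalingExponent γ / 2)).add ((hUc.rpow_const fun r hr =>
          Or.inl (h r hr).1.ne').const_smul γ)).sub (ContinuousOn.mul (fun r hr => ?_) hPc)
        exact (contDiffAt_profileDrift n (hR.trans hr)).continuousAt.continuousWithinAt
      exact hc.congr fun r hr => (h r hr).2.2.2.deriv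
    rw [show (2 : WithTop ℕ∞) = 1 + 1 from rfl, contDiffOn_succ_iff_deriv_of_isOpen isOpen_Ioi]
    refine ⟨fun r hr => (h r hr).2.2.1.differentiableAt.differentiableWithinAt, by simp, ?_⟩
    exact hP1.congr hdU
  · have h1 : deriv (deriv U) r = deriv P r :=
      (Filter.eventuallyEq_of_mem (Ioi_mem_nhds hr) hdU).deriv_eq
    rw [h1, (h r hr).2.2.2.deriv, hdU hr, profileDrift]
    ring
  · refine strictMonoOn_of_deriv_pos (convex_Ici R) (fun r hr => ?_) fun r hr => ?_
    · rcases eq_or_lt_of_le (mem_Ici.1 hr) with rfl | hr'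
      · refine continuousWithinAt_of_rpow (by linarith : 0 < scalingExponent γ) (fun r hr => ?_)
          hfb.continuousWithinAt
        rcases eq_or_lt_of_le hr with rfl | hr'
        · exact (hU0 _ le_rfl).ge
        · exact (h r hr').1.le
      · exact (h r hr').2.2.1.continuousAt.continuousWithinAt
    · rw [interior_Ici] at hr
      rw [hdU hr]
      exact (h r hr).2.1

/-! ### The similarity variable and the exterior region. -/

/-- The integration by parts in `integral_fderiv_eq_zero` is for additive Haar measures. -/
instance isAddHaarMeasure_spacetime (n : ℕ) :
    (volume : Measure (Spacetime n)).IsAddHaarMeasure :=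
  Measure.prod.instIsAddHaarMeasure (volume : Measure (EuclideanSpace ℝ (Fin n)))
    (volume : Measure ℝ)

/-- The self-similar variable `t^(-1/2) |x|`. -/
noncomputable def similarityVar {n : ℕ} (z : Spacetime n) : ℝ := z.2 ^ (-(1 / 2) : ℝ) * ‖z.1‖

/-- The region `t > 0`, `|x| > R √t`. -/
def exteriorRegion (n : ℕ) (R : ℝ) : Set (Spacetime n) := {z | 0 < z.2 ∧ R < similarityVar z}

section Region

variable {n : ℕ} {R : ℝ}

theorem continuousOn_similarityVar : ContinuousOn (similarityVar (n := n)) (upperSpacetime n) :=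
  fun _ hz => ((continuousAt_snd.rpow_const (Or.inl (ne_of_gt hz))).mul
    (continuous_norm.continuousAt.comp continuousAt_fst)).continuousWithinAt

theorem isOpen_upperSpacetime : IsOpen (upperSpacetime n) :=
  isOpen_lt continuous_const continuous_snd

theorem isOpen_exteriorRegion : IsOpen (exteriorRegion n R) :=
  continuousOn_similarityVar.isOpen_inter_preimage isOpen_upperSpacetime (isOpen_Ioi (a := R))

theorem norm_pos_of_mem_exteriorRegion (hR : 0 < R) {z : Spacetime n}
    (hz : z ∈ exteriorRegion n R) : 0 < ‖z.1‖ := by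
  by_contra h
  have h0 : ‖z.1‖ = 0 := le_antisymm (not_lt.1 h) (norm_nonneg _)
  have := hz.2
  rw [similarityVar, h0, mul_zero] at this
  linarith

/-- The derivative of the self-similar variable. -/
theorem hasFDerivAt_similarityVar {z : Spacetime n} (ht : 0 < z.2) (hx : 0 < ‖z.1‖) :
    ∃ L : Spacetime n →L[ℝ] ℝ, HasFDerivAt similarityVar L z ∧
      (∀ v, L (v, 0) = z.2 ^ (-(1 / 2) : ℝ) * (inner ℝ z.1 v / ‖z.1‖)) ∧
      L (0, 1) = -(1 / 2) * similarityVar z / z.2 := by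
  have h0 : HasFDerivAt (fun z : Spacetime n => z.1)
      (ContinuousLinearMap.fst ℝ (EuclideanSpace ℝ (Fin n)) ℝ) z := hasFDerivAt_fst
  have h0' : HasFDerivAt (fun z : Spacetime n => z.2)
      (ContinuousLinearMap.snd ℝ (EuclideanSpace ℝ (Fin n)) ℝ) z := hasFDerivAt_snd
  have h1 := h0'.rpow_const (p := -(1 / 2)) (Or.inl ht.ne')
  have h2 := h0.norm_sq.sqrt (pow_pos hx 2).ne'
  have h3 := h2.congr_of_eventuallyEq (f₁ := fun z : Spacetime n => ‖z.1‖)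
    (Eventually.of_forall fun z => (Real.sqrt_sq (norm_nonneg _)).symm)
  refine ⟨_, h1.mul h3, fun v => ?_, ?_⟩
  · simp
    left
    field_simp
  · simp [similarityVar, Real.rpow_sub_one ht.ne']
    field_simp

theorem contDiffAt_similarityVar {k : WithTop ℕ∞} {z : Spacetime n} (ht : 0 < z.2)
    (hx : 0 < ‖z.1‖) : ContDiffAt ℝ k similarityVar z :=
  (contDiffAt_snd.rpow_const_of_ne ht.ne').mul
    (contDiffAt_fst.norm ℝ (norm_pos_iff.1 hx))

end Region

/-! ### Cutoffs near the free boundary. -/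

/-- A smooth cutoff vanishing on `(-∞, R + 1/(m+1)]` and equal to one on `[R + 2/(m+1), ∞)`. -/
noncomputable def cutoff (R : ℝ) (m : ℕ) (s : ℝ) : ℝ :=
  Real.smoothTransition (((m : ℝ) + 1) * (s - R) - 1)

theorem contDiff_cutoff (R : ℝ) (m : ℕ) {k : ℕ∞} : ContDiff ℝ k (cutoff R m) :=
  Real.smoothTransition.contDiff.comp
    ((contDiff_const.mul (contDiff_id.sub contDiff_const)).sub contDiff_const)

theorem cutoff_nonneg (R : ℝ) (m : ℕ) (s : ℝ) : 0 ≤ cutoff R m s :=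
  Real.smoothTransition.nonneg _

theorem cutoff_le_one (R : ℝ) (m : ℕ) (s : ℝ) : cutoff R m s ≤ 1 :=
  Real.smoothTransition.le_one _

theorem cutoff_eq_zero {R : ℝ} {m : ℕ} {s : ℝ} (h : s ≤ R + 1 / ((m : ℝ) + 1)) :
    cutoff R m s = 0 := by
  have hm : (0 : ℝ) < (m : ℝ) + 1 := by positivity
  apply Real.smoothTransition.zero_of_nonpos
  have h1 := mul_le_mul_of_nonneg_left h hm.le
  have h2 : ((m : ℝ) + 1) * (1 / ((m : ℝ) + 1)) = 1 := mul_one_div_cancel hm.ne'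
  linarith

theorem cutoff_eq_one {R : ℝ} {m : ℕ} {s : ℝ} (h : R + 2 / ((m : ℝ) + 1) ≤ s) :
    cutoff R m s = 1 := by
  have hm : (0 : ℝ) < (m : ℝ) + 1 := by positivity
  apply Real.smoothTransition.one_of_one_le
  have h1 := mul_le_mul_of_nonneg_left h hm.le
  have h2 : ((m : ℝ) + 1) * (2 / ((m : ℝ) + 1)) = 2 := mul_div_cancel₀ _ hm.ne'
  linarith

/-- The sign allows weighted integrals of the cutoff derivative to be compared, which gives bounds
independent of `m`. -/
theorem deriv_cutoff_nonneg (R : ℝ) (m : ℕ) (s : ℝ) : 0 ≤ deriv (cutoff R m) s := by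
  apply Monotone.deriv_nonneg
  intro x y hxy
  apply Real.smoothTransition.monotone
  have : (0 : ℝ) ≤ (m : ℝ) + 1 := by positivity
  have := mul_le_mul_of_nonneg_left hxy this
  linarith

theorem deriv_cutoff_eq_zero_of_lt {R : ℝ} {m : ℕ} {s : ℝ} (h : s < R + 1 / ((m : ℝ) + 1)) :
    deriv (cutoff R m) s = 0 := by
  have : cutoff R m =ᶠ[𝓝 s] fun _ => 0 := by
    filter_upwards [gt_mem_nhds h] with r hr using cutoff_eq_zero hr.le
  rw [this.deriv_eq, deriv_const]

theorem deriv_cutoff_eq_zero_of_gt {R : ℝ} {m : ℕ} {s : ℝ} (h : R + 2 / ((m : ℝ) + 1) < s) :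
    deriv (cutoff R m) s = 0 := by
  have : cutoff R m =ᶠ[𝓝 s] fun _ => 1 := by
    filter_upwards [lt_mem_nhds h] with r hr using cutoff_eq_one hr.le
  rw [this.deriv_eq, deriv_const]

theorem tendsto_cutoff {R s : ℝ} (h : R < s) :
    Tendsto (fun m => cutoff R m s) atTop (𝓝 1) := by
  have h1 : Tendsto (fun m : ℕ => R + 2 * (1 / ((m : ℝ) + 1))) atTop (𝓝 (R + 2 * 0)) :=
    (tendsto_one_div_add_atTop_nhds_zero_nat.const_mul 2).const_add R
  rw [mul_zero, add_zero] at h1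
  refine tendsto_const_nhds.congr' ?_
  filter_upwards [h1.eventually_lt_const h] with m hm
  rw [cutoff_eq_one]
  rw [mul_one_div] at hm
  exact hm.le

/-- Fatou's lemma for the norms: no dominating function is needed, only a finite lower limit of the
`L¹` norms. -/
theorem integrable_of_ae_tendsto {α : Type*} {m : MeasurableSpace α} {G : ℕ → α → ℝ} {f : α → ℝ}
    {μ : Measure α} (hGf : ∀ᵐ x ∂μ, Tendsto (fun n => G n x) atTop (𝓝 (f x)))
    (hG : ∀ n, AEStronglyMeasurable (G n) μ)
    (hG' : liminf (fun n => ∫⁻ x, ‖G n x‖ₑ ∂μ) atTop ≠ ⊤) : Integrable f μ := by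
  refine ⟨aestronglyMeasurable_of_tendsto_ae _ hG hGf, lt_of_le_of_lt ?_ hG'.lt_top⟩
  calc ∫⁻ x, ‖f x‖ₑ ∂μ = ∫⁻ x, liminf (fun n => ‖G n x‖ₑ) atTop ∂μ :=
        lintegral_congr_ae (hGf.mono fun x hx => hx.enorm.liminf_eq.symm)
    _ ≤ _ := lintegral_liminf_le' fun n => (hG n).aemeasurable.enorm

/-! ### Divergence theorem up to the free boundary. -/

section Divergence

variable {n : ℕ} {R : ℝ} {K : Set (Spacetime n)}

/-- Multiplication by a function of the self-similar variable that vanishes near `R` extends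
functions on the exterior region to the whole space-time. -/
theorem contDiff_indicator_cutoff (hR : 0 < R) (hK : IsCompact K) (hKQ : K ⊆ upperSpacetime n)
    {k : ℕ∞} {θ : ℝ → ℝ} {ε : ℝ} (hε : 0 < ε) (hθ : ContDiff ℝ k θ)
    (hθ0 : ∀ s, s < R + ε → θ s = 0) {f : Spacetime n → ℝ}
    (hf : ContDiffOn ℝ k f (exteriorRegion n R)) (hfK : ∀ z ∉ K, f z = 0) :
    ContDiff ℝ k ((exteriorRegion n R).indicator fun z => θ (similarityVar z) * f z) ∧
      HasCompactSupport ((exteriorRegion n R).indicator fun z => θ (similarityVar z) * f z) := by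
  set g := (exteriorRegion n R).indicator fun z => θ (similarityVar z) * f z with hg
  have hgK : ∀ z ∉ K, g z = 0 := fun z hz =>
    indicator_apply_eq_zero.2 fun _ => by simp only [hfK z hz, mul_zero]
  refine ⟨contDiff_iff_contDiffAt.2 fun z => ?_, HasCompactSupport.intro hK hgK⟩
  -- Off the exterior region the function vanishes near `z` for one of two reasons: if `t > 0`, then
  -- `θ` is zero nearby; otherwise `z` lies outside the compact set `K`.
  by_cases hz : z ∈ exteriorRegion n R
  · have h1 : ContDiffAt ℝ k (fun z => θ (similarityVar z) * f z) z :=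
      (hθ.contDiffAt.comp z (contDiffAt_similarityVar hz.1
        (norm_pos_of_mem_exteriorRegion hR hz))).mul
        (hf.contDiffAt (isOpen_exteriorRegion.mem_nhds hz))
    refine h1.congr_of_eventuallyEq ?_
    filter_upwards [isOpen_exteriorRegion.mem_nhds hz] with w hw using indicator_of_mem hw _
  · refine (contDiffAt_const (c := (0 : ℝ))).congr_of_eventuallyEq ?_
    by_cases ht : z ∈ upperSpacetime n
    · have hle : similarityVar z < R + ε := by
        have : similarityVar z ≤ R := not_lt.1 fun h => hz ⟨ht, h⟩
        linarith
      have hmem := isOpen_upperSpacetime.mem_nhds ht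
      filter_upwards [(continuousOn_similarityVar.continuousAt hmem).eventually_lt_const hle]
        with w hw
      exact indicator_apply_eq_zero.2 fun _ => by simp only [hθ0 _ hw, zero_mul]
    · filter_upwards [hK.isClosed.isOpen_compl.mem_nhds fun h => ht (hKQ h)] with w hw
      exact hgK w hw

/-- Integration by parts against the constant `1`. -/
theorem integral_fderiv_eq_zero {f : Spacetime n → ℝ} (hf : ContDiff ℝ 1 f)
    (hc : HasCompactSupport f) (v : Spacetime n) : ∫ z, fderiv ℝ f z v = 0 := by
  have hd : Continuous fun z => fderiv ℝ f z v :=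
    (hf.continuous_fderiv one_ne_zero).clm_apply continuous_const
  have h := integral_mul_fderiv_eq_neg_fderiv_mul_of_integrable
    (μ := (volume : Measure (Spacetime n))) (f := fun _ => (1 : ℝ)) (g := f) (v := v) (by simp)
    (by simpa using hd.integrable_of_hasCompactSupport (hc.fderiv_apply (𝕜 := ℝ) v))
    (by simpa using hf.continuous.integrable_of_hasCompactSupport hc)
    (fun z _ => differentiableAt_const _) (fun z _ => hf.differentiable one_ne_zero z)
  simpa using h

variable {ι : Type*} [Fintype ι] {f : ι → Spacetime n → ℝ} {v : ι → Spacetime n}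

/-- The divergence of the vector field `∑ᵢ fᵢ vᵢ`. -/
noncomputable def familyDiv (f : ι → Spacetime n → ℝ) (v : ι → Spacetime n)
    (z : Spacetime n) : ℝ := ∑ i, fderiv ℝ (f i) z (v i)

/-- The component of the vector field `∑ᵢ fᵢ vᵢ` along the gradient of the self-similar
variable. -/
noncomputable def familyFlux (f : ι → Spacetime n → ℝ) (v : ι → Spacetime n)
    (z : Spacetime n) : ℝ := ∑ i, f i z * fderiv ℝ similarityVar z (v i)

theorem familyDiv_eq_zero (hK : IsCompact K) (hfK : ∀ i, ∀ z ∉ K, f i z = 0) {z : Spacetime n}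
    (hz : z ∉ K) : familyDiv f v z = 0 := by
  refine Finset.sum_eq_zero fun i _ => ?_
  have : f i =ᶠ[𝓝 z] fun _ => 0 := by
    filter_upwards [hK.isClosed.isOpen_compl.mem_nhds hz] with w hw using hfK i w hw
  rw [this.fderiv_eq]; simp

theorem familyFlux_eq_zero (hfK : ∀ i, ∀ z ∉ K, f i z = 0) {z : Spacetime n}
    (hz : z ∉ K) : familyFlux f v z = 0 :=
  Finset.sum_eq_zero fun i _ => by rw [hfK i z hz, zero_mul]

theorem continuousOn_familyDiv (hf : ∀ i, ContDiffOn ℝ 1 (f i) (exteriorRegion n R)) :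
    ContinuousOn (familyDiv f v) (exteriorRegion n R) :=
  continuousOn_finsetSum _ fun i _ =>
    ((hf i).continuousOn_fderiv_of_isOpen isOpen_exteriorRegion le_rfl).clm_apply
      continuousOn_const

theorem continuousOn_familyFlux (hR : 0 < R)
    (hf : ∀ i, ContDiffOn ℝ 1 (f i) (exteriorRegion n R)) :
    ContinuousOn (familyFlux f v) (exteriorRegion n R) :=
  continuousOn_finsetSum _ fun i _ => by
    have h1 : ContDiffOn ℝ 1 (similarityVar (n := n)) (exteriorRegion n R) := fun z hz =>
      (contDiffAt_similarityVar hz.1 (norm_pos_of_mem_exteriorRegion hR hz)).contDiffWithinAt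
    exact (hf i).continuousOn.mul
      ((h1.continuousOn_fderiv_of_isOpen isOpen_exteriorRegion le_rfl).clm_apply
        continuousOn_const)

theorem integrable_cutoff_familyDiv (hR : 0 < R) (hK : IsCompact K)
    (hKQ : K ⊆ upperSpacetime n) (hf : ∀ i, ContDiffOn ℝ 1 (f i) (exteriorRegion n R))
    (hfK : ∀ i, ∀ z ∉ K, f i z = 0) (m : ℕ) :
    IntegrableOn (fun z => cutoff R m (similarityVar z) * familyDiv f v z)
      (exteriorRegion n R) := by
  rw [← integrable_indicator_iff isOpen_exteriorRegion.measurableSet]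
  obtain ⟨h1, h2⟩ := contDiff_indicator_cutoff (k := 0) hR hK hKQ
    (by positivity : 0 < 1 / ((m : ℝ) + 1)) (contDiff_cutoff R m)
    (fun s hs => cutoff_eq_zero hs.le) (contDiffOn_zero.2 (continuousOn_familyDiv (v := v) hf))
    (fun z hz => familyDiv_eq_zero hK hfK hz)
  exact h1.continuous.integrable_of_hasCompactSupport h2

theorem integrable_deriv_cutoff_mul (hR : 0 < R) (hK : IsCompact K)
    (hKQ : K ⊆ upperSpacetime n) {g : Spacetime n → ℝ}
    (hg : ContinuousOn g (exteriorRegion n R)) (hgK : ∀ z ∉ K, g z = 0) (m : ℕ) :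
    IntegrableOn (fun z => deriv (cutoff R m) (similarityVar z) * g z)
      (exteriorRegion n R) := by
  rw [← integrable_indicator_iff isOpen_exteriorRegion.measurableSet]
  obtain ⟨h1, h2⟩ := contDiff_indicator_cutoff (k := 0) hR hK hKQ
    (by positivity : 0 < 1 / ((m : ℝ) + 1))
    (contDiff_zero.2 ((contDiff_cutoff R m (k := 1)).continuous_deriv le_rfl))
    (fun s hs => deriv_cutoff_eq_zero_of_lt hs) (contDiffOn_zero.2 hg) hgK
  exact h1.continuous.integrable_of_hasCompactSupport h2

/-- The divergence theorem with a cutoff. -/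
theorem integral_cutoff_familyDiv (hR : 0 < R) (hK : IsCompact K)
    (hKQ : K ⊆ upperSpacetime n) (hf : ∀ i, ContDiffOn ℝ 1 (f i) (exteriorRegion n R))
    (hfK : ∀ i, ∀ z ∉ K, f i z = 0) (m : ℕ) :
    ∫ z in exteriorRegion n R, cutoff R m (similarityVar z) * familyDiv f v z =
      - ∫ z in exteriorRegion n R, deriv (cutoff R m) (similarityVar z) * familyFlux f v z := by
  set P := exteriorRegion n R with hP
  set g : ι → Spacetime n → ℝ :=
    fun i => P.indicator fun z => cutoff R m (similarityVar z) * f i z with hg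
  have hgc := fun i => contDiff_indicator_cutoff (k := 1) hR hK hKQ
    (by positivity : 0 < 1 / ((m : ℝ) + 1)) (contDiff_cutoff R m)
    (fun s hs => cutoff_eq_zero hs.le) (hf i) (hfK i)
  have hsum : ∫ z, ∑ i, fderiv ℝ (g i) z (v i) = 0 := by
    rw [integral_finsetSum]
    · exact Finset.sum_eq_zero fun i _ => integral_fderiv_eq_zero (hgc i).1 (hgc i).2 _
    · intro i _
      exact (((hgc i).1.continuous_fderiv (by simp)).clm_apply
        continuous_const).integrable_of_hasCompactSupport ((hgc i).2.fderiv_apply (𝕜 := ℝ) _)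
  have hzero : ∀ z ∉ P, ∀ i, fderiv ℝ (g i) z = 0 := by
    intro z hz i
    by_cases ht : z ∈ upperSpacetime n
    · have hle : similarityVar z < R + 1 / ((m : ℝ) + 1) := by
        have h1 : similarityVar z ≤ R := not_lt.1 fun h => hz ⟨ht, h⟩
        have h2 : 0 < 1 / ((m : ℝ) + 1) := by positivity
        linarith
      have : g i =ᶠ[𝓝 z] fun _ => 0 := by
        filter_upwards [(continuousOn_similarityVar.continuousAt
          (isOpen_upperSpacetime.mem_nhds ht)).eventually_lt_const hle] with w hw
        exact indicator_apply_eq_zero.2 fun _ => by simp only [cutoff_eq_zero hw.le, zero_mul]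
      rw [this.fderiv_eq]; simp
    · have : g i =ᶠ[𝓝 z] fun _ => 0 := by
        filter_upwards [hK.isClosed.isOpen_compl.mem_nhds fun h => ht (hKQ h)] with w hw
        exact indicator_apply_eq_zero.2 fun _ => by simp only [hfK i w hw, mul_zero]
      rw [this.fderiv_eq]; simp
  -- Product rule: `div (η(ξ) F) = η(ξ) div F + η'(ξ) F·∇ξ`.
  have hEq : (fun z => ∑ i, fderiv ℝ (g i) z (v i)) = P.indicator fun z =>
      cutoff R m (similarityVar z) * familyDiv f v z
        + deriv (cutoff R m) (similarityVar z) * familyFlux f v z := by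
    ext z
    by_cases hz : z ∈ P
    · rw [indicator_of_mem hz, familyDiv, familyFlux, Finset.mul_sum, Finset.mul_sum,
        ← Finset.sum_add_distrib]
      refine Finset.sum_congr rfl fun i _ => ?_
      have h1 : g i =ᶠ[𝓝 z] fun z => cutoff R m (similarityVar z) * f i z := by
        filter_upwards [isOpen_exteriorRegion.mem_nhds hz] with w hw using indicator_of_mem hw _
      have h2 : HasFDerivAt similarityVar (fderiv ℝ similarityVar z) z :=
        ((contDiffAt_similarityVar (k := 1) hz.1
          (norm_pos_of_mem_exteriorRegion hR hz)).differentiableAt one_ne_zero).hasFDerivAt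
      have h3 : HasFDerivAt (f i) (fderiv ℝ (f i) z) z :=
        (((hf i).contDiffAt (isOpen_exteriorRegion.mem_nhds hz)).differentiableAt
          one_ne_zero).hasFDerivAt
      have h4 : HasDerivAt (cutoff R m) (deriv (cutoff R m) (similarityVar z))
          (similarityVar z) :=
        ((contDiff_cutoff R m (k := 1)).differentiable one_ne_zero _).hasDerivAt
      have h5 : HasFDerivAt (fun z => cutoff R m (similarityVar z) * f i z) _ z :=
        (h4.comp_hasFDerivAt z h2).mul h3
      rw [h1.fderiv_eq, h5.fderiv]
      simp
      ring
    · rw [indicator_of_notMem hz]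
      exact Finset.sum_eq_zero fun i _ => by rw [hzero z hz i]; simp
  rw [hEq, integral_indicator isOpen_exteriorRegion.measurableSet, integral_add] at hsum
  · linarith
  · exact integrable_cutoff_familyDiv hR hK hKQ hf hfK m
  · exact integrable_deriv_cutoff_mul hR hK hKQ (continuousOn_familyFlux hR hf)
      (fun z hz => familyFlux_eq_zero hfK hz) m

/-- A smooth function that equals one on `K`, with compact support. -/
theorem exists_smooth_one_on_compact (hK : IsCompact K) (hKQ : K ⊆ upperSpacetime n) :
    ∃ (L : Set (Spacetime n)) (φ : Spacetime n → ℝ), IsCompact L ∧ L ⊆ upperSpacetime n ∧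
      ContDiff ℝ ∞ φ ∧ (∀ z, 0 ≤ φ z) ∧ (∀ z ∈ K, φ z = 1) ∧ ∀ z ∉ L, φ z = 0 := by
  obtain ⟨L, hL, hKL, hLQ⟩ := exists_compact_between hK isOpen_upperSpacetime hKQ
  obtain ⟨φ, h1, h2, h3, h4⟩ := exists_contMDiff_support_eq_eq_one_iff (n := ⊤)
    (modelWithCornersSelf ℝ (Spacetime n)) isOpen_interior hK.isClosed hKL
  refine ⟨L, φ, hL, hLQ, h1.contDiff, fun z => (h2 (mem_range_self z)).1,
    fun z hz => (h4 z).1 hz, fun z hz => ?_⟩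
  by_contra h
  exact hz (interior_subset (h3 ▸ (Function.mem_support.2 h)))

/-- The derivative of the cutoff grows with `m` on a layer that shrinks like `1/m`, so its integral
should stay of the order of the boundary area. No surface measure is needed: the field `φ x`, with
`φ = 1` on `K`, has flux `φ ξ ≥ R φ`, so the cutoff divergence theorem bounds the integral by `∫
|div (φ x)| / R`. -/
theorem exists_bound_integral_deriv_cutoff (hR : 0 < R) (hK : IsCompact K)
    (hKQ : K ⊆ upperSpacetime n) :
    ∃ C, 0 ≤ C ∧ ∀ (m : ℕ) (B : ℝ) (N : Spacetime n → ℝ), 0 ≤ B → (∀ z ∉ K, N z = 0) →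
      (∀ z ∈ exteriorRegion n R, similarityVar z ≤ R + 2 / ((m : ℝ) + 1) → |N z| ≤ B) →
      |∫ z in exteriorRegion n R, deriv (cutoff R m) (similarityVar z) * N z| ≤ B * C := by
  obtain ⟨L, φ, hL, hLQ, hφ, hφ0, hφ1, hφL⟩ := exists_smooth_one_on_compact hK hKQ
  set e : Fin n → Spacetime n := fun i => (EuclideanSpace.single i 1, 0) with he
  set f : Fin n → Spacetime n → ℝ := fun i z => φ z * z.1 i with hf
  have hfc : ∀ i, ContDiff ℝ 1 (f i) := fun i => by
    have h1 : ContDiff ℝ 1 fun z : Spacetime n => z.1 i :=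
      (EuclideanSpace.proj (𝕜 := ℝ) i).contDiff.comp contDiff_fst
    exact (hφ.of_le (by simp)).mul h1
  have hfL : ∀ i, ∀ z ∉ L, f i z = 0 := fun i z hz => by simp [hf, hφL z hz]
  have hflux : ∀ z ∈ exteriorRegion n R, familyFlux f e z = φ z * similarityVar z := by
    intro z hz
    have hx := norm_pos_of_mem_exteriorRegion hR hz
    obtain ⟨ℓ, h1, h2, -⟩ := hasFDerivAt_similarityVar hz.1 hx
    simp only [familyFlux, h1.fderiv, he, h2, hf]
    have h3 : ∀ i : Fin n, inner ℝ z.1 (EuclideanSpace.single i (1 : ℝ)) = z.1 i := fun i => by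
      simp [EuclideanSpace.inner_single_right]
    simp only [h3]
    have h4 : ∑ i, z.1 i * z.1 i = ‖z.1‖ ^ 2 := by
      rw [EuclideanSpace.norm_sq_eq]
      exact Finset.sum_congr rfl fun i _ => by rw [Real.norm_eq_abs, sq_abs, sq]
    calc _ = φ z * (z.2 ^ (-(1 / 2) : ℝ) / ‖z.1‖) * ∑ i, z.1 i * z.1 i := by
          rw [Finset.mul_sum]; exact Finset.sum_congr rfl fun i _ => by ring
      _ = _ := by rw [h4, similarityVar]; field_simp
  have hdiv : Integrable (familyDiv f e) := by
    have h1 : Continuous (familyDiv f e) := continuous_finsetSum _ fun i _ =>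
      ((hfc i).continuous_fderiv one_ne_zero).clm_apply continuous_const
    exact h1.integrable_of_hasCompactSupport
      (HasCompactSupport.intro hL fun z hz => familyDiv_eq_zero hL hfL hz)
  have hφint : ∀ m, IntegrableOn (fun z => deriv (cutoff R m) (similarityVar z) * φ z)
      (exteriorRegion n R) := fun m => integrable_deriv_cutoff_mul hR hL hLQ
        hφ.continuous.continuousOn hφL m
  have hfluxint : ∀ m, IntegrableOn
      (fun z => deriv (cutoff R m) (similarityVar z) * familyFlux f e z)
      (exteriorRegion n R) := fun m => integrable_deriv_cutoff_mul hR hL hLQ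
        (continuousOn_familyFlux hR fun i => (hfc i).contDiffOn)
        (fun z hz => familyFlux_eq_zero hfL hz) m
  set C := (∫ z, |familyDiv f e z|) / R with hC
  have hPm : MeasurableSet (exteriorRegion n R) := isOpen_exteriorRegion.measurableSet
  have hbound : ∀ m, ∫ z in exteriorRegion n R, deriv (cutoff R m) (similarityVar z) * φ z
      ≤ C := by
    intro m
    rw [hC, le_div_iff₀ hR]
    have h1 := integral_cutoff_familyDiv (v := e) hR hL hLQ (fun i => (hfc i).contDiffOn) hfL m
    calc _ = ∫ z in exteriorRegion n R, deriv (cutoff R m) (similarityVar z) * φ z * R :=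
          (integral_mul_const _ _).symm
      _ ≤ ∫ z in exteriorRegion n R, deriv (cutoff R m) (similarityVar z) * familyFlux f e z := by
          refine setIntegral_mono_on ((hφint m).mul_const R) (hfluxint m) hPm fun z hz => ?_
          rw [hflux z hz, ← mul_assoc]
          exact mul_le_mul_of_nonneg_left hz.2.le
            (mul_nonneg (deriv_cutoff_nonneg _ _ _) (hφ0 z))
      _ = ∫ z in exteriorRegion n R, -(cutoff R m (similarityVar z) * familyDiv f e z) := by
          rw [integral_neg, h1, neg_neg]
      _ ≤ ∫ z in exteriorRegion n R, |familyDiv f e z| := by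
          refine setIntegral_mono_on
            (integrable_cutoff_familyDiv hR hL hLQ (fun i => (hfc i).contDiffOn) hfL m).neg
            hdiv.abs.integrableOn hPm fun z hz => ?_
          refine (neg_le_abs _).trans ?_
          rw [abs_mul, abs_of_nonneg (cutoff_nonneg _ _ _)]
          exact mul_le_of_le_one_left (abs_nonneg _) (cutoff_le_one _ _ _)
      _ ≤ ∫ z, |familyDiv f e z| :=
          setIntegral_le_integral hdiv.abs (Eventually.of_forall fun z => abs_nonneg _)
  refine ⟨C, by positivity, fun m B N hB hNK hN => ?_⟩
  rw [← Real.norm_eq_abs]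
  calc _ ≤ ∫ z in exteriorRegion n R, B * (deriv (cutoff R m) (similarityVar z) * φ z) := by
        refine norm_integral_le_of_norm_le ((hφint m).const_mul B) ?_
        rw [ae_restrict_iff' hPm]
        refine Eventually.of_forall fun z hz => ?_
        have h0 := deriv_cutoff_nonneg R m (similarityVar z)
        have hφz := hφ0 z
        by_cases hzK : z ∈ K
        · by_cases hs : similarityVar z ≤ R + 2 / ((m : ℝ) + 1)
          · rw [norm_mul, Real.norm_of_nonneg h0, hφ1 z hzK, mul_one, mul_comm]
            exact mul_le_mul_of_nonneg_right (hN z hz hs) h0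
          · rw [deriv_cutoff_eq_zero_of_gt (not_le.1 hs)]; simp
        · rw [hNK z hzK, mul_zero, norm_zero]; positivity
    _ = B * ∫ z in exteriorRegion n R, deriv (cutoff R m) (similarityVar z) * φ z :=
        integral_const_mul _ _
    _ ≤ B * C := mul_le_mul_of_nonneg_left (hbound m) hB

/-! ### Integrability and vanishing of divergence integrals. -/

/-- A divergence that is bounded from below by an integrable function is integrable if the flux
through the boundary stays bounded. -/
theorem integrableOn_familyDiv (hR : 0 < R) (hK : IsCompact K)
    (hKQ : K ⊆ upperSpacetime n) (hf : ∀ i, ContDiffOn ℝ 1 (f i) (exteriorRegion n R))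
    (hfK : ∀ i, ∀ z ∉ K, f i z = 0) {B : ℝ} (hB : 0 ≤ B)
    (hflux : ∀ z ∈ exteriorRegion n R, similarityVar z ≤ R + 2 → |familyFlux f v z| ≤ B)
    {G : Spacetime n → ℝ} (hG : IntegrableOn G (exteriorRegion n R))
    (hFG : ∀ z ∈ exteriorRegion n R, -G z ≤ familyDiv f v z) :
    IntegrableOn (familyDiv f v) (exteriorRegion n R) := by
  set P := exteriorRegion n R with hP
  have hPm : MeasurableSet P := isOpen_exteriorRegion.measurableSet
  obtain ⟨C, hC, hCb⟩ := exists_bound_integral_deriv_cutoff hR hK hKQ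
  have hcm : ∀ m, ContinuousOn (fun z => cutoff R m (similarityVar z)) P := fun m =>
    (contDiff_cutoff R m (k := 0)).continuous.comp_continuousOn
      (continuousOn_similarityVar.mono fun z hz => hz.1)
  have hint := fun m => integrable_cutoff_familyDiv (v := v) hR hK hKQ hf hfK m
  have hintG : ∀ m, IntegrableOn (fun z => cutoff R m (similarityVar z) * G z) P := fun m => by
    refine hG.bdd_mul (c := 1) ((hcm m).aestronglyMeasurable hPm) ?_
    exact Eventually.of_forall fun z => by
      rw [Real.norm_of_nonneg (cutoff_nonneg _ _ _)]; exact cutoff_le_one _ _ _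
  -- Adding `G` makes the integrand nonnegative, so its `L¹` norm with cutoff is its integral, which
  -- the divergence theorem evaluates.
  have hmain : IntegrableOn (fun z => familyDiv f v z + G z) P := by
    refine integrable_of_ae_tendsto
      (G := fun m z => cutoff R m (similarityVar z) * familyDiv f v z
        + cutoff R m (similarityVar z) * G z) ?_
      (fun m => ((hint m).add (hintG m)).aestronglyMeasurable) ?_
    · rw [ae_restrict_iff' hPm]
      refine Eventually.of_forall fun z hz => ?_
      have h1 := tendsto_cutoff hz.2
      simpa using (h1.mul_const (familyDiv f v z)).add (h1.mul_const (G z))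
    · refine ne_of_lt (lt_of_le_of_lt ?_ (ENNReal.ofReal_lt_top (r := B * C + ∫ z in P, |G z|)))
      refine (liminf_le_liminf (v := fun _ => ENNReal.ofReal (B * C + ∫ z in P, |G z|))
        (Eventually.of_forall fun m => ?_)).trans_eq (liminf_const _)
      have hnn : 0 ≤ᵐ[volume.restrict P] fun z => cutoff R m (similarityVar z) * familyDiv f v z
          + cutoff R m (similarityVar z) * G z := by
        rw [EventuallyLE, ae_restrict_iff' hPm]
        refine Eventually.of_forall fun z hz => ?_
        rw [← mul_add]
        exact mul_nonneg (cutoff_nonneg _ _ _) (by linarith [hFG z hz])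
      have h2 : ∫⁻ z in P, ‖cutoff R m (similarityVar z) * familyDiv f v z
          + cutoff R m (similarityVar z) * G z‖ₑ = ENNReal.ofReal
          (∫ z in P, (cutoff R m (similarityVar z) * familyDiv f v z
          + cutoff R m (similarityVar z) * G z)) := by
        have hadd : Integrable (fun z => cutoff R m (similarityVar z) * familyDiv f v z
            + cutoff R m (similarityVar z) * G z) (volume.restrict P) := (hint m).add (hintG m)
        rw [ofReal_integral_eq_lintegral_ofReal hadd hnn]
        refine lintegral_congr_ae (hnn.mono fun z hz => ?_)
        exact Real.enorm_of_nonneg hz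
      rw [h2]
      apply ENNReal.ofReal_le_ofReal
      rw [integral_add (hint m) (hintG m)]
      refine add_le_add ?_ ?_
      · rw [integral_cutoff_familyDiv hR hK hKQ hf hfK m]
        refine (neg_le_abs _).trans (hCb m B _ hB (fun z hz => familyFlux_eq_zero hfK hz) ?_)
        intro z hz hs
        -- The layer of every cutoff lies in `ξ ≤ R + 2/(m+1) ≤ R + 2`, which explains the range in
        -- the flux hypothesis.
        refine hflux z hz (hs.trans ?_)
        have : 2 / ((m : ℝ) + 1) ≤ 2 := div_le_self (by norm_num) (by
          have : (0 : ℝ) ≤ m := by positivity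
          linarith)
        linarith
      · refine integral_mono (hintG m) hG.abs fun z => ?_
        simp only
        refine (le_abs_self _).trans ?_
        rw [abs_mul, abs_of_nonneg (cutoff_nonneg _ _ _)]
        exact mul_le_of_le_one_left (abs_nonneg _) (cutoff_le_one _ _ _)
  have h3 := hmain.sub hG
  refine h3.congr (Eventually.of_forall fun z => ?_)
  simp

/-- The integral of a divergence vanishes if the flux tends to zero at the boundary. -/
theorem integral_familyDiv_eq_zero (hR : 0 < R) (hK : IsCompact K)
    (hKQ : K ⊆ upperSpacetime n) (hf : ∀ i, ContDiffOn ℝ 1 (f i) (exteriorRegion n R))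
    (hfK : ∀ i, ∀ z ∉ K, f i z = 0)
    (hint : IntegrableOn (familyDiv f v) (exteriorRegion n R))
    (hflux : ∀ ε > 0, ∃ δ > 0, ∀ z ∈ exteriorRegion n R, similarityVar z < R + δ →
      |familyFlux f v z| ≤ ε) :
    ∫ z in exteriorRegion n R, familyDiv f v z = 0 := by
  set P := exteriorRegion n R with hP
  have hPm : MeasurableSet P := isOpen_exteriorRegion.measurableSet
  obtain ⟨C, hC, hCb⟩ := exists_bound_integral_deriv_cutoff hR hK hKQ
  have hlim : Tendsto (fun m => ∫ z in P, cutoff R m (similarityVar z) * familyDiv f v z) atTop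
      (𝓝 (∫ z in P, familyDiv f v z)) := by
    refine tendsto_integral_of_dominated_convergence (fun z => |familyDiv f v z|)
      (fun m => (integrable_cutoff_familyDiv hR hK hKQ hf hfK m).aestronglyMeasurable) hint.abs
      (fun m => Eventually.of_forall fun z => ?_) ?_
    · rw [norm_mul, Real.norm_of_nonneg (cutoff_nonneg _ _ _)]
      exact mul_le_of_le_one_left (abs_nonneg _) (cutoff_le_one _ _ _)
    · rw [ae_restrict_iff' hPm]
      refine Eventually.of_forall fun z hz => ?_
      simpa using (tendsto_cutoff hz.2).mul_const (familyDiv f v z)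
  refine tendsto_nhds_unique hlim ?_
  rw [Metric.tendsto_atTop]
  intro ε hε
  -- Dividing by `C + 1` allows for `C = 0`.
  obtain ⟨δ, hδ, hδf⟩ := hflux (ε / (2 * (C + 1))) (by positivity)
  have h1 : Tendsto (fun m : ℕ => 2 * (1 / ((m : ℝ) + 1))) atTop (𝓝 (2 * 0)) :=
    tendsto_one_div_add_atTop_nhds_zero_nat.const_mul 2
  rw [mul_zero] at h1
  obtain ⟨M, hM⟩ := eventually_atTop.1 (h1.eventually_lt_const hδ)
  refine ⟨M, fun m hm => ?_⟩
  rw [dist_zero_right, integral_cutoff_familyDiv hR hK hKQ hf hfK m, norm_neg, Real.norm_eq_abs]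
  refine (hCb m (ε / (2 * (C + 1))) _ (by positivity)
    (fun z hz => familyFlux_eq_zero hfK hz) fun z hz hs => ?_).trans_lt ?_
  · refine hδf z hz (hs.trans_lt ?_)
    have := hM m hm
    rw [mul_one_div] at this
    linarith
  · rw [div_mul_eq_mul_div, div_lt_iff₀ (by positivity)]
    nlinarith

end Divergence

/-! ### Boundary behaviour of a profile. -/

/-- A continuous function on `(R, ∞)` with a limit at `R` is the restriction of a continuous
function on the line. -/
theorem exists_continuous_extension {f : ℝ → ℝ} {R L : ℝ} (hf : ContinuousOn f (Ioi R))
    (hL : Tendsto f (𝓝[>] R) (𝓝 L)) : ∃ g : ℝ → ℝ, Continuous g ∧ ∀ r, R < r → g r = f r := by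
  refine ⟨fun r => if r ≤ R then L else f r, continuous_iff_continuousAt.2 fun r => ?_,
    fun r hr => if_neg (not_le.2 hr)⟩
  rcases lt_trichotomy r R with h | rfl | h
  · refine (continuousAt_const (y := L)).congr ?_
    filter_upwards [gt_mem_nhds h] with s hs using (if_pos hs.le).symm
  · rw [ContinuousAt, if_pos le_rfl, ← nhdsLE_sup_nhdsGT]
    refine Tendsto.sup ?_ ?_
    · refine tendsto_const_nhds.congr' ?_
      filter_upwards [self_mem_nhdsWithin] with s hs using (if_pos hs).symm
    · refine hL.congr' ?_
      filter_upwards [self_mem_nhdsWithin] with s hs using (if_neg (not_le.2 hs)).symm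
  · refine (hf.continuousAt (Ioi_mem_nhds h)).congr ?_
    filter_upwards [lt_mem_nhds h] with s hs using (if_neg (not_le.2 hs)).symm

namespace IsSelfSimilarProfile

variable {n : ℕ} {γ R : ℝ} {U : ℝ → ℝ}

theorem apply_R (hU : IsSelfSimilarProfile n γ R U) (hR : 0 < R) : U R = 0 :=
  hU.eq_zero R hR.le le_rfl

theorem hasDerivAt (hU : IsSelfSimilarProfile n γ R U) {r : ℝ} (hr : R < r) :
    HasDerivAt U (deriv U r) r :=
  ((hU.contDiffOn.contDiffAt (Ioi_mem_nhds hr)).differentiableAt two_ne_zero).hasDerivAt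

theorem contDiffOn_deriv (hU : IsSelfSimilarProfile n γ R U) :
    ContDiffOn ℝ 1 (deriv U) (Ioi R) := by
  have h := hU.contDiffOn
  rw [show (2 : WithTop ℕ∞) = 1 + 1 from rfl,
    contDiffOn_succ_iff_deriv_of_isOpen isOpen_Ioi] at h
  exact h.2.2

theorem hasDerivAt_deriv (hU : IsSelfSimilarProfile n γ R U) {r : ℝ} (hr : R < r) :
    HasDerivAt (deriv U) (deriv (deriv U) r) r :=
  ((hU.contDiffOn_deriv.contDiffAt (Ioi_mem_nhds hr)).differentiableAt one_ne_zero).hasDerivAt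

theorem continuousWithinAt (hU : IsSelfSimilarProfile n γ R U) (hγ₀ : 0 ≤ γ) (hγ₁ : γ ≤ 1)
    (hR : 0 < R) : ContinuousWithinAt U (Ici R) R := by
  have hβ := one_le_scalingExponent hγ₀ hγ₁
  refine continuousWithinAt_of_rpow (by linarith : 0 < scalingExponent γ) (fun r hr => ?_)
    hU.free_boundary.continuousWithinAt
  rcases eq_or_lt_of_le hr with rfl | hr'
  · exact (hU.apply_R hR).ge
  · exact (hU.pos r hr').le

theorem tendsto_zero (hU : IsSelfSimilarProfile n γ R U) (hγ₀ : 0 ≤ γ) (hγ₁ : γ ≤ 1)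
    (hR : 0 < R) : Tendsto U (𝓝[>] R) (𝓝 0) := by
  have h := (hU.continuousWithinAt hγ₀ hγ₁ hR).mono Ioi_subset_Ici_self
  rwa [ContinuousWithinAt, hU.apply_R hR] at h

/-- The derivative of a profile has a one-sided limit at the free boundary. -/
theorem exists_tendsto_deriv (hU : IsSelfSimilarProfile n γ R U) (hγ₀ : 0 ≤ γ) (hγ₁ : γ ≤ 1)
    (hR : 0 < R) : ∃ L, Tendsto (deriv U) (𝓝[>] R) (𝓝 L) := by
  have hβ := one_le_scalingExponent hγ₀ hγ₁
  -- `E = r^(n-1) exp(r²/4)` is the integrating factor of the drift: `(E U')' = E (β U/2 + γ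
  -- U^(γ-1)) ≥ 0`.
  set E : ℝ → ℝ := fun r => Real.exp (((n : ℝ) - 1) * Real.log r + r ^ 2 / 4) with hE
  have hEd : ∀ r, 0 < r → HasDerivAt E (E r * (((n : ℝ) - 1) / r + r / 2)) r := fun r hr => by
    refine ((((Real.hasDerivAt_log hr.ne').const_mul ((n : ℝ) - 1)).add
      ((hasDerivAt_pow 2 r).div_const 4)).exp).congr_deriv ?_
    simp only [hE, Pi.add_apply]
    push_cast; ring
  have hEpos : ∀ r, 0 < E r := fun r => Real.exp_pos _
  have hgd : ∀ r, R < r → HasDerivAt (fun r => E r * deriv U r)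
      (E r * (scalingExponent γ / 2 * U r + γ * U r ^ (γ - 1))) r := fun r hr => by
    refine ((hEd r (hR.trans hr)).mul (hU.hasDerivAt_deriv hr)).congr_deriv ?_
    rw [← hU.ode r hr]; ring
  have hm : MonotoneOn (fun r => E r * deriv U r) (Ioi R) := by
    refine monotoneOn_of_hasDerivWithinAt_nonneg (convex_Ioi R)
      (fun r hr => (hgd r hr).continuousAt.continuousWithinAt)
      (fun r hr => (hgd r (interior_subset hr)).hasDerivWithinAt) fun r hr => ?_
    have h1 := hU.pos r (interior_subset hr)
    have := hEpos r
    positivity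
  -- As `U` rises from `0`, the mean value theorem gives points with `U' > 0` between `R` and any
  -- `r`, and monotonicity carries the sign to `r`. Being increasing and bounded below, `E U'`
  -- converges at `R`.
  have hpos : ∀ r, R < r → 0 < E r * deriv U r := fun r hr => by
    obtain ⟨s, hs, hs'⟩ := exists_deriv_eq_slope U hr (fun s hs => by
      rcases eq_or_lt_of_le hs.1 with rfl | h
      · exact (hU.continuousWithinAt hγ₀ hγ₁ hR).mono Icc_subset_Ici_self
      · exact (hU.hasDerivAt h).continuousAt.continuousWithinAt)
      (fun s hs => (hU.hasDerivAt hs.1).differentiableAt.differentiableWithinAt)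
    have h1 : 0 < deriv U s := by
      rw [hs', hU.apply_R hR, sub_zero]
      exact div_pos (hU.pos r hr) (sub_pos.2 hr)
    exact (mul_pos (hEpos s) h1).trans_le (hm hs.1 hr hs.2.le)
  have hlim := hm.tendsto_nhdsGT ⟨0, by
    rintro _ ⟨r, hr, rfl⟩
    exact (hpos r hr).le⟩
  have hEc : Tendsto (fun r => (E r)⁻¹) (𝓝[>] R) (𝓝 (E R)⁻¹) :=
    ((hEd R hR).continuousAt.inv₀ (hEpos R).ne').tendsto.mono_left nhdsWithin_le_nhds
  refine ⟨_, (hEc.mul hlim).congr fun r => ?_⟩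
  rw [← mul_assoc, inv_mul_cancel₀ (hEpos r).ne', one_mul]

/-- The limit of the derivative at the free boundary. -/
theorem tendsto_deriv (hU : IsSelfSimilarProfile n γ R U) (hγ₀ : 0 ≤ γ) (hγ₁ : γ ≤ 1)
    (hR : 0 < R) :
    Tendsto (deriv U) (𝓝[>] R) (𝓝 (√2 * 0 ^ (scalingExponent γ - 1))) := by
  have hβ := one_le_scalingExponent hγ₀ hγ₁
  have hβ0 : 0 < scalingExponent γ := by linarith
  obtain ⟨L, hL⟩ := hU.exists_tendsto_deriv hγ₀ hγ₁ hR
  have h1 : HasDerivWithinAt U L (Ici R) R :=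
    hasDerivWithinAt_Ici_of_tendsto_deriv (s := Ioi R)
      (fun r hr => (hU.hasDerivAt hr).differentiableAt.differentiableWithinAt)
      ((hU.continuousWithinAt hγ₀ hγ₁ hR).mono Ioi_subset_Ici_self) self_mem_nhdsWithin hL
  have h2 := hU.free_boundary.rpow_const (p := scalingExponent γ) (Or.inr hβ)
  have h3 : HasDerivWithinAt U _ (Ici R) R := h2.congr
    (fun r hr => by
      have h0 : 0 ≤ U r := by
        rcases eq_or_lt_of_le (mem_Ici.1 hr) with rfl | hr'
        · exact (hU.apply_R hR).ge
        · exact (hU.pos r hr').le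
      rw [← Real.rpow_mul h0, one_div_mul_cancel hβ0.ne', Real.rpow_one])
    (by rw [← Real.rpow_mul (hU.apply_R hR).ge, one_div_mul_cancel hβ0.ne', Real.rpow_one])
  -- The limit of `U'` is the right derivative of `U` at `R`, which the chain rule for `(U^(1/β))^β`
  -- also computes. The factor `0^(β-1)` is `1` for `γ = 0`, by the convention `0^0 = 1`, and `0`
  -- for `γ > 0`.
  have h4 := (uniqueDiffOn_Ici R R self_mem_Ici).eq_deriv _ h1 h3
  rw [h4, hU.apply_R hR, Real.zero_rpow (one_div_pos.2 hβ0).ne',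
    div_mul_cancel₀ _ hβ0.ne'] at hL
  exact hL

/-- Here `γ > 0` makes `β > 1`. For `γ = 0` the limit is `√2`, and the flux of `φ ∇u` need not
vanish at the free boundary. -/
theorem tendsto_deriv_zero (hU : IsSelfSimilarProfile n γ R U) (hγ₀ : 0 < γ) (hγ₁ : γ ≤ 1)
    (hR : 0 < R) : Tendsto (deriv U) (𝓝[>] R) (𝓝 0) := by
  have h := hU.tendsto_deriv hγ₀.le hγ₁ hR
  have hβ : scalingExponent γ - 1 ≠ 0 := by
    have : 0 < γ / (2 - γ) := div_pos hγ₀ (by linarith)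
    have e : scalingExponent γ - 1 = γ / (2 - γ) := by
      rw [scalingExponent]
      have : 2 - γ ≠ 0 := by linarith
      field_simp; ring
    rw [e]; exact this.ne'
  rwa [Real.zero_rpow hβ, mul_zero] at h

/-- The energy identity at the free boundary. -/
theorem tendsto_energy (hU : IsSelfSimilarProfile n γ R U) (hγ₀ : 0 ≤ γ) (hγ₁ : γ ≤ 1)
    (hR : 0 < R) : Tendsto (fun r => 2 * U r ^ γ - deriv U r ^ 2) (𝓝[>] R) (𝓝 0) := by
  -- For `γ = 0` the terms balance, `U^0 = 1` against `U'^2 → 2`; for `γ > 0` each tends to zero by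
  -- itself.
  rcases eq_or_lt_of_le hγ₀ with rfl | hγ
  · have h := hU.tendsto_deriv le_rfl hγ₁ hR
    have e : scalingExponent 0 - 1 = 0 := by norm_num [scalingExponent]
    rw [e, Real.rpow_zero, mul_one] at h
    have h1 := (h.pow 2).const_sub 2
    rw [Real.sq_sqrt (by norm_num), sub_self] at h1
    simpa using h1
  · have h1 := ((hU.tendsto_zero hγ₀ hγ₁ hR).rpow_const (p := γ) (Or.inr hγ₀)).const_mul 2
    have h2 := (hU.tendsto_deriv_zero hγ hγ₁ hR).pow 2
    have h3 := h1.sub h2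
    rwa [Real.zero_rpow hγ.ne', mul_zero, zero_pow two_ne_zero, sub_zero] at h3

end IsSelfSimilarProfile

/-! ### Classical derivatives in the exterior region. -/

/-- The scalar `q` with `∇u = q x` for the self-similar function `u`. -/
noncomputable def radialFactor {n : ℕ} (γ : ℝ) (U : ℝ → ℝ) (z : Spacetime n) : ℝ :=
  z.2 ^ (scalingExponent γ / 2 - 1) * (deriv U (similarityVar z) / similarityVar z)

/-- The classical time derivative of the self-similar function. -/
noncomputable def timeFactor {n : ℕ} (γ : ℝ) (U : ℝ → ℝ) (z : Spacetime n) : ℝ :=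
  z.2 ^ (scalingExponent γ / 2 - 1) * (scalingExponent γ / 2 * U (similarityVar z)
    - similarityVar z * deriv U (similarityVar z) / 2)

section Pointwise

variable {n : ℕ} {γ R : ℝ} {U : ℝ → ℝ} {z : Spacetime n}

theorem selfSimilarFunction_eq (z : Spacetime n) : selfSimilarFunction n γ U z =
    z.2 ^ (scalingExponent γ / 2) * U (similarityVar z) := rfl

theorem hasFDerivAt_time_rpow (ht : 0 < z.2) (p : ℝ) :
    HasFDerivAt (fun z : Spacetime n => z.2 ^ p)
      ((p * z.2 ^ (p - 1)) • ContinuousLinearMap.snd ℝ (EuclideanSpace ℝ (Fin n)) ℝ) z := by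
  have h0 : HasFDerivAt (fun z : Spacetime n => z.2)
      (ContinuousLinearMap.snd ℝ (EuclideanSpace ℝ (Fin n)) ℝ) z := hasFDerivAt_snd
  exact h0.rpow_const (Or.inl ht.ne')

theorem rpow_neg_half_sq_mul {t : ℝ} (ht : 0 < t) :
    t ^ (-(1 / 2) : ℝ) * t ^ (-(1 / 2) : ℝ) * t = 1 := by
  rw [← Real.rpow_add ht]
  norm_num [Real.rpow_neg_one, ht.ne']

theorem selfSimilarFunction_pos (hU : IsSelfSimilarProfile n γ R U)
    (hz : z ∈ exteriorRegion n R) : 0 < selfSimilarFunction n γ U z :=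
  mul_pos (Real.rpow_pos_of_pos hz.1 _) (hU.pos _ hz.2)

theorem selfSimilarFunction_eq_zero (hU : IsSelfSimilarProfile n γ R U)
    (ht : z ∈ upperSpacetime n) (hz : z ∉ exteriorRegion n R) :
    selfSimilarFunction n γ U z = 0 := by
  have h1 : 0 ≤ similarityVar z := mul_nonneg (Real.rpow_nonneg (le_of_lt ht) _) (norm_nonneg _)
  rw [selfSimilarFunction_eq, hU.eq_zero _ h1 (not_lt.1 fun h => hz ⟨ht, h⟩), mul_zero]

/-- The derivative of the self-similar function in the exterior region. -/
theorem hasFDerivAt_selfSimilarFunction (hU : IsSelfSimilarProfile n γ R U) (hR : 0 < R)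
    (hz : z ∈ exteriorRegion n R) :
    ∃ L : Spacetime n →L[ℝ] ℝ, HasFDerivAt (selfSimilarFunction n γ U) L z ∧
      (∀ v, L (v, 0) = radialFactor γ U z * inner ℝ z.1 v) ∧ L (0, 1) = timeFactor γ U z := by
  have ht : 0 < z.2 := hz.1
  have hx := norm_pos_of_mem_exteriorRegion hR hz
  obtain ⟨L, hL, hLx, hLt⟩ := hasFDerivAt_similarityVar hz.1 hx
  have h1 : HasFDerivAt (fun z => U (similarityVar z)) _ z :=
    (hU.hasDerivAt hz.2).comp_hasFDerivAt z hL
  have h2 : HasFDerivAt (fun z : Spacetime n =>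
      z.2 ^ (scalingExponent γ / 2) * U (similarityVar z)) _ z :=
    (hasFDerivAt_time_rpow ht (scalingExponent γ / 2)).mul h1
  refine ⟨_, h2, fun v => ?_, ?_⟩
  · have hs := rpow_neg_half_sq_mul ht
    have hs0 := Real.rpow_pos_of_pos ht (-(1 / 2))
    simp only [_root_.add_apply, _root_.smul_apply, hLx,
      ContinuousLinearMap.coe_snd', smul_eq_mul, mul_zero, add_zero, radialFactor]
    rw [Real.rpow_sub_one ht.ne']
    simp only [similarityVar]
    set s := z.2 ^ (-(1 / 2) : ℝ)
    field_simp
    linear_combination deriv U (s * ‖z.1‖) * inner ℝ z.1 v * hs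
  · simp only [_root_.add_apply, _root_.smul_apply, hLt,
      ContinuousLinearMap.coe_snd', smul_eq_mul, mul_one, timeFactor]
    rw [Real.rpow_sub_one ht.ne']
    field_simp
    ring

/-- The derivative of the radial factor, and the equation satisfied by the self-similar function
in the exterior region. -/
theorem hasFDerivAt_radialFactor (hU : IsSelfSimilarProfile n γ R U) (hγ₁ : γ ≤ 1) (hR : 0 < R)
    (hz : z ∈ exteriorRegion n R) :
    ∃ (L : Spacetime n →L[ℝ] ℝ) (q₁ : ℝ), HasFDerivAt (radialFactor γ U) L z ∧
      (∀ v, L (v, 0) = q₁ * inner ℝ z.1 v) ∧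
      n * radialFactor γ U z + q₁ * ‖z.1‖ ^ 2 =
        timeFactor γ U z + γ * selfSimilarFunction n γ U z ^ (γ - 1) := by
  have ht : 0 < z.2 := hz.1
  have hx := norm_pos_of_mem_exteriorRegion hR hz
  have hξ : 0 < similarityVar z := hR.trans hz.2
  obtain ⟨L, hL, hLx, -⟩ := hasFDerivAt_similarityVar hz.1 hx
  have h1 := ((hU.hasDerivAt_deriv hz.2).div (hasDerivAt_id _) hξ.ne').comp_hasFDerivAt z hL
  -- Since `∇u = q x` and `∇q = q₁ x`, the quantity `n q + q₁ |x|²` is the Laplacian of `u`.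
  refine ⟨_, z.2 ^ (scalingExponent γ / 2 - 1) *
    ((deriv (deriv U) (similarityVar z) * similarityVar z - deriv U (similarityVar z))
      / similarityVar z ^ 2) * (z.2 ^ (-(1 / 2) : ℝ) / ‖z.1‖),
    (hasFDerivAt_time_rpow ht (scalingExponent γ / 2 - 1)).mul h1, fun v => ?_, ?_⟩
  · simp only [_root_.add_apply, _root_.smul_apply, hLx,
      ContinuousLinearMap.coe_snd', smul_eq_mul, mul_zero, add_zero, id, mul_one]
    ring
  · have e1 : selfSimilarFunction n γ U z ^ (γ - 1)
        = z.2 ^ (scalingExponent γ / 2 - 1) * U (similarityVar z) ^ (γ - 1) := by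
      rw [selfSimilarFunction_eq, Real.mul_rpow (Real.rpow_nonneg ht.le _) (hU.pos _ hz.2).le,
        ← Real.rpow_mul ht.le]
      congr 2
      have := scalingExponent_mul_sub_one hγ₁
      linarith
    have hode := hU.ode _ hz.2
    have e2 : z.2 ^ (-(1 / 2) : ℝ) / ‖z.1‖ * ‖z.1‖ ^ 2 = similarityVar z := by
      rw [similarityVar]; field_simp
    rw [e1, mul_assoc (_ * _) (_ / _) (_ ^ 2), e2, radialFactor, timeFactor]
    have e3 : γ * U (similarityVar z) ^ (γ - 1) = _ := hode.symm
    rw [mul_left_comm γ, e3]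
    field_simp
    ring

theorem contDiffAt_comp_similarityVar {k : WithTop ℕ∞} {g : ℝ → ℝ} (hR : 0 < R)
    (hg : ContDiffOn ℝ k g (Ioi R)) (hz : z ∈ exteriorRegion n R) :
    ContDiffAt ℝ k (fun z => g (similarityVar z)) z :=
  (hg.contDiffAt (Ioi_mem_nhds hz.2)).comp z
    (contDiffAt_similarityVar hz.1 (norm_pos_of_mem_exteriorRegion hR hz))

theorem contDiffOn_selfSimilarFunction (hU : IsSelfSimilarProfile n γ R U) (hR : 0 < R) :
    ContDiffOn ℝ 1 (selfSimilarFunction n γ U) (exteriorRegion n R) := fun _ hz =>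
  ((contDiffAt_snd.rpow_const_of_ne (ne_of_gt hz.1)).mul (contDiffAt_comp_similarityVar hR
    (hU.contDiffOn.of_le one_le_two) hz)).contDiffWithinAt

theorem contDiffOn_radialFactor (hU : IsSelfSimilarProfile n γ R U) (hR : 0 < R) :
    ContDiffOn ℝ 1 (radialFactor (n := n) γ U) (exteriorRegion n R) := fun _ hz =>
  ((contDiffAt_snd.rpow_const_of_ne (ne_of_gt hz.1)).mul
    ((contDiffAt_comp_similarityVar hR hU.contDiffOn_deriv hz).div
      (contDiffAt_similarityVar hz.1 (norm_pos_of_mem_exteriorRegion hR hz))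
      (hR.trans hz.2).ne')).contDiffWithinAt

theorem continuousOn_timeFactor (hU : IsSelfSimilarProfile n γ R U) (hR : 0 < R) :
    ContinuousOn (timeFactor (n := n) γ U) (exteriorRegion n R) := fun z hz => by
  have h1 := (contDiffAt_comp_similarityVar hR hU.contDiffOn_deriv hz).continuousAt
  have h2 := (contDiffAt_comp_similarityVar hR hU.contDiffOn hz).continuousAt
  have h3 := (contDiffAt_similarityVar (k := 0) hz.1
    (norm_pos_of_mem_exteriorRegion hR hz)).continuousAt
  exact ((continuousAt_snd.rpow_const (Or.inl (ne_of_gt hz.1))).mul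
    ((h2.const_mul _).sub ((h3.mul h1).div_const _))).continuousWithinAt

/-- The spatial coordinate directions. -/
noncomputable def spatialDir (i : Fin n) : Spacetime n := (EuclideanSpace.single i 1, 0)

theorem sum_mul_apply_spatialDir (L : Spacetime n →L[ℝ] ℝ) (v : EuclideanSpace ℝ (Fin n)) :
    ∑ i, v i * L (spatialDir i) = L (v, 0) := by
  have h := (EuclideanSpace.basisFun (Fin n) ℝ).sum_repr v
  have h2 := congrArg (L.comp (ContinuousLinearMap.inl ℝ (EuclideanSpace ℝ (Fin n)) ℝ)) h
  simpa [spatialDir] using h2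

theorem familyDiv_smul_position {h : Spacetime n → ℝ} {L : Spacetime n →L[ℝ] ℝ}
    (hL : HasFDerivAt h L z) :
    familyDiv (fun i z => h z * z.1 i) spatialDir z = n * h z + L (z.1, 0) := by
  have h1 : ∀ i : Fin n, fderiv ℝ (fun z : Spacetime n => h z * z.1 i) z (spatialDir i)
      = h z + z.1 i * L (spatialDir i) := fun i => by
    have h0 : HasFDerivAt (fun z : Spacetime n => z.1 i)
        ((EuclideanSpace.proj (𝕜 := ℝ) i).comp
          (ContinuousLinearMap.fst ℝ (EuclideanSpace ℝ (Fin n)) ℝ)) z :=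
      ((EuclideanSpace.proj (𝕜 := ℝ) i).comp
        (ContinuousLinearMap.fst ℝ (EuclideanSpace ℝ (Fin n)) ℝ)).hasFDerivAt
    have h2 : HasFDerivAt (fun z : Spacetime n => h z * z.1 i) _ z := hL.mul h0
    rw [h2.fderiv]
    simp [spatialDir]
  rw [familyDiv, Finset.sum_congr rfl fun i _ => h1 i, Finset.sum_add_distrib,
    sum_mul_apply_spatialDir]
  simp

theorem familyDiv_smul_field {A : Spacetime n → ℝ} {Φ : Spacetime n → Spacetime n}
    {L : Spacetime n →L[ℝ] ℝ} (hL : HasFDerivAt A L z) (hΦ : DifferentiableAt ℝ Φ z) :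
    familyDiv (fun i z => A z * (Φ z).1 i) spatialDir z
      = A z * spatialDiv Φ z + L ((Φ z).1, 0) := by
  have h1 : ∀ i : Fin n, fderiv ℝ (fun z : Spacetime n => A z * (Φ z).1 i) z (spatialDir i)
      = A z * (spatialDeriv Φ z (EuclideanSpace.single i 1)).1 i
        + (Φ z).1 i * L (spatialDir i) := fun i => by
    have h0 : HasFDerivAt (fun z : Spacetime n => (Φ z).1 i)
        (((EuclideanSpace.proj (𝕜 := ℝ) i).comp
          (ContinuousLinearMap.fst ℝ (EuclideanSpace ℝ (Fin n)) ℝ)).comp (fderiv ℝ Φ z)) z :=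
      ((EuclideanSpace.proj (𝕜 := ℝ) i).comp
        (ContinuousLinearMap.fst ℝ (EuclideanSpace ℝ (Fin n)) ℝ)).hasFDerivAt.comp z
          hΦ.hasFDerivAt
    have h2 : HasFDerivAt (fun z : Spacetime n => A z * (Φ z).1 i) _ z := hL.mul h0
    rw [h2.fderiv]
    simp [spatialDir, spatialDeriv]
  rw [familyDiv, Finset.sum_congr rfl fun i _ => h1 i, Finset.sum_add_distrib,
    sum_mul_apply_spatialDir, spatialDiv, Finset.mul_sum]

/-- The domain variation field `(|∇u|² + 2 u^γ) Φ - 2 (∇u · Φ) ∇u`. -/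
noncomputable def variationField (γ : ℝ) (U : ℝ → ℝ) (Φ : Spacetime n → Spacetime n) (i : Fin n)
    (z : Spacetime n) : ℝ :=
  (radialFactor γ U z ^ 2 * ‖z.1‖ ^ 2 + 2 * selfSimilarFunction n γ U z ^ γ) * (Φ z).1 i
    + (-2 * radialFactor γ U z ^ 2 * inner ℝ z.1 (Φ z).1) * z.1 i

/-- The terms with second derivatives of `u` cancel except for `-2 (∇u·Φ) Δu`. Replacing `Δu` by
`∂ₜu + γ u^(γ-1)` cancels the derivative of `2 u^γ` and leaves the time derivative term. -/
theorem familyDiv_variationField (hU : IsSelfSimilarProfile n γ R U) (hγ₁ : γ ≤ 1) (hR : 0 < R)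
    (hz : z ∈ exteriorRegion n R) {Φ : Spacetime n → Spacetime n} (hΦ : DifferentiableAt ℝ Φ z) :
    familyDiv (variationField γ U Φ) spatialDir z =
      (‖radialFactor γ U z • z.1‖ ^ 2 + 2 * selfSimilarFunction n γ U z ^ γ) * spatialDiv Φ z
      - 2 * inner ℝ (radialFactor γ U z • z.1)
          (spatialDeriv Φ z (radialFactor γ U z • z.1)).1
      - 2 * timeFactor γ U z * inner ℝ (radialFactor γ U z • z.1) (Φ z).1 := by
  obtain ⟨Lu, hLu, hLux, -⟩ := hasFDerivAt_selfSimilarFunction hU hR hz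
  obtain ⟨Lq, q₁, hLq, hLqx, heq⟩ := hasFDerivAt_radialFactor hU hγ₁ hR hz
  have hu := selfSimilarFunction_pos hU hz
  have hx : HasFDerivAt (fun z : Spacetime n => z.1)
      (ContinuousLinearMap.fst ℝ (EuclideanSpace ℝ (Fin n)) ℝ) z := hasFDerivAt_fst
  have hΦ1 : HasFDerivAt (fun z : Spacetime n => (Φ z).1)
      ((ContinuousLinearMap.fst ℝ (EuclideanSpace ℝ (Fin n)) ℝ).comp (fderiv ℝ Φ z)) z :=
    (ContinuousLinearMap.fst ℝ (EuclideanSpace ℝ (Fin n)) ℝ).hasFDerivAt.comp z hΦ.hasFDerivAt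
  have hq2 : HasFDerivAt (fun z => radialFactor γ U z ^ 2) _ z := hLq.pow 2
  have hA : HasFDerivAt (fun z => radialFactor γ U z ^ 2 * ‖z.1‖ ^ 2
      + 2 * selfSimilarFunction n γ U z ^ γ) _ z :=
    (hq2.mul hx.norm_sq).add ((hLu.rpow_const (p := γ) (Or.inl hu.ne')).const_mul 2)
  have hB : HasFDerivAt (fun z => -2 * radialFactor γ U z ^ 2 * inner ℝ z.1 (Φ z).1) _ z :=
    (hq2.const_mul (-2)).mul (hx.inner ℝ hΦ1)
  have hsplit : familyDiv (variationField γ U Φ) spatialDir z =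
      familyDiv (fun i z => (radialFactor γ U z ^ 2 * ‖z.1‖ ^ 2
        + 2 * selfSimilarFunction n γ U z ^ γ) * (Φ z).1 i) spatialDir z
      + familyDiv (fun i z => (-2 * radialFactor γ U z ^ 2 * inner ℝ z.1 (Φ z).1) * z.1 i)
        spatialDir z := by
    simp only [familyDiv, ← Finset.sum_add_distrib]
    refine Finset.sum_congr rfl fun i _ => ?_
    have p1 := (EuclideanSpace.proj (𝕜 := ℝ) i).hasFDerivAt.comp z hΦ1
    have p2 := (EuclideanSpace.proj (𝕜 := ℝ) i).hasFDerivAt.comp z hx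
    have h1 : DifferentiableAt ℝ (fun z => (radialFactor γ U z ^ 2 * ‖z.1‖ ^ 2
        + 2 * selfSimilarFunction n γ U z ^ γ) * (Φ z).1 i) z := (hA.mul p1).differentiableAt
    have h2 : DifferentiableAt ℝ (fun z : Spacetime n =>
        (-2 * radialFactor γ U z ^ 2 * inner ℝ z.1 (Φ z).1) * z.1 i) z :=
      (hB.mul p2).differentiableAt
    have h3 : variationField γ U Φ i = (fun z => (radialFactor γ U z ^ 2 * ‖z.1‖ ^ 2
        + 2 * selfSimilarFunction n γ U z ^ γ) * (Φ z).1 i)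
        + fun z => (-2 * radialFactor γ U z ^ 2 * inner ℝ z.1 (Φ z).1) * z.1 i := rfl
    rw [h3, fderiv_add h1 h2, _root_.add_apply]
  rw [hsplit, familyDiv_smul_field hA hΦ, familyDiv_smul_position hB]
  simp only [spatialDeriv, norm_smul, inner_smul_left, mul_pow, Real.norm_eq_abs, sq_abs]
  have hsm : fderiv ℝ Φ z (radialFactor γ U z • z.1, 0)
      = radialFactor γ U z • fderiv ℝ Φ z (z.1, 0) := by
    rw [← map_smul]; simp
  rw [hsm]
  simp [hLux, hLqx, inner_smul_right]
  linear_combination (-2 * radialFactor γ U z * inner ℝ z.1 (Φ z).1) * heq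

end Pointwise

/-! ### Local bounds and fluxes near the free boundary. -/

section Bounds

variable {n : ℕ} {γ R : ℝ} {U : ℝ → ℝ} {K : Set (Spacetime n)}

/-- A quantity known only in the exterior region is bounded up to the free boundary if it extends
continuously to `t > 0`; such extensions come from `exists_continuous_extension`. -/
theorem exists_bound_of_eqOn {E : Type*} [NormedAddCommGroup E] {f g : Spacetime n → E}
    (hK : IsCompact K) (hKQ : K ⊆ upperSpacetime n) (hg : ContinuousOn g (upperSpacetime n))
    (hfg : EqOn f g (exteriorRegion n R)) :
    ∃ C, 0 ≤ C ∧ ∀ z ∈ K, z ∈ exteriorRegion n R → ‖f z‖ ≤ C := by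
  obtain ⟨C, hC⟩ := hK.exists_bound_of_continuousOn (hg.mono hKQ)
  exact ⟨max C 0, le_max_right _ _, fun z hz hzP => by
    rw [hfg hzP]; exact (hC z hz).trans (le_max_left _ _)⟩

theorem continuousOn_time_rpow (p : ℝ) :
    ContinuousOn (fun z : Spacetime n => z.2 ^ p) (upperSpacetime n) := fun _ hz =>
  (continuousAt_snd.rpow_const (Or.inl (ne_of_gt hz))).continuousWithinAt

theorem exists_bound_selfSimilarFunction (hU : IsSelfSimilarProfile n γ R U) (hγ₀ : 0 ≤ γ)
    (hγ₁ : γ ≤ 1) (hR : 0 < R) (hK : IsCompact K) (hKQ : K ⊆ upperSpacetime n) :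
    ∃ C, 0 ≤ C ∧ ∀ z ∈ K, z ∈ exteriorRegion n R → ‖selfSimilarFunction n γ U z‖ ≤ C := by
  obtain ⟨g, hg, hgU⟩ := exists_continuous_extension hU.contDiffOn.continuousOn
    (hU.tendsto_zero hγ₀ hγ₁ hR)
  refine exists_bound_of_eqOn (g := fun z => z.2 ^ (scalingExponent γ / 2) * g (similarityVar z))
    hK hKQ ((continuousOn_time_rpow _).mul
      (hg.comp_continuousOn continuousOn_similarityVar)) fun z hz => ?_
  simp only [selfSimilarFunction_eq, hgU _ hz.2]

theorem exists_bound_timeFactor (hU : IsSelfSimilarProfile n γ R U) (hγ₀ : 0 ≤ γ)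
    (hγ₁ : γ ≤ 1) (hR : 0 < R) (hK : IsCompact K) (hKQ : K ⊆ upperSpacetime n) :
    ∃ C, 0 ≤ C ∧ ∀ z ∈ K, z ∈ exteriorRegion n R → ‖timeFactor γ U z‖ ≤ C := by
  obtain ⟨g, hg, hgU⟩ := exists_continuous_extension hU.contDiffOn.continuousOn
    (hU.tendsto_zero hγ₀ hγ₁ hR)
  obtain ⟨g₁, hg₁, hgU₁⟩ := exists_continuous_extension hU.contDiffOn_deriv.continuousOn
    (hU.tendsto_deriv hγ₀ hγ₁ hR)
  refine exists_bound_of_eqOn (g := fun z => z.2 ^ (scalingExponent γ / 2 - 1) *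
      (scalingExponent γ / 2 * g (similarityVar z) - similarityVar z * g₁ (similarityVar z) / 2))
    hK hKQ ?_ fun z hz => ?_
  · refine (continuousOn_time_rpow _).mul ?_
    exact ((hg.comp_continuousOn continuousOn_similarityVar).const_mul _).sub
      ((continuousOn_similarityVar.mul
        (hg₁.comp_continuousOn continuousOn_similarityVar)).div_const _)
  · simp only [timeFactor, hgU _ hz.2, hgU₁ _ hz.2]

theorem exists_bound_gradient (hU : IsSelfSimilarProfile n γ R U) (hγ₀ : 0 ≤ γ)
    (hγ₁ : γ ≤ 1) (hR : 0 < R) (hK : IsCompact K) (hKQ : K ⊆ upperSpacetime n) :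
    ∃ C, 0 ≤ C ∧ ∀ z ∈ K, z ∈ exteriorRegion n R → ‖radialFactor γ U z • z.1‖ ≤ C := by
  obtain ⟨g₁, hg₁, hgU₁⟩ := exists_continuous_extension hU.contDiffOn_deriv.continuousOn
    (hU.tendsto_deriv hγ₀ hγ₁ hR)
  -- The maximum with `R` keeps the denominator positive for all `t > 0` and changes nothing in the
  -- exterior region.
  refine exists_bound_of_eqOn (g := fun z => (z.2 ^ (scalingExponent γ / 2 - 1) *
      (g₁ (similarityVar z) / max (similarityVar z) R)) • z.1)
    hK hKQ ?_ fun z hz => ?_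
  · refine ContinuousOn.smul ((continuousOn_time_rpow _).mul ?_) continuous_fst.continuousOn
    refine (hg₁.comp_continuousOn continuousOn_similarityVar).div
      ((continuous_id.max continuous_const).comp_continuousOn continuousOn_similarityVar) fun z _ => ?_
    exact (lt_max_of_lt_right hR).ne'
  · simp only [radialFactor, hgU₁ _ hz.2, max_eq_left (le_of_lt hz.2)]

theorem integrableOn_of_bound {f : Spacetime n → ℝ} (hK : IsCompact K)
    (hf : ContinuousOn f (exteriorRegion n R)) (hfK : ∀ z ∉ K, f z = 0) {C : ℝ}
    (hC : ∀ z ∈ K, z ∈ exteriorRegion n R → ‖f z‖ ≤ C) :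
    IntegrableOn f (exteriorRegion n R) := by
  have hPm : MeasurableSet (exteriorRegion n R) := isOpen_exteriorRegion.measurableSet
  have h1 : IntegrableOn f (exteriorRegion n R ∩ K) := by
    refine IntegrableOn.of_bound ((measure_mono inter_subset_right).trans_lt hK.measure_lt_top)
      ((hf.mono inter_subset_left).aestronglyMeasurable (hPm.inter hK.measurableSet)) C ?_
    · rw [ae_restrict_iff' (hPm.inter hK.measurableSet)]
      exact Eventually.of_forall fun z hz => hC z hz.2 hz.1
  exact h1.of_forall_sdiff_eq_zero hPm fun z hz => hfK z fun h => hz.2 ⟨hz.1, h⟩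

theorem memLp_indicator_of_bound {E : Type*} [NormedAddCommGroup E]
    [SecondCountableTopology E] {f : Spacetime n → E} {W : Set (Spacetime n)}
    (hK : IsCompact K) (hWK : W ⊆ K) (hW : MeasurableSet W)
    (hf : ContinuousOn f (exteriorRegion n R)) {C : ℝ} (hC0 : 0 ≤ C)
    (hC : ∀ z ∈ K, z ∈ exteriorRegion n R → ‖f z‖ ≤ C) :
    MemLp ((exteriorRegion n R).indicator f) 2 (volume.restrict W) := by
  have hPm : MeasurableSet (exteriorRegion n R) := isOpen_exteriorRegion.measurableSet
  have : IsFiniteMeasure ((volume : Measure (Spacetime n)).restrict W) :=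
    isFiniteMeasure_restrict.2 ((measure_mono hWK).trans_lt hK.measure_lt_top).ne
  refine MemLp.of_bound (C := C) ?_ ?_
  · exact ((aestronglyMeasurable_indicator_iff hPm).2
      (hf.aestronglyMeasurable hPm)).mono_measure Measure.restrict_le_self
  · rw [ae_restrict_iff' hW]
    refine Eventually.of_forall fun z hz => ?_
    by_cases hzP : z ∈ exteriorRegion n R
    · rw [indicator_of_mem hzP]; exact hC z (hWK hz) hzP
    · rw [indicator_of_notMem hzP, norm_zero]; exact hC0

theorem setIntegral_eq_exterior {f : Spacetime n → ℝ} {W : Set (Spacetime n)} (hKW : K ⊆ W)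
    (hfK : ∀ z ∉ K, f z = 0) (hfP : ∀ z ∈ K, z ∉ exteriorRegion n R → f z = 0) :
    ∫ z in W, f z = ∫ z in exteriorRegion n R, f z := by
  rw [setIntegral_eq_integral_of_forall_compl_eq_zero fun z hz => hfK z fun h => hz (hKW h),
    setIntegral_eq_integral_of_forall_compl_eq_zero fun z hz => ?_]
  by_cases h : z ∈ K
  · exact hfP z h hz
  · exact hfK z h

/-- A flux that is bounded by a multiple of a function of the self-similar variable tending to
zero at `R` tends to zero uniformly. -/
theorem flux_tendsto_zero {N c : Spacetime n → ℝ} {e : ℝ → ℝ} (hK : IsCompact K)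
    (hKQ : K ⊆ upperSpacetime n) (hNK : ∀ z ∉ K, N z = 0)
    (hc : ContinuousOn c (upperSpacetime n))
    (hN : ∀ z ∈ exteriorRegion n R, |N z| ≤ c z * |e (similarityVar z)|)
    (he : Tendsto e (𝓝[>] R) (𝓝 0)) :
    ∀ ε > 0, ∃ δ > 0, ∀ z ∈ exteriorRegion n R, similarityVar z < R + δ → |N z| ≤ ε := by
  intro ε hε
  obtain ⟨C, hC⟩ := hK.exists_bound_of_continuousOn (hc.mono hKQ)
  set C' := max C 0 + 1 with hC'
  have hC'0 : 0 < C' := by positivity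
  have h1 := he.eventually (Metric.ball_mem_nhds (0 : ℝ) (div_pos hε hC'0))
  obtain ⟨b, hb, hbs⟩ := mem_nhdsGT_iff_exists_Ioo_subset.1 h1
  refine ⟨b - R, sub_pos.2 hb, fun z hz hzb => ?_⟩
  by_cases hzK : z ∈ K
  · have h2 : |e (similarityVar z)| < ε / C' := by
      simpa using hbs (a := similarityVar z) ⟨hz.2, by linarith⟩
    have h3 : c z ≤ C' := (le_abs_self _).trans
      ((hC z hzK).trans ((le_max_left _ _).trans (by linarith)))
    calc |N z| ≤ c z * |e (similarityVar z)| := hN z hz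
      _ ≤ C' * (ε / C') := mul_le_mul h3 h2.le (abs_nonneg _) hC'0.le
      _ = ε := mul_div_cancel₀ _ hC'0.ne'
  · rw [hNK z hzK, abs_zero]; exact hε.le

/-- The vector is split into space and time parts, with `|∇ξ| = t^(-1/2)` and `∂ₜξ = -ξ/(2t)`; the
factor `1/2` is dropped. -/
theorem abs_fderiv_similarityVar_le (hR : 0 < R) {z : Spacetime n}
    (hz : z ∈ exteriorRegion n R) (v : Spacetime n) :
    |fderiv ℝ similarityVar z v| ≤
      z.2 ^ (-(1 / 2) : ℝ) * ‖v.1‖ + similarityVar z / z.2 * |v.2| := by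
  have ht : 0 < z.2 := hz.1
  have hx := norm_pos_of_mem_exteriorRegion hR hz
  obtain ⟨L, hL, hLx, hLt⟩ := hasFDerivAt_similarityVar hz.1 hx
  have hv : v = (v.1, 0) + v.2 • ((0, 1) : Spacetime n) := by ext <;> simp
  have hξ : 0 < similarityVar z := hR.trans hz.2
  have hs : 0 < z.2 ^ (-(1 / 2) : ℝ) := Real.rpow_pos_of_pos ht _
  rw [hL.fderiv]
  conv_lhs => rw [hv, map_add, map_smul, hLx, hLt]
  refine (abs_add_le _ _).trans (add_le_add ?_ ?_)
  · rw [abs_mul, abs_of_pos hs, abs_div, abs_of_pos hx]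
    refine mul_le_mul_of_nonneg_left ?_ hs.le
    rw [div_le_iff₀ hx, mul_comm ‖v.1‖]
    exact abs_real_inner_le_norm _ _
  · rw [smul_eq_mul, abs_mul, abs_div, abs_mul, abs_of_pos hξ, abs_of_pos ht, mul_comm]
    refine mul_le_mul_of_nonneg_right ?_ (abs_nonneg _)
    rw [div_le_div_iff_of_pos_right ht]
    norm_num
    linarith

end Bounds

/-! ### Integral identities over the exterior region. -/

section Fields

variable {n : ℕ} {γ R : ℝ} {U : ℝ → ℝ} {K : Set (Spacetime n)}

/-- The classical derivatives of the self-similar function are its weak derivatives. -/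
theorem integral_mul_fderiv_selfSimilarFunction (hU : IsSelfSimilarProfile n γ R U)
    (hγ₀ : 0 ≤ γ) (hγ₁ : γ ≤ 1) (hR : 0 < R) (hK : IsCompact K) (hKQ : K ⊆ upperSpacetime n)
    {φ : Spacetime n → ℝ} (hφ : ContDiff ℝ 1 φ) (hφK : ∀ z ∉ K, φ z = 0) (v : Spacetime n)
    {d : Spacetime n → ℝ} (hd : ContinuousOn d (exteriorRegion n R))
    (hdu : ∀ z ∈ exteriorRegion n R, fderiv ℝ (selfSimilarFunction n γ U) z v = d z) {C : ℝ}
    (hC : ∀ z ∈ K, z ∈ exteriorRegion n R → ‖d z‖ ≤ C) :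
    ∫ z in exteriorRegion n R, selfSimilarFunction n γ U z * fderiv ℝ φ z v =
      - ∫ z in exteriorRegion n R, d z * φ z := by
  have huc := contDiffOn_selfSimilarFunction hU hR
  obtain ⟨Cu, hCu0, hCu⟩ := exists_bound_selfSimilarFunction hU hγ₀ hγ₁ hR hK hKQ
  obtain ⟨Cφ, hCφ⟩ := hK.exists_bound_of_continuousOn hφ.continuous.continuousOn
  have hdφ : Continuous fun z => fderiv ℝ φ z v :=
    (hφ.continuous_fderiv one_ne_zero).clm_apply continuous_const
  obtain ⟨Cd, hCd⟩ := hK.exists_bound_of_continuousOn hdφ.continuousOn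
  have hdφK : ∀ z ∉ K, fderiv ℝ φ z v = 0 := fun z hz => by
    have : φ =ᶠ[𝓝 z] fun _ => 0 := by
      filter_upwards [hK.isClosed.isOpen_compl.mem_nhds hz] with w hw using hφK w hw
    rw [this.fderiv_eq]; simp
  have hi1 : IntegrableOn (fun z => selfSimilarFunction n γ U z * fderiv ℝ φ z v)
      (exteriorRegion n R) := by
    refine integrableOn_of_bound (C := Cu * Cd) hK (huc.continuousOn.mul hdφ.continuousOn)
      (fun z hz => by rw [hdφK z hz, mul_zero]) fun z hz hzP => ?_
    rw [norm_mul]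
    exact mul_le_mul (hCu z hz hzP) (hCd z hz) (norm_nonneg _) hCu0
  have hi2 : IntegrableOn (fun z => d z * φ z) (exteriorRegion n R) := by
    refine integrableOn_of_bound (C := C * Cφ) hK (hd.mul hφ.continuous.continuousOn)
      (fun z hz => by rw [hφK z hz, mul_zero]) fun z hz hzP => ?_
    rw [norm_mul]
    exact mul_le_mul (hC z hz hzP) (hCφ z hz) (norm_nonneg _)
      ((norm_nonneg _).trans (hC z hz hzP))
  -- A single component `u φ` in the direction `v` treats space and time derivatives alike; its flux
  -- carries the factor `U(ξ)`, which tends to zero.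
  set f : Unit → Spacetime n → ℝ := fun _ z => selfSimilarFunction n γ U z * φ z with hf
  have hfK : ∀ i, ∀ z ∉ K, f i z = 0 := fun i z hz => by simp only [hf, hφK z hz, mul_zero]
  have hdiv : EqOn (familyDiv f fun _ => v) (fun z => selfSimilarFunction n γ U z * fderiv ℝ φ z v
      + d z * φ z) (exteriorRegion n R) := fun z hz => by
    have h1 := ((huc.contDiffAt (isOpen_exteriorRegion.mem_nhds hz)).differentiableAt
      one_ne_zero).hasFDerivAt
    have h2 := (hφ.differentiable one_ne_zero z).hasFDerivAt
    have h3 : HasFDerivAt (fun z => selfSimilarFunction n γ U z * φ z) _ z := h1.mul h2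
    simp only [familyDiv, hf, Finset.univ_unique, Finset.sum_singleton, h3.fderiv]
    simp [hdu z hz, mul_comm]
  have hPm : MeasurableSet (exteriorRegion n R) := isOpen_exteriorRegion.measurableSet
  have hmain := integral_familyDiv_eq_zero (f := f) (v := fun _ => v) hR hK hKQ
    (fun _ => huc.mul hφ.contDiffOn) hfK
    ((hi1.add hi2).congr_fun (fun z hz => (hdiv hz).symm) hPm)
    (flux_tendsto_zero (e := U) (c := fun z => z.2 ^ (scalingExponent γ / 2) * |φ z| *
        (z.2 ^ (-(1 / 2) : ℝ) * ‖v.1‖ + similarityVar z / z.2 * |v.2|)) hK hKQ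
      (fun z hz => familyFlux_eq_zero hfK hz) ?_ ?_ (hU.tendsto_zero hγ₀ hγ₁ hR))
  · rw [setIntegral_congr_fun hPm hdiv, integral_add hi1 hi2] at hmain
    linarith
  · refine ((continuousOn_time_rpow _).mul hφ.continuous.abs.continuousOn).mul
      (((continuousOn_time_rpow _).mul continuousOn_const).add
        ((continuousOn_similarityVar.div continuous_snd.continuousOn fun z hz => ?_).mul
          continuousOn_const))
    exact (ne_of_gt hz)
  · intro z hz
    have h1 := abs_fderiv_similarityVar_le hR hz v
    simp only [familyFlux, hf, Finset.univ_unique, Finset.sum_singleton, selfSimilarFunction_eq]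
    have h2 : 0 < z.2 ^ (scalingExponent γ / 2) := Real.rpow_pos_of_pos hz.1 _
    rw [abs_mul, abs_mul, abs_mul, abs_of_pos h2]
    calc _ = z.2 ^ (scalingExponent γ / 2) * |φ z| * |fderiv ℝ similarityVar z v|
          * |U (similarityVar z)| := by ring
      _ ≤ _ := by gcongr

/-- The vector field `φ ∇u`. -/
noncomputable def gradientField (γ : ℝ) (U : ℝ → ℝ) (φ : Spacetime n → ℝ) (i : Fin n)
    (z : Spacetime n) : ℝ := φ z * radialFactor γ U z * z.1 i

theorem contDiff_coord (i : Fin n) {k : WithTop ℕ∞} :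
    ContDiff ℝ k fun z : Spacetime n => z.1 i :=
  (EuclideanSpace.proj (𝕜 := ℝ) i).contDiff.comp contDiff_fst

theorem contDiffOn_gradientField (hU : IsSelfSimilarProfile n γ R U) (hR : 0 < R)
    {φ : Spacetime n → ℝ} (hφ : ContDiff ℝ 1 φ) (i : Fin n) :
    ContDiffOn ℝ 1 (gradientField γ U φ i) (exteriorRegion n R) :=
  (hφ.contDiffOn.mul (contDiffOn_radialFactor hU hR)).mul (contDiff_coord i).contDiffOn

/-- This is `div (φ ∇u) = ∇φ·∇u + φ Δu` with `Δu` taken from the equation. -/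
theorem familyDiv_gradientField (hU : IsSelfSimilarProfile n γ R U) (hγ₁ : γ ≤ 1) (hR : 0 < R)
    {φ : Spacetime n → ℝ} (hφ : ContDiff ℝ 1 φ) {z : Spacetime n}
    (hz : z ∈ exteriorRegion n R) :
    familyDiv (gradientField γ U φ) spatialDir z =
      timeFactor γ U z * φ z + spatialDeriv φ z (radialFactor γ U z • z.1)
        + γ * (φ z * selfSimilarFunction n γ U z ^ (γ - 1)) := by
  obtain ⟨L, q₁, hL, hLx, heq⟩ := hasFDerivAt_radialFactor hU hγ₁ hR hz
  have h1 := (hφ.differentiable one_ne_zero z).hasFDerivAt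
  have h2 : HasFDerivAt (fun z => φ z * radialFactor γ U z) _ z := h1.mul hL
  have h3 := familyDiv_smul_position h2
  have hsm : fderiv ℝ φ z (radialFactor γ U z • z.1, 0)
      = radialFactor γ U z * fderiv ℝ φ z (z.1, 0) := by
    rw [← smul_eq_mul, ← map_smul]; simp
  rw [spatialDeriv, hsm]
  refine h3.trans ?_
  simp [hLx]
  linear_combination φ z * heq

/-- Because `x·∇ξ = ξ`, the division by `ξ` in `radialFactor` disappears. -/
theorem familyFlux_gradientField (hR : 0 < R) {φ : Spacetime n → ℝ} {z : Spacetime n}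
    (hz : z ∈ exteriorRegion n R) :
    familyFlux (gradientField γ U φ) spatialDir z =
      φ z * z.2 ^ (scalingExponent γ / 2 - 1) * deriv U (similarityVar z) := by
  have hx := norm_pos_of_mem_exteriorRegion hR hz
  have hξ : 0 < similarityVar z := hR.trans hz.2
  obtain ⟨L, hL, hLx, -⟩ := hasFDerivAt_similarityVar hz.1 hx
  have h1 : familyFlux (gradientField γ U φ) spatialDir z
      = φ z * radialFactor γ U z * ∑ i, z.1 i * L (spatialDir i) := by
    rw [familyFlux, Finset.mul_sum, hL.fderiv]
    exact Finset.sum_congr rfl fun i _ => by rw [gradientField]; ring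
  have h2 : z.2 ^ (-(1 / 2) : ℝ) * (‖z.1‖ ^ 2 / ‖z.1‖) = similarityVar z := by
    rw [similarityVar]; field_simp
  rw [h1, sum_mul_apply_spatialDir, hLx, real_inner_self_eq_norm_sq, h2, radialFactor]
  field_simp

/-- The part of the divergence of `φ ∇u` that does not contain the singular term is integrable. -/
theorem integrableOn_regular_part (hU : IsSelfSimilarProfile n γ R U) (hγ₀ : 0 ≤ γ)
    (hγ₁ : γ ≤ 1) (hR : 0 < R) (hK : IsCompact K) (hKQ : K ⊆ upperSpacetime n)
    {φ : Spacetime n → ℝ} (hφ : ContDiff ℝ 1 φ) (hφK : ∀ z ∉ K, φ z = 0) :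
    IntegrableOn (fun z => timeFactor γ U z * φ z
      + spatialDeriv φ z (radialFactor γ U z • z.1)) (exteriorRegion n R) := by
  obtain ⟨CD, hCD0, hCD⟩ := exists_bound_timeFactor hU hγ₀ hγ₁ hR hK hKQ
  obtain ⟨CG, hCG0, hCG⟩ := exists_bound_gradient hU hγ₀ hγ₁ hR hK hKQ
  obtain ⟨Cφ, hCφ⟩ := hK.exists_bound_of_continuousOn hφ.continuous.continuousOn
  obtain ⟨Cd, hCd⟩ := hK.exists_bound_of_continuousOn
    (hφ.continuous_fderiv one_ne_zero).continuousOn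
  have hqc := (contDiffOn_radialFactor hU hR).continuousOn
  refine integrableOn_of_bound (C := CD * Cφ + Cd * CG) hK ?_ (fun z hz => ?_)
    fun z hz hzP => ?_
  · refine ((continuousOn_timeFactor hU hR).mul hφ.continuous.continuousOn).add ?_
    exact (hφ.continuous_fderiv one_ne_zero).continuousOn.clm_apply
      ((hqc.smul continuous_fst.continuousOn).prodMk continuousOn_const)
  · have : φ =ᶠ[𝓝 z] fun _ => 0 := by
      filter_upwards [hK.isClosed.isOpen_compl.mem_nhds hz] with w hw using hφK w hw
    rw [hφK z hz, spatialDeriv, this.fderiv_eq]; simp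
  · refine (norm_add_le _ _).trans (add_le_add ?_ ?_)
    · rw [norm_mul]
      exact mul_le_mul (hCD z hz hzP) (hCφ z hz) (norm_nonneg _) hCD0
    · refine (ContinuousLinearMap.le_opNorm _ _).trans ?_
      refine mul_le_mul (hCd z hz) ?_ (norm_nonneg _) ((norm_nonneg _).trans (hCd z hz))
      rw [Prod.norm_def]
      simpa using hCG z hz hzP

theorem gradientField_eq_zero {φ : Spacetime n → ℝ} (hφK : ∀ z ∉ K, φ z = 0) (i : Fin n)
    (z : Spacetime n) (hz : z ∉ K) : gradientField γ U φ i z = 0 := by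
  rw [gradientField, hφK z hz, zero_mul, zero_mul]

/-- Local integrability of the singular reaction term. -/
theorem integrableOn_reaction (hU : IsSelfSimilarProfile n γ R U) (hγ₀ : 0 < γ)
    (hγ₁ : γ ≤ 1) (hR : 0 < R) (hK : IsCompact K) (hKQ : K ⊆ upperSpacetime n)
    {φ : Spacetime n → ℝ} (hφ : ContDiff ℝ 1 φ) (hφ0 : ∀ z, 0 ≤ φ z)
    (hφK : ∀ z ∉ K, φ z = 0) :
    IntegrableOn (fun z => φ z * selfSimilarFunction n γ U z ^ (γ - 1))
      (exteriorRegion n R) := by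
  have hPm : MeasurableSet (exteriorRegion n R) := isOpen_exteriorRegion.measurableSet
  have hreg := integrableOn_regular_part hU hγ₀.le hγ₁ hR hK hKQ hφ hφK
  obtain ⟨g₁, hg₁, hgU₁⟩ := exists_continuous_extension hU.contDiffOn_deriv.continuousOn
    (hU.tendsto_deriv hγ₀.le hγ₁ hR)
  obtain ⟨B, hB0, hB⟩ := exists_bound_of_eqOn
    (f := familyFlux (gradientField γ U φ) spatialDir) hK hKQ
    ((hφ.continuous.continuousOn.mul (continuousOn_time_rpow (scalingExponent γ / 2 - 1))).mul
      (hg₁.comp_continuousOn continuousOn_similarityVar)) (fun z (hz : z ∈ exteriorRegion n R) => by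
        simp only [familyFlux_gradientField hR hz, Pi.mul_apply, Function.comp_apply, hgU₁ _ hz.2])
  -- The reaction term is nonnegative, so the divergence of `φ ∇u` is bounded below by its regular
  -- part; `U'` is bounded near `R`, hence so is the flux.
  have hdiv := integrableOn_familyDiv (f := gradientField γ U φ) (v := spatialDir) (B := B)
    hR hK hKQ (contDiffOn_gradientField hU hR hφ) (gradientField_eq_zero hφK) hB0
    (fun z hz _ => by
      by_cases hzK : z ∈ K
      · exact hB z hzK hz
      · rw [familyFlux_eq_zero (gradientField_eq_zero hφK) hzK, abs_zero]; exact hB0)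
    hreg.neg (fun z hz => by
      rw [familyDiv_gradientField hU hγ₁ hR hφ hz, Pi.neg_apply, neg_neg]
      have h1 := Real.rpow_nonneg (selfSimilarFunction_pos hU hz).le (γ - 1)
      have h2 := mul_nonneg hγ₀.le (mul_nonneg (hφ0 z) h1)
      linarith)
  have h := (hdiv.sub hreg).const_mul γ⁻¹
  refine IntegrableOn.congr_fun h (fun z hz => ?_) hPm
  simp only [Pi.sub_apply]
  rw [familyDiv_gradientField hU hγ₁ hR hφ hz]
  field_simp
  ring

/-- The weak formulation, as an integral over the exterior region. -/
theorem integral_weak_formulation (hU : IsSelfSimilarProfile n γ R U) (hγ₀ : 0 < γ)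
    (hγ₁ : γ ≤ 1) (hR : 0 < R) (hK : IsCompact K) (hKQ : K ⊆ upperSpacetime n)
    {φ : Spacetime n → ℝ} (hφ : ContDiff ℝ 1 φ) (hφK : ∀ z ∉ K, φ z = 0)
    (hreac : IntegrableOn (fun z => φ z * selfSimilarFunction n γ U z ^ (γ - 1))
      (exteriorRegion n R)) :
    ∫ z in exteriorRegion n R, (timeFactor γ U z * φ z
      + spatialDeriv φ z (radialFactor γ U z • z.1)
      + γ * (φ z * selfSimilarFunction n γ U z ^ (γ - 1))) = 0 := by
  have hPm : MeasurableSet (exteriorRegion n R) := isOpen_exteriorRegion.measurableSet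
  have hreg := integrableOn_regular_part hU hγ₀.le hγ₁ hR hK hKQ hφ hφK
  have hdiv : EqOn (familyDiv (gradientField γ U φ) spatialDir) _ (exteriorRegion n R) :=
    fun z hz => familyDiv_gradientField hU hγ₁ hR hφ hz
  rw [← setIntegral_congr_fun hPm hdiv]
  refine integral_familyDiv_eq_zero hR hK hKQ (contDiffOn_gradientField hU hR hφ)
    (gradientField_eq_zero hφK)
    (IntegrableOn.congr_fun (hreg.add (hreac.const_mul γ)) (fun z hz => (hdiv hz).symm) hPm)
    (flux_tendsto_zero (e := deriv U)
      (c := fun z => |φ z| * z.2 ^ (scalingExponent γ / 2 - 1)) hK hKQ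
      (fun z hz => familyFlux_eq_zero (gradientField_eq_zero hφK) hz)
      (hφ.continuous.abs.continuousOn.mul (continuousOn_time_rpow _)) (fun z hz => ?_)
      (hU.tendsto_deriv_zero hγ₀ hγ₁ hR))
  rw [familyFlux_gradientField hR hz, abs_mul, abs_mul,
    abs_of_pos (Real.rpow_pos_of_pos hz.1 _)]

/-- `∇u` is parallel to `∇ξ`, so `|∇u|² Φ·∇ξ - 2 (∇u·Φ)(∇u·∇ξ)` equals `-|∇u|² Φ·∇ξ`. What remains
is the quantity in `tendsto_energy`. -/
theorem familyFlux_variationField (hU : IsSelfSimilarProfile n γ R U) (hγ₁ : γ ≤ 1)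
    (hR : 0 < R) {Φ : Spacetime n → Spacetime n} {z : Spacetime n}
    (hz : z ∈ exteriorRegion n R) :
    familyFlux (variationField γ U Φ) spatialDir z =
      z.2 ^ (-(1 / 2) : ℝ) * (inner ℝ z.1 (Φ z).1 / ‖z.1‖) * z.2 ^ (scalingExponent γ - 1)
        * (2 * U (similarityVar z) ^ γ - deriv U (similarityVar z) ^ 2) := by
  have ht : 0 < z.2 := hz.1
  have hx := norm_pos_of_mem_exteriorRegion hR hz
  have hξ : 0 < similarityVar z := hR.trans hz.2
  obtain ⟨L, hL, hLx, -⟩ := hasFDerivAt_similarityVar hz.1 hx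
  have h1 : familyFlux (variationField γ U Φ) spatialDir z
      = (radialFactor γ U z ^ 2 * ‖z.1‖ ^ 2 + 2 * selfSimilarFunction n γ U z ^ γ)
          * ∑ i, (Φ z).1 i * L (spatialDir i)
        + (-2 * radialFactor γ U z ^ 2 * inner ℝ z.1 (Φ z).1)
          * ∑ i, z.1 i * L (spatialDir i) := by
    rw [familyFlux, Finset.mul_sum, Finset.mul_sum, hL.fderiv, ← Finset.sum_add_distrib]
    exact Finset.sum_congr rfl fun i _ => by rw [variationField]; ring
  have h2 : selfSimilarFunction n γ U z ^ γ
      = z.2 ^ (scalingExponent γ - 1) * U (similarityVar z) ^ γ := by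
    rw [selfSimilarFunction_eq, Real.mul_rpow (Real.rpow_nonneg ht.le _) (hU.pos _ hz.2).le,
      ← Real.rpow_mul ht.le]
    congr 2
    have := scalingExponent_mul_sub_one hγ₁
    linarith
  have h3 : radialFactor γ U z ^ 2 * ‖z.1‖ ^ 2
      = z.2 ^ (scalingExponent γ - 1) * deriv U (similarityVar z) ^ 2 := by
    have e1 : z.2 ^ (scalingExponent γ / 2 - 1) ^ 1 * z.2 ^ (scalingExponent γ / 2 - 1)
        = z.2 ^ (scalingExponent γ - 1) / z.2 := by
      rw [pow_one, ← Real.rpow_add ht, ← Real.rpow_sub_one ht.ne']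
      congr 1; ring
    rw [pow_one] at e1
    have e2 : ‖z.1‖ ^ 2 = similarityVar z ^ 2 * z.2 := by
      rw [similarityVar]
      linear_combination (-‖z.1‖ ^ 2) * rpow_neg_half_sq_mul ht
    have e3 : z.2 ^ (scalingExponent γ - 1)
        = z.2 ^ (scalingExponent γ / 2 - 1) * z.2 ^ (scalingExponent γ / 2 - 1) * z.2 := by
      rw [e1, div_mul_cancel₀ _ ht.ne']
    rw [radialFactor, e2, e3]
    field_simp
  rw [h1, sum_mul_apply_spatialDir, sum_mul_apply_spatialDir, hLx, hLx,
    real_inner_self_eq_norm_sq]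
  have h4 : (-2 * radialFactor γ U z ^ 2 * inner ℝ z.1 (Φ z).1)
      * (z.2 ^ (-(1 / 2) : ℝ) * (‖z.1‖ ^ 2 / ‖z.1‖))
      = -2 * (radialFactor γ U z ^ 2 * ‖z.1‖ ^ 2)
        * (z.2 ^ (-(1 / 2) : ℝ) * (inner ℝ z.1 (Φ z).1 / ‖z.1‖)) := by ring
  rw [h4, h3, h2]
  ring

theorem contDiffOn_variationField (hU : IsSelfSimilarProfile n γ R U) (hR : 0 < R)
    {Φ : Spacetime n → Spacetime n} (hΦ : ContDiff ℝ 1 Φ) (i : Fin n) :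
    ContDiffOn ℝ 1 (variationField γ U Φ i) (exteriorRegion n R) := by
  have hq := contDiffOn_radialFactor hU hR
  have hu : ContDiffOn ℝ 1 (fun z => selfSimilarFunction n γ U z ^ γ) (exteriorRegion n R) :=
    (contDiffOn_selfSimilarFunction hU hR).rpow_const_of_ne fun z hz =>
      (selfSimilarFunction_pos hU hz).ne'
  have hx : ContDiffOn ℝ 1 (fun z : Spacetime n => ‖z.1‖ ^ 2) (exteriorRegion n R) :=
    (contDiff_fst.norm_sq ℝ).contDiffOn
  have hΦ1 : ContDiff ℝ 1 fun z => (Φ z).1 := contDiff_fst.comp hΦ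
  have hin : ContDiffOn ℝ 1 (fun z : Spacetime n => inner ℝ z.1 (Φ z).1) (exteriorRegion n R) :=
    (contDiff_fst.inner ℝ hΦ1).contDiffOn
  exact ((((hq.pow 2).mul hx).add (contDiffOn_const.mul hu)).mul
    ((contDiff_coord i).comp hΦ).contDiffOn).add
    (((contDiffOn_const.mul (hq.pow 2)).mul hin).mul (contDiff_coord i).contDiffOn)

/-- The domain variation formula, as an integral over the exterior region. -/
theorem integral_domain_variation (hU : IsSelfSimilarProfile n γ R U) (hγ₀ : 0 ≤ γ)
    (hγ₁ : γ ≤ 1) (hR : 0 < R) (hK : IsCompact K) (hKQ : K ⊆ upperSpacetime n)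
    {Φ : Spacetime n → Spacetime n} (hΦ : ContDiff ℝ 1 Φ) (hΦK : ∀ z ∉ K, Φ z = 0) :
    ∫ z in exteriorRegion n R,
      ((‖radialFactor γ U z • z.1‖ ^ 2 + 2 * selfSimilarFunction n γ U z ^ γ) * spatialDiv Φ z
      - 2 * inner ℝ (radialFactor γ U z • z.1)
          (spatialDeriv Φ z (radialFactor γ U z • z.1)).1
      - 2 * timeFactor γ U z * inner ℝ (radialFactor γ U z • z.1) (Φ z).1) = 0 := by
  have hPm : MeasurableSet (exteriorRegion n R) := isOpen_exteriorRegion.measurableSet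
  have hdiv : EqOn (familyDiv (variationField γ U Φ) spatialDir) _ (exteriorRegion n R) :=
    fun z hz => familyDiv_variationField hU hγ₁ hR hz (hΦ.differentiable one_ne_zero z)
  have hXK : ∀ i : Fin n, ∀ z ∉ K, variationField γ U Φ i z = 0 := fun i z hz => by
    rw [variationField, hΦK z hz]; simp
  obtain ⟨Cu, hCu0, hCu⟩ := exists_bound_selfSimilarFunction hU hγ₀ hγ₁ hR hK hKQ
  obtain ⟨CD, hCD0, hCD⟩ := exists_bound_timeFactor hU hγ₀ hγ₁ hR hK hKQ
  obtain ⟨CG, hCG0, hCG⟩ := exists_bound_gradient hU hγ₀ hγ₁ hR hK hKQ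
  obtain ⟨C₀, hC₀⟩ := hK.exists_bound_of_continuousOn hΦ.continuous.continuousOn
  obtain ⟨C₁, hC₁⟩ := hK.exists_bound_of_continuousOn
    (hΦ.continuous_fderiv one_ne_zero).continuousOn
  have hsd : Continuous (spatialDiv Φ) := continuous_finsetSum _ fun j _ =>
    (EuclideanSpace.proj (𝕜 := ℝ) j).continuous.comp (continuous_fst.comp
      ((hΦ.continuous_fderiv one_ne_zero).clm_apply continuous_const))
  obtain ⟨C₂, hC₂⟩ := hK.exists_bound_of_continuousOn hsd.continuousOn
  -- The singular power has cancelled, so every term is bounded for all `γ ∈ [0, 1]`.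
  have hint : IntegrableOn (familyDiv (variationField γ U Φ) spatialDir)
      (exteriorRegion n R) := by
    refine integrableOn_of_bound
      (C := (CG ^ 2 + 2 * Cu ^ γ) * C₂ + 2 * (CG * (C₁ * CG)) + 2 * CD * (CG * C₀)) hK
      (continuousOn_familyDiv (contDiffOn_variationField hU hR hΦ))
      (fun z hz => familyDiv_eq_zero hK hXK hz) fun z hz hzP => ?_
    have hG := hCG z hz hzP
    have hG0 := norm_nonneg (radialFactor γ U z • z.1)
    have hu0 := selfSimilarFunction_pos hU hzP
    have hu := hCu z hz hzP
    rw [Real.norm_of_nonneg hu0.le] at hu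
    have huγ := Real.rpow_le_rpow hu0.le hu hγ₀
    have huγ0 := Real.rpow_nonneg hu0.le γ
    have hD := hCD z hz hzP
    have h0 : 0 ≤ CG ^ 2 + 2 * Cu ^ γ := by positivity
    rw [hdiv hzP]
    refine (norm_sub_le _ _).trans (add_le_add ((norm_sub_le _ _).trans (add_le_add ?_ ?_)) ?_)
    · rw [norm_mul]
      refine mul_le_mul ?_ (hC₂ z hz) (norm_nonneg _) h0
      rw [Real.norm_of_nonneg (by positivity)]
      gcongr
    · rw [norm_mul, Real.norm_ofNat]
      refine mul_le_mul_of_nonneg_left ((norm_inner_le_norm _ _).trans ?_) (by norm_num)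
      refine mul_le_mul hG ((norm_fst_le _).trans ?_) (norm_nonneg _) hCG0
      refine (ContinuousLinearMap.le_opNorm _ _).trans ?_
      refine mul_le_mul (hC₁ z hz) ?_ (norm_nonneg _) ((norm_nonneg _).trans (hC₁ z hz))
      rw [Prod.norm_def]
      simpa using hG
    · rw [norm_mul, norm_mul, Real.norm_ofNat]
      refine mul_le_mul (mul_le_mul_of_nonneg_left hD (by norm_num)) ?_ (norm_nonneg _)
        (by positivity)
      refine (norm_inner_le_norm _ _).trans ?_
      exact mul_le_mul hG ((norm_fst_le _).trans (hC₀ z hz)) (norm_nonneg _) hCG0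
  rw [← setIntegral_congr_fun hPm hdiv]
  refine integral_familyDiv_eq_zero hR hK hKQ (contDiffOn_variationField hU hR hΦ) hXK hint
    (flux_tendsto_zero (e := fun r => 2 * U r ^ γ - deriv U r ^ 2)
      (c := fun z => z.2 ^ (-(1 / 2) : ℝ) * ‖(Φ z).1‖ * z.2 ^ (scalingExponent γ - 1)) hK hKQ
      (fun z hz => familyFlux_eq_zero hXK hz) ?_ (fun z hz => ?_)
      (hU.tendsto_energy hγ₀ hγ₁ hR))
  · exact ((continuousOn_time_rpow _).mul
      (continuous_fst.comp hΦ.continuous).norm.continuousOn).mul (continuousOn_time_rpow _)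
  · have hx := norm_pos_of_mem_exteriorRegion hR hz
    have h1 := Real.rpow_pos_of_pos hz.1 (-(1 / 2))
    have h2 := Real.rpow_pos_of_pos hz.1 (scalingExponent γ - 1)
    rw [familyFlux_variationField hU hγ₁ hR hz, abs_mul, abs_mul, abs_mul, abs_of_pos h1,
      abs_of_pos h2, abs_div, abs_of_pos hx]
    have h3 : |inner ℝ z.1 (Φ z).1| / ‖z.1‖ ≤ ‖(Φ z).1‖ := by
      rw [div_le_iff₀ hx, mul_comm]
      exact abs_real_inner_le_norm _ _
    gcongr

end Fields

/-! ### The notions of solution. -/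

section Solutions

variable {n : ℕ} {γ R : ℝ} {U : ℝ → ℝ} {W : Set (Spacetime n)}

/-- The spatial gradient of the self-similar function. -/
noncomputable def selfSimilarGradient (γ R : ℝ) (U : ℝ → ℝ) :
    Spacetime n → EuclideanSpace ℝ (Fin n) :=
  (exteriorRegion n R).indicator fun z => radialFactor γ U z • z.1

/-- The time derivative of the self-similar function. -/
noncomputable def selfSimilarTimeDeriv (γ R : ℝ) (U : ℝ → ℝ) : Spacetime n → ℝ :=
  (exteriorRegion n R).indicator (timeFactor γ U)

theorem spatialDeriv_eq_zero {F : Type*} [NormedAddCommGroup F] [NormedSpace ℝ F]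
    {φ : Spacetime n → F} {z : Spacetime n} (hz : z ∉ tsupport φ)
    (v : EuclideanSpace ℝ (Fin n)) : spatialDeriv φ z v = 0 := by
  rw [spatialDeriv, fderiv_of_notMem_tsupport ℝ hz]; simp

theorem inEnergySpace_selfSimilarFunction (hU : IsSelfSimilarProfile n γ R U) (hγ₀ : 0 ≤ γ)
    (hγ₁ : γ ≤ 1) (hR : 0 < R) (hW : MeasurableSet W) (hK : IsCompact (closure W))
    (hKQ : closure W ⊆ upperSpacetime n) :
    InEnergySpace W (selfSimilarFunction n γ U) (selfSimilarGradient γ R U)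
      (selfSimilarTimeDeriv γ R U) := by
  have hPm : MeasurableSet (exteriorRegion n R) := isOpen_exteriorRegion.measurableSet
  obtain ⟨Cu, hCu0, hCu⟩ := exists_bound_selfSimilarFunction hU hγ₀ hγ₁ hR hK hKQ
  obtain ⟨CD, hCD0, hCD⟩ := exists_bound_timeFactor hU hγ₀ hγ₁ hR hK hKQ
  obtain ⟨CG, hCG0, hCG⟩ := exists_bound_gradient hU hγ₀ hγ₁ hR hK hKQ
  have huc := (contDiffOn_selfSimilarFunction hU hR).continuousOn
  have hqc := (contDiffOn_radialFactor hU hR).continuousOn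
  have hu0 : ∀ z ∈ closure W, z ∉ exteriorRegion n R → selfSimilarFunction n γ U z = 0 :=
    fun z hz hzP => selfSimilarFunction_eq_zero hU (hKQ hz) hzP
  refine ⟨?_, ?_, ?_, ?_, ?_⟩
  · refine (memLp_congr_ae ?_).1
      (memLp_indicator_of_bound hK subset_closure hW huc hCu0 hCu)
    rw [Filter.EventuallyEq, ae_restrict_iff' hW]
    refine Eventually.of_forall fun z hz => ?_
    by_cases hzP : z ∈ exteriorRegion n R
    · rw [indicator_of_mem hzP]
    · rw [indicator_of_notMem hzP, hu0 z (subset_closure hz) hzP]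
  · exact memLp_indicator_of_bound hK subset_closure hW
      (hqc.smul continuous_fst.continuousOn) hCG0 hCG
  · exact memLp_indicator_of_bound hK subset_closure hW (continuousOn_timeFactor hU hR) hCD0 hCD
  · rintro φ ⟨hφ, hφc, hφW⟩ v
    have hsub : tsupport φ ⊆ closure W := hφW.trans subset_closure
    have hφ0 : ∀ z ∉ tsupport φ, φ z = 0 := fun z hz => image_eq_zero_of_notMem_tsupport hz
    rw [setIntegral_eq_exterior (R := R) hφW
        (fun z hz => by rw [spatialDeriv_eq_zero hz, mul_zero])
        (fun z hz hzP => by rw [hu0 z (hsub hz) hzP, zero_mul]),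
      setIntegral_eq_exterior (R := R) hφW
        (fun z hz => by rw [hφ0 z hz, mul_zero])
        (fun z hz hzP => by rw [selfSimilarGradient, indicator_of_notMem hzP]; simp)]
    have h := integral_mul_fderiv_selfSimilarFunction hU hγ₀ hγ₁ hR hφc (hsub.trans hKQ)
      (hφ.of_le (by simp)) hφ0 (v, 0)
      (d := fun z => inner ℝ (radialFactor γ U z • z.1) v) (C := CG * ‖v‖)
      (ContinuousOn.inner (𝕜 := ℝ) (hqc.smul continuous_fst.continuousOn) continuousOn_const) (fun z hz => by
        obtain ⟨L, hL, hLx, -⟩ := hasFDerivAt_selfSimilarFunction hU hR hz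
        rw [hL.fderiv, hLx, inner_smul_left]; simp) (fun z hz hzP =>
        (norm_inner_le_norm _ _).trans
          (mul_le_mul_of_nonneg_right (hCG z (hsub hz) hzP) (norm_nonneg _)))
    refine h.trans (congrArg Neg.neg (setIntegral_congr_fun hPm fun z hz => ?_))
    simp only [selfSimilarGradient, indicator_of_mem hz]
  · rintro φ ⟨hφ, hφc, hφW⟩
    have hsub : tsupport φ ⊆ closure W := hφW.trans subset_closure
    have hφ0 : ∀ z ∉ tsupport φ, φ z = 0 := fun z hz => image_eq_zero_of_notMem_tsupport hz
    rw [setIntegral_eq_exterior (R := R) hφW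
        (fun z hz => by rw [timeDeriv, fderiv_of_notMem_tsupport ℝ hz]; simp)
        (fun z hz hzP => by rw [hu0 z (hsub hz) hzP, zero_mul]),
      setIntegral_eq_exterior (R := R) hφW
        (fun z hz => by rw [hφ0 z hz, mul_zero])
        (fun z hz hzP => by rw [selfSimilarTimeDeriv, indicator_of_notMem hzP]; simp)]
    have h := integral_mul_fderiv_selfSimilarFunction hU hγ₀ hγ₁ hR hφc (hsub.trans hKQ)
      (hφ.of_le (by simp)) hφ0 (0, 1) (continuousOn_timeFactor hU hR) (fun z hz => by
        obtain ⟨L, hL, -, hLt⟩ := hasFDerivAt_selfSimilarFunction hU hR hz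
        rw [hL.fderiv, hLt]) (fun z hz hzP => hCD z (hsub hz) hzP)
    refine h.trans (congrArg Neg.neg (setIntegral_congr_fun hPm fun z hz => ?_))
    simp only [selfSimilarTimeDeriv, indicator_of_mem hz]

theorem domainVariationFormulation_selfSimilarFunction (hU : IsSelfSimilarProfile n γ R U)
    (hγ₀ : 0 ≤ γ) (hγ₁ : γ ≤ 1) (hR : 0 < R) (hKQ : closure W ⊆ upperSpacetime n) :
    DomainVariationFormulation γ W (selfSimilarFunction n γ U) (selfSimilarGradient γ R U)
      (selfSimilarTimeDeriv γ R U) := by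
  rintro Φ ⟨hΦ, hΦc, hΦW⟩
  have hPm : MeasurableSet (exteriorRegion n R) := isOpen_exteriorRegion.measurableSet
  have hsub : tsupport Φ ⊆ closure W := hΦW.trans subset_closure
  have hΦ0 : ∀ z ∉ tsupport Φ, Φ z = 0 := fun z hz => image_eq_zero_of_notMem_tsupport hz
  rw [setIntegral_eq_exterior (R := R) hΦW (fun z hz => ?_) (fun z hz hzP => ?_)]
  · refine (setIntegral_congr_fun hPm fun z hz => ?_).trans
      (integral_domain_variation hU hγ₀ hγ₁ hR hΦc (hsub.trans hKQ) (hΦ.of_le (by simp)) hΦ0)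
    simp only [selfSimilarGradient, selfSimilarTimeDeriv, indicator_of_mem hz, posPartPow,
      if_pos (selfSimilarFunction_pos hU hz)]
  · simp [spatialDiv, spatialDeriv_eq_zero hz, hΦ0 z hz]
  · simp [selfSimilarGradient, selfSimilarTimeDeriv, indicator_of_notMem hzP, posPartPow,
      selfSimilarFunction_eq_zero hU (hKQ (hsub hz)) hzP]

theorem posPartPow_selfSimilarFunction (hU : IsSelfSimilarProfile n γ R U) (p : ℝ) :
    EqOn (fun z => posPartPow p (selfSimilarFunction n γ U z))
      ((exteriorRegion n R).indicator fun z => selfSimilarFunction n γ U z ^ p)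
      (upperSpacetime n) := fun z hz => by
  by_cases hzP : z ∈ exteriorRegion n R
  · simp only [indicator_of_mem hzP, posPartPow, if_pos (selfSimilarFunction_pos hU hzP)]
  · simp only [indicator_of_notMem hzP, posPartPow, selfSimilarFunction_eq_zero hU hz hzP,
      lt_irrefl, if_false]

/-- `integrableOn_reaction` needs a smooth nonnegative weight; one that equals `1` on the closure of
`W` removes it. -/
theorem integrableOn_posPartPow (hU : IsSelfSimilarProfile n γ R U) (hγ₀ : 0 < γ)
    (hγ₁ : γ ≤ 1) (hR : 0 < R) (hW : MeasurableSet W) (hK : IsCompact (closure W))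
    (hKQ : closure W ⊆ upperSpacetime n) :
    IntegrableOn (fun z => posPartPow (γ - 1) (selfSimilarFunction n γ U z)) W := by
  have hPm : MeasurableSet (exteriorRegion n R) := isOpen_exteriorRegion.measurableSet
  obtain ⟨L, φ, hL, hLQ, hφ, hφ0, hφ1, hφL⟩ := exists_smooth_one_on_compact hK hKQ
  have h1 := integrableOn_reaction hU hγ₀ hγ₁ hR hL hLQ (hφ.of_le (by simp)) hφ0 hφL
  rw [← integrable_indicator_iff hPm] at h1
  refine (h1.integrableOn (s := W)).congr_fun (fun z hz => ?_) hW
  have hz' := subset_closure hz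
  have h2 := posPartPow_selfSimilarFunction hU (γ - 1) (hKQ hz')
  simp only at h2
  rw [h2]
  by_cases hzP : z ∈ exteriorRegion n R
  · rw [indicator_of_mem hzP, indicator_of_mem hzP, hφ1 z hz', one_mul]
  · rw [indicator_of_notMem hzP, indicator_of_notMem hzP]

theorem weakFormulation_selfSimilarFunction (hU : IsSelfSimilarProfile n γ R U) (hγ₀ : 0 < γ)
    (hγ₁ : γ ≤ 1) (hR : 0 < R) (hW : MeasurableSet W) (hK : IsCompact (closure W))
    (hKQ : closure W ⊆ upperSpacetime n) :
    WeakFormulation γ W (selfSimilarFunction n γ U) (selfSimilarGradient γ R U)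
      (selfSimilarTimeDeriv γ R U) := by
  rintro φ ⟨hφ, hφc, hφW⟩
  have hPm : MeasurableSet (exteriorRegion n R) := isOpen_exteriorRegion.measurableSet
  have hsub : tsupport φ ⊆ closure W := hφW.trans subset_closure
  have hφ0 : ∀ z ∉ tsupport φ, φ z = 0 := fun z hz => image_eq_zero_of_notMem_tsupport hz
  -- The test function may change sign, so `integrableOn_reaction` does not apply to it directly;
  -- boundedness of `φ` suffices once the power is integrable on `W`.
  have hreac : IntegrableOn (fun z => φ z * selfSimilarFunction n γ U z ^ (γ - 1))
      (exteriorRegion n R) := by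
    obtain ⟨C, hC⟩ := hφc.exists_bound_of_continuousOn hφ.continuous.continuousOn
    have hb : ∀ z, ‖φ z‖ ≤ max C 0 := fun z => by
      by_cases hz : z ∈ tsupport φ
      · exact (hC z hz).trans (le_max_left _ _)
      · rw [hφ0 z hz, norm_zero]; exact le_max_right _ _
    have h1 := (integrableOn_posPartPow hU hγ₀ hγ₁ hR hW hK hKQ).bdd_mul (c := max C 0)
      hφ.continuous.aestronglyMeasurable (Eventually.of_forall hb)
    have h2 : IntegrableOn (fun z => φ z * posPartPow (γ - 1) (selfSimilarFunction n γ U z))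
        univ := IntegrableOn.of_forall_sdiff_eq_zero h1 MeasurableSet.univ fun z hz => by
      rw [hφ0 z fun h => hz.2 (hφW h), zero_mul]
    refine (h2.mono_set (subset_univ (exteriorRegion n R))).congr_fun (fun z hz => ?_) hPm
    simp only [posPartPow, if_pos (selfSimilarFunction_pos hU hz)]
  rw [setIntegral_eq_exterior (R := R) hφW (fun z hz => ?_) (fun z hz hzP => ?_)]
  · refine (setIntegral_congr_fun hPm fun z hz => ?_).trans
      (integral_weak_formulation hU hγ₀ hγ₁ hR hφc (hsub.trans hKQ) (hφ.of_le (by simp)) hφ0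
        hreac)
    simp only [selfSimilarGradient, selfSimilarTimeDeriv, indicator_of_mem hz, posPartPow,
      if_pos (selfSimilarFunction_pos hU hz)]
    ring
  · simp [spatialDeriv_eq_zero hz, hφ0 z hz]
  · simp [selfSimilarGradient, selfSimilarTimeDeriv, indicator_of_notMem hzP, posPartPow,
      selfSimilarFunction_eq_zero hU (hKQ (hsub hz)) hzP, spatialDeriv, Prod.mk_zero_zero]

theorem IsInnerCylinder.measurableSet {A : Set (Spacetime n)} (hW : IsInnerCylinder A W) :
    MeasurableSet W := by
  obtain ⟨Ω, a, b, hΩ, -, rfl, -, -⟩ := hW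
  exact (hΩ.prod isOpen_Ioo).measurableSet

theorem mem_exteriorRegion_iff (hR : 0 < R) {z : Spacetime n} (hz : z ∈ upperSpacetime n) :
    z ∈ exteriorRegion n R ↔ R ^ 2 * z.2 < ‖z.1‖ ^ 2 := by
  have ht : 0 < z.2 := hz
  have h1 : z ∈ exteriorRegion n R ↔ R < similarityVar z := ⟨fun h => h.2, fun h => ⟨ht, h⟩⟩
  have hξ : 0 ≤ similarityVar z := mul_nonneg (Real.rpow_nonneg ht.le _) (norm_nonneg _)
  have h2 : ‖z.1‖ ^ 2 = similarityVar z ^ 2 * z.2 := by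
    rw [similarityVar]
    linear_combination (-‖z.1‖ ^ 2) * rpow_neg_half_sq_mul ht
  rw [h1, h2, mul_lt_mul_iff_of_pos_right ht, pow_lt_pow_iff_left₀ hR.le hξ two_ne_zero]

end Solutions

theorem mainTheorem3 (n : ℕ) (hn : 1 ≤ n) (γ : ℝ) (hγ₀ : 0 ≤ γ) (hγ₁ : γ ≤ 1)
    (R : ℝ) (hR : 0 < R) :
    (∃ U : ℝ → ℝ, IsSelfSimilarProfile n γ R U ∧ StrictMonoOn U (Set.Ici R) ∧
      ∃ c : ℝ, 0 < c ∧
        Filter.Tendsto (fun r => U r / r ^ scalingExponent γ) Filter.atTop (nhds c)) ∧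
    (∀ U : ℝ → ℝ, IsSelfSimilarProfile n γ R U →
      (0 < γ → IsWeakSolution γ (upperSpacetime n) (selfSimilarFunction n γ U)) ∧
      (γ = 0 → IsDomainVariationSolution γ (upperSpacetime n) (selfSimilarFunction n γ U)) ∧
      {z ∈ upperSpacetime n | selfSimilarFunction n γ U z = 0} =
        {z ∈ upperSpacetime n | ‖z.1‖ ^ 2 ≤ R ^ 2 * z.2}) := by
  refine ⟨exists_selfSimilarProfile hn hγ₀ hγ₁ hR, fun U hU => ⟨fun hγ W hW => ?_,
    fun _ W hW => ?_, ?_⟩⟩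
  · have hWm := hW.measurableSet
    obtain ⟨-, -, -, -, -, -, hK, hKQ⟩ := hW
    exact ⟨_, _, inEnergySpace_selfSimilarFunction hU hγ₀ hγ₁ hR hWm hK hKQ,
      integrableOn_posPartPow hU hγ hγ₁ hR hWm hK hKQ,
      weakFormulation_selfSimilarFunction hU hγ hγ₁ hR hWm hK hKQ,
      domainVariationFormulation_selfSimilarFunction hU hγ₀ hγ₁ hR hKQ⟩
  · have hWm := hW.measurableSet
    obtain ⟨-, -, -, -, -, -, hK, hKQ⟩ := hW
    exact ⟨_, _, inEnergySpace_selfSimilarFunction hU hγ₀ hγ₁ hR hWm hK hKQ,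
      domainVariationFormulation_selfSimilarFunction hU hγ₀ hγ₁ hR hKQ⟩
  · ext z
    refine and_congr_right fun hz => ?_
    rw [← not_lt, ← mem_exteriorRegion_iff hR hz]
    exact ⟨fun h hzP => (selfSimilarFunction_pos hU hzP).ne' h,
      selfSimilarFunction_eq_zero hU hz⟩
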